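/- **Setting.** Let $n\in\{2,3\}$, let $\Omega\subset\mathbb R^n$ be a bounded domain with polygonal/polyhedral boundary $\Gamma$ and without cracks (that is, $\Omega$ is the interior of its closure), and let $\Gamma_D\subseteq\Gamma$ have positive surface measure. Norms of vectors and tensors are Euclidean (Frobenius), $\|\cdot\|_{0}$ is the $L^2(\Omega)$-norm, $\|v\|_1^2=\|v\|_0^2+|v|_1^2$ with $|v|_1=\|\nabla v\|_0$; $(\nabla v)_{ij}=\partial_j v_i$; $\mathbf e(v)$ and $\boldsymbol\omega(v)$ are the symmetric and skew-symmetric parts of $\nabla v$; $\mathbf{div}$ acts on rows; $\tau^{\rm d}=\tau-\frac1n(\mathrm{tr}\,\tau)I$; $(u\otimes w)_{ij}=u_iw_j$. Data: $\gamma>0$; $\alpha\in\mathbb R^2$; $g\in\mathbb R^n$; a function $\nu:\mathbb R^2\to\mathbb R$ with $\nu_1\le\nu\le\nu_2$ and $|\nu(a)-\nu(b)|\le L_\nu|a-b|$ on $\mathbb R^2$, where $\nu_1,\nu_2,L_\nu>0$; $\mathbb K=\mathrm{diag}(k_1,k_2)$ with $k_i\in L^\infty(\Omega)$ and $k_i\ge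 k_0>0$ a.e., $\|\mathbb K\|_\infty=\max_i\|k_i\|_{L^\infty}$; and $\varphi_D\in H^{1/2}(\Gamma_D)^2$, the space of traces on $\Gamma_D$ of functions of $H^1(\Omega)^2$, normed by $\|\varphi_D\|_{1/2,\Gamma_D}=\min\{\|\varphi\|_1:\varphi\in H^1(\Omega)^2,\ \varphi|_{\Gamma_D}=\varphi_D\}$. (The vector of temperature and concentration has two components for both values of $n$.) **Spaces.** $\mathbb L^2_{\rm tr}$ is the space of symmetric trace-free tensor fields in $L^2(\Omega)^{n\times n}$; $\mathbb H_0(\mathbf{div})=\{\tau\in L^2(\Omega)^{n\times n}:\mathbf{div}\,\tau\in L^2(\Omega)^n,\ \int_\Omega\mathrm{tr}\,\tau=0\}$ with $\|\tau\|_{\mathbf{div}}^2=\|\tau\|_0^2+\|\mathbf{div}\,\tau\|_0^2$; $\mathbb H=\mathbb L^2_{\rm tr}\times\mathbb H_0(\mathbf{div})\times H^1_0(\Omega)^n$ with $\|(r,\tau,v)\|_{\mathbb H}^2=\|r\|_0^2+\|\tau\|_{\mathbf{div}}^2+\|v\|_1^2$; $H^1_{\Gamma_D}=\{\psi\in H^1(\Omega)^2:\psi|_{\Gamma_D}=0\}$;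 and, for $r>0$, $W_r=\{(w,\phi)\in H^1_0(\Omega)^n\times H^1(\Omega)^2:\|w\|_1+\|\phi\|_1\le r\}$. **Problem.** For $\vec t=(t,\sigma,u)$ and $\vec r=(r,\tau,v)$ in $\mathbb H$ put $$\begin{aligned}A_\phi(\vec t,\vec r)={}&2\int_\Omega\nu(\phi)\,t:(r-\kappa_3\tau^{\rm d})+\int_\Omega t:(\tau^{\rm d}-\kappa_1\mathbf e(v))-\int_\Omega\sigma^{\rm d}:(r-\kappa_3\tau^{\rm d})+(1-\kappa_2\gamma)\int_\Omega u\cdot\mathbf{div}\,\tau-\int_\Omega v\cdot\mathbf{div}\,\sigma\\&+\int_\Omega\boldsymbol\omega(u):\tau-\int_\Omega\sigma:\boldsymbol\omega(v)+\gamma\int_\Omega u\cdot v+\kappa_2\int_\Omega\mathbf{div}\,\sigma\cdot\mathbf{div}\,\tau+\kappa_1\int_\Omega\mathbf e(u):\mathbf e(v),\end{aligned}$$ $B_w(\vec t,\vec r)=\int_\Omega(u\otimes w)^{\rm d}:(\kappa_3\tau^{\rm d}-r)$, $F_\phi(\vec r)=\int_\Omega(\alpha\cdot\phi)\,g\cdot(v-\kappa_2\mathbf{div}\,\tau)$,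 $C(\chi,\psi)=\int_\Omega\mathbb K\nabla\chi:\nabla\psi$, $G_{w,\phi}(\psi)=-\int_\Omega(\nabla\phi)w\cdot\psi$. The semi-augmented mixed-primal problem is: find $(\vec t,\varphi)\in\mathbb H\times H^1(\Omega)^2$, $\vec t=(t,\sigma,u)$, with $\varphi|_{\Gamma_D}=\varphi_D$ and $$A_\varphi(\vec t,\vec r)+B_u(\vec t,\vec r)=F_\varphi(\vec r)\ \ \forall\,\vec r\in\mathbb H,\qquad C(\varphi,\psi)=G_{u,\varphi}(\psi)\ \ \forall\,\psi\in H^1_{\Gamma_D}.\tag{P}$$ **Constants.** $c_1=\|i\|^2$ with $i:H^1(\Omega)^n\to L^4(\Omega)^n$ the injection; $c_2$ is the best constant in $c_2\|\tau\|_0^2\le\|\tau^{\rm d}\|_0^2+\|\mathbf{div}\,\tau\|_0^2$ on $\mathbb H_0(\mathbf{div})$; $c_{\rm gp}$ is the best constant in $\|\psi\|_1\le c_{\rm gp}|\psi|_1$ on $H^1_{\Gamma_D}$; for $\varepsilon\in(0,1)$, $C_\varepsilon$ and $\widetilde C_\varepsilon$ are the norms of the injections $H^\varepsilon(\Omega)^{n\times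 n}\to L^{2n/(n-2\varepsilon)}(\Omega)^{n\times n}$ and $H^1(\Omega)^2\to L^{n/\varepsilon}(\Omega)^2$, where $\|\cdot\|_\varepsilon$ is the Sobolev–Slobodeckij norm. With parameters $\delta_1,\delta_2,\delta_3$, $$\alpha(\Omega)=\min\Big\{2\nu_1-\tfrac{\kappa_3\nu_2}{\delta_1}-\tfrac{\kappa_1}{2\delta_3},\ c_2\min\big\{\kappa_3(1-\nu_2\delta_1),\tfrac{\kappa_2}2(1-\tfrac{\gamma\delta_2}2)\big\},\ \tfrac{\kappa_2}2(1-\tfrac{\gamma\delta_2}2),\ \gamma(1-\tfrac{\kappa_2}{2\delta_2}),\ \tfrac{\kappa_1}2(1-\delta_3)\Big\},$$ $r_0=\dfrac{\alpha(\Omega)}{2c_1(2+\kappa_3^2)^{1/2}}$, $C_{\mathcal A}=\dfrac{2\sqrt2(2+\kappa_2^2)^{1/2}}{\alpha(\Omega)}$, $\widetilde\alpha=k_0c_{\rm gp}^{-2}$, $C_{\mathcal B}=\max\{\widetilde\alpha^{-1}c_1,\ \widetilde\alpha^{-1}\|\mathbb K\|_\infty+1\}$, $L_{\mathcal B}=rc_1/\widetilde\alpha$,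 $$L_{\mathcal A}=\tfrac2{\alpha(\Omega)}\max\big\{c_1(2+\kappa_3^2)^{1/2},\ 2L_\nu(2+\kappa_3^2)^{1/2}C_\varepsilon,\ \sqrt2(2+\kappa_2^2)^{1/2}\big\}.$$ **Theorem.** Let $\delta_1\in(0,\frac1{\nu_2})$, $\delta_2\in(0,\frac2\gamma)$, $\delta_3\in(0,1)$, $\kappa_3\in(0,\frac{2\nu_1\delta_1}{\nu_2})$, $\kappa_2\in(0,2\delta_2)$, $\kappa_1\in\big(0,2\delta_3(2\nu_1-\frac{\kappa_3\nu_2}{\delta_1})\big)$ and $r\in(0,r_0)$. Assume the following regularity: for some $\varepsilon\in(0,1)$ if $n=2$, $\varepsilon\in[\frac12,1)$ if $n=3$, and some $\widehat C(r)>0$, whenever $(w,\phi)\in W_r$ and $\vec t=(t,\sigma,u)\in\mathbb H$ satisfies $A_\phi(\vec t,\vec r)+B_w(\vec t,\vec r)=F_\phi(\vec r)$ for all $\vec r\in\mathbb H$, then $t\in H^\varepsilon(\Omega)^{n\times n}$ and $\|t\|_\varepsilon\le\widehat C(r)|\alpha||g|\|\phi\|_0$. Assume further $$rC_{\mathcal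 A}(1+rC_{\mathcal B})|\alpha||g|+C_{\mathcal B}\|\varphi_D\|_{1/2,\Gamma_D}\le r$$ and $L_{\rm Lip}<1$, where $$L_{\rm Lip}=rC_{\mathcal A}(1+L_{\mathcal B})L_{\mathcal A}|\alpha||g|+(1+L_{\mathcal B})L_{\mathcal A}|\alpha||g|\,(r\widetilde C_\varepsilon\widehat C(r)+1)+L_{\mathcal B}.$$ Then problem (P) has a unique solution $(\vec t,\varphi)=((t,\sigma,u),\varphi)\in\mathbb H\times H^1(\Omega)^2$ with $(u,\varphi)\in W_r$, and $$\|\vec t\|_{\mathbb H}\le C_{\mathcal A}\,r\,|\alpha|\,|g|,\qquad\|\varphi\|_1\le C_{\mathcal B}\big(r\|u\|_1+\|\varphi_D\|_{1/2,\Gamma_D}\big).$$ -/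

import Mathlib

open MeasureTheory Filter
open scoped ENNReal Topology ContDiff

namespace DoubleDiffusive

noncomputable section

/-- Vectors of `ℝᵐ` with the Euclidean norm. -/
abbrev E (m : ℕ) := EuclideanSpace ℝ (Fin m)

/-- Real `m × n` tensors; the inner product is `τ : ζ = ∑ τᵢⱼ ζᵢⱼ`, the norm is the Frobenius norm. -/
abbrev T (m n : ℕ) := EuclideanSpace ℝ (Fin m × Fin n)

/-! ### Pointwise tensor operations -/

/-- The trace of a square tensor. -/
def tr {n : ℕ} (τ : T n n) : ℝ := ∑ i, τ (i, i)

/-- The deviatoric part `τ - (tr τ / n) I`. -/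
def dev {n : ℕ} (τ : T n n) : T n n :=
  WithLp.toLp 2 fun p => τ p - if p.1 = p.2 then tr τ / n else 0

/-- The symmetric part; `symPart (∇v) = e(v)`. -/
def symPart {n : ℕ} (τ : T n n) : T n n :=
  WithLp.toLp 2 fun p => (τ (p.1, p.2) + τ (p.2, p.1)) / 2

/-- The skew-symmetric part; `skewPart (∇v) = ω(v)`. -/
def skewPart {n : ℕ} (τ : T n n) : T n n :=
  WithLp.toLp 2 fun p => (τ (p.1, p.2) - τ (p.2, p.1)) / 2

/-- The dyadic product `(v ⊗ w)ᵢⱼ = vᵢ wⱼ`. -/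
def dyad {m n : ℕ} (v : E m) (w : E n) : T m n :=
  WithLp.toLp 2 fun p => v p.1 * w p.2

/-- The matrix-vector product `(τ w)ᵢ = ∑ⱼ τᵢⱼ wⱼ`. -/
def tmul {m n : ℕ} (τ : T m n) (w : E n) : E m :=
  WithLp.toLp 2 fun i => ∑ j, τ (i, j) * w j

/-- The product of the diagonal matrix `diag(d)` with a tensor. -/
def diagMul {m n : ℕ} (d : Fin m → ℝ) (τ : T m n) : T m n :=
  WithLp.toLp 2 fun p => d p.1 * τ p

/-- The classical gradient `(∇η)ᵢⱼ = ∂ηᵢ/∂xⱼ`. -/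
def gradField {m n : ℕ} (η : E n → E m) (x : E n) : T m n :=
  WithLp.toLp 2 fun p => fderiv ℝ η x (EuclideanSpace.single p.2 1) p.1

/-! ### The domain -/

/-- A bounded domain (nonempty connected open set) of `ℝⁿ` with polygonal/polyhedral boundary: the
boundary is covered by finitely many affine hyperplanes, and the domain has no cracks
(it is the interior of its closure). -/
structure PolyhedralDomain (n : ℕ) where
  carrier : Set (E n)
  isOpen : IsOpen carrier
  isConnected : IsConnected carrier
  isBounded : Bornology.IsBounded carrier
  interior_closure : interior (closure carrier) = carrier
  polyhedral : ∃ S : Finset (E n × ℝ), (∀ h ∈ S, h.1 ≠ 0) ∧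
    frontier carrier ⊆ ⋃ h ∈ S, {x | inner ℝ h.1 x = h.2}

/-- The boundary `Γ`. -/
def PolyhedralDomain.boundary {n : ℕ} (Ω : PolyhedralDomain n) : Set (E n) := frontier Ω.carrier

/-- Lebesgue measure on `Ω`. -/
def PolyhedralDomain.vol {n : ℕ} (Ω : PolyhedralDomain n) : Measure (E n) :=
  volume.restrict Ω.carrier

instance {n : ℕ} (Ω : PolyhedralDomain n) : IsFiniteMeasure Ω.vol :=
  ⟨by simpa [PolyhedralDomain.vol] using Ω.isBounded.measure_lt_top⟩

/-- The `(n-1)`-dimensional surface measure on a part of the boundary (Hausdorff measure). -/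
def surf {n : ℕ} (S : Set (E n)) : Measure (E n) :=
  (Measure.hausdorffMeasure ((n : ℝ) - 1)).restrict S

variable {n : ℕ}

/-- `L²(Ω; V)`. -/
abbrev L2 (Ω : PolyhedralDomain n) (V : Type) [NormedAddCommGroup V] := Lp V 2 Ω.vol

/-! ### Test functions, weak gradient and weak divergence -/

/-- `η ∈ C_c^∞(Ω; V)`. -/
def IsTest (Ω : PolyhedralDomain n) {V : Type} [NormedAddCommGroup V] [NormedSpace ℝ V]
    (η : E n → V) : Prop :=
  ContDiff ℝ ∞ η ∧ HasCompactSupport η ∧ tsupport η ⊆ Ω.carrier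

/-- `∂η/∂xⱼ`. -/
def pd (η : E n → ℝ) (j : Fin n) (x : E n) : ℝ := fderiv ℝ η x (EuclideanSpace.single j 1)

/-- `G` is the weak gradient of `u`. -/
def IsWeakGrad (Ω : PolyhedralDomain n) {m : ℕ} (u : L2 Ω (E m)) (G : L2 Ω (T m n)) : Prop :=
  ∀ η : E n → ℝ, IsTest Ω η → ∀ i j,
    ∫ x, u x i * pd η j x ∂Ω.vol = -∫ x, G x (i, j) * η x ∂Ω.vol

/-- `d` is the weak row-wise divergence of `τ`. -/
def IsWeakDiv (Ω : PolyhedralDomain n) (τ : L2 Ω (T n n)) (d : L2 Ω (E n)) : Prop :=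
  ∀ η : E n → ℝ, IsTest Ω η → ∀ i,
    ∑ j, ∫ x, τ x (i, j) * pd η j x ∂Ω.vol = -∫ x, d x i * η x ∂Ω.vol

lemma IsTest.memLp {Ω : PolyhedralDomain n} {η : E n → ℝ} (h : IsTest Ω η) :
    MemLp η 2 Ω.vol :=
  (h.1.continuous.memLp_of_hasCompactSupport h.2.1 (μ := volume)).restrict _

lemma IsTest.memLp_pd {Ω : PolyhedralDomain n} {η : E n → ℝ} (h : IsTest Ω η) (j : Fin n) :
    MemLp (pd η j) 2 Ω.vol := by
  refine (Continuous.memLp_of_hasCompactSupport (μ := volume) ?_ ?_).restrict _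
  · exact (h.1.continuous_fderiv (by simp)).clm_apply continuous_const
  · exact h.2.1.fderiv_apply (𝕜 := ℝ) _

lemma memLp_coord {ι : Type} [Fintype ι] {Ω : PolyhedralDomain n}
    (u : L2 Ω (EuclideanSpace ℝ ι)) (i : ι) : MemLp (fun x => u x i) 2 Ω.vol :=
  (EuclideanSpace.proj i : EuclideanSpace ℝ ι →L[ℝ] ℝ).comp_memLp' (Lp.memLp u)

lemma integrable_coord_mul {ι : Type} [Fintype ι] {Ω : PolyhedralDomain n}
    (u : L2 Ω (EuclideanSpace ℝ ι)) (i : ι) {η : E n → ℝ} (h : MemLp η 2 Ω.vol) :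
    Integrable (fun x => u x i * η x) Ω.vol :=
  (memLp_coord u i).integrable_mul h

lemma integral_add_coord {ι : Type} [Fintype ι] {Ω : PolyhedralDomain n}
    (u v : L2 Ω (EuclideanSpace ℝ ι)) (i : ι) {η : E n → ℝ} (h : MemLp η 2 Ω.vol) :
    ∫ x, (u + v) x i * η x ∂Ω.vol = ∫ x, u x i * η x ∂Ω.vol + ∫ x, v x i * η x ∂Ω.vol := by
  rw [← integral_add (integrable_coord_mul u i h) (integrable_coord_mul v i h)]
  refine integral_congr_ae ?_
  filter_upwards [Lp.coeFn_add u v] with x hx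
  rw [hx]
  simp [add_mul]

lemma integral_smul_coord {ι : Type} [Fintype ι] {Ω : PolyhedralDomain n}
    (c : ℝ) (u : L2 Ω (EuclideanSpace ℝ ι)) (i : ι) (η : E n → ℝ) :
    ∫ x, (c • u) x i * η x ∂Ω.vol = c * ∫ x, u x i * η x ∂Ω.vol := by
  rw [← integral_const_mul]
  refine integral_congr_ae ?_
  filter_upwards [Lp.coeFn_smul c u] with x hx
  rw [hx]
  simp [mul_assoc]

lemma integral_zero_coord {ι : Type} [Fintype ι] {Ω : PolyhedralDomain n} (i : ι) (η : E n → ℝ) :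
    ∫ x, (0 : L2 Ω (EuclideanSpace ℝ ι)) x i * η x ∂Ω.vol = 0 := by
  rw [← integral_zero (E n) ℝ (μ := Ω.vol)]
  refine integral_congr_ae ?_
  filter_upwards [Lp.coeFn_zero (EuclideanSpace ℝ ι) 2 Ω.vol] with x hx
  rw [hx]
  simp

/-! ### Function spaces -/

/-- Pairs (function, gradient); the norm is `(‖u‖₀² + ‖∇u‖₀²)^{1/2}`. -/
abbrev SobPair (Ω : PolyhedralDomain n) (m : ℕ) := WithLp 2 (L2 Ω (E m) × L2 Ω (T m n))

/-- `H¹(Ω; ℝᵐ)`: an element is the pair of a function and its (unique) weak gradient. -/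
def H1 (Ω : PolyhedralDomain n) (m : ℕ) : Submodule ℝ (SobPair Ω m) where
  carrier := {p | IsWeakGrad Ω p.fst p.snd}
  add_mem' {p q} hp hq η hη i j := by
    simp only [WithLp.add_fst, WithLp.add_snd]
    rw [integral_add_coord _ _ _ (hη.memLp_pd j), integral_add_coord _ _ _ hη.memLp,
      hp η hη i j, hq η hη i j]
    ring
  zero_mem' η _ i j := by
    simp only [WithLp.zero_fst, WithLp.zero_snd]
    rw [integral_zero_coord, integral_zero_coord, neg_zero]
  smul_mem' c p hp η hη i j := by
    simp only [WithLp.smul_fst, WithLp.smul_snd]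
    rw [integral_smul_coord, integral_smul_coord, hp η hη i j]
    ring

/-- `C_c^∞(Ω; ℝᵐ)` inside the space of pairs. -/
def testPairs (Ω : PolyhedralDomain n) (m : ℕ) : Submodule ℝ (SobPair Ω m) where
  carrier := {p | ∃ η : E n → E m, IsTest Ω η ∧ p.fst =ᵐ[Ω.vol] η ∧ p.snd =ᵐ[Ω.vol] gradField η}
  add_mem' := by
    rintro p q ⟨η, hη, hp, hp'⟩ ⟨ζ, hζ, hq, hq'⟩
    refine ⟨η + ζ, ⟨hη.1.add hζ.1, hη.2.1.add hζ.2.1, ?_⟩, ?_, ?_⟩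
    · exact (tsupport_add η ζ).trans (Set.union_subset hη.2.2 hζ.2.2)
    · filter_upwards [Lp.coeFn_add p.fst q.fst, hp, hq] with x h h1 h2
      rw [WithLp.add_fst, h, Pi.add_apply, h1, h2, Pi.add_apply]
    · filter_upwards [Lp.coeFn_add p.snd q.snd, hp', hq'] with x h h1 h2
      rw [WithLp.add_snd, h, Pi.add_apply, h1, h2]
      ext a
      simp [gradField, fderiv_add (hη.1.differentiable (by simp) x)
        (hζ.1.differentiable (by simp) x)]
  zero_mem' := by
    refine ⟨0, ⟨contDiff_const, HasCompactSupport.zero, by simp⟩, ?_, ?_⟩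
    · exact Lp.coeFn_zero _ _ _
    · filter_upwards [Lp.coeFn_zero (T m n) 2 Ω.vol] with x h
      rw [WithLp.zero_snd, h]
      ext a
      simp [gradField]
  smul_mem' := by
    rintro c p ⟨η, hη, hp, hp'⟩
    refine ⟨c • η, ⟨hη.1.const_smul c, hη.2.1.smul_left, ?_⟩, ?_, ?_⟩
    · exact (tsupport_smul_subset_right (fun _ => c) η).trans hη.2.2
    · filter_upwards [Lp.coeFn_smul c p.fst, hp] with x h h1
      rw [WithLp.smul_fst, h, Pi.smul_apply, h1, Pi.smul_apply]
    · filter_upwards [Lp.coeFn_smul c p.snd, hp'] with x h h1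
      rw [WithLp.smul_snd, h, Pi.smul_apply, h1]
      ext a
      simp [gradField, fderiv_const_smul (hη.1.differentiable (by simp) x)]

/-- `H¹₀(Ω; ℝᵐ)`: the closure of `C_c^∞(Ω; ℝᵐ)` in the `H¹`-norm. -/
def H10 (Ω : PolyhedralDomain n) (m : ℕ) : Submodule ℝ (SobPair Ω m) :=
  (testPairs Ω m).topologicalClosure

/-- `H₀(div; Ω)`: an element is the pair of a tensor field with `∫ tr τ = 0` and its weak
divergence; the norm is `(‖τ‖₀² + ‖div τ‖₀²)^{1/2}`. -/
def Hdiv0 (Ω : PolyhedralDomain n) : Submodule ℝ (WithLp 2 (L2 Ω (T n n) × L2 Ω (E n))) where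
  carrier := {p | IsWeakDiv Ω p.fst p.snd ∧ ∑ i, ∫ x, p.fst x (i, i) * 1 ∂Ω.vol = 0}
  add_mem' {p q} hp hq := by
    refine ⟨fun η hη i => ?_, ?_⟩
    · simp only [WithLp.add_fst, WithLp.add_snd]
      simp_rw [fun j => integral_add_coord p.fst q.fst (i, j) (hη.memLp_pd j)]
      rw [integral_add_coord _ _ _ hη.memLp, Finset.sum_add_distrib, hp.1 η hη i, hq.1 η hη i]
      ring
    · simp only [WithLp.add_fst]
      simp_rw [fun i => integral_add_coord p.fst q.fst (i, i) (memLp_const (1 : ℝ))]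
      rw [Finset.sum_add_distrib, hp.2, hq.2, add_zero]
  zero_mem' := by
    refine ⟨fun η _ i => ?_, ?_⟩
    · simp only [WithLp.zero_fst, WithLp.zero_snd]
      simp_rw [integral_zero_coord]
      simp
    · simp only [WithLp.zero_fst]
      simp_rw [fun i => integral_zero_coord (Ω := Ω) (i, i) (fun _ => (1 : ℝ))]
      simp
  smul_mem' c p hp := by
    refine ⟨fun η hη i => ?_, ?_⟩
    · simp only [WithLp.smul_fst, WithLp.smul_snd]
      simp_rw [integral_smul_coord]
      rw [← Finset.mul_sum, hp.1 η hη i]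
      ring
    · simp only [WithLp.smul_fst]
      simp_rw [fun i => integral_smul_coord c p.fst (i, i) (fun _ => (1 : ℝ))]
      rw [← Finset.mul_sum, hp.2, mul_zero]

/-- `L²_tr(Ω)`: symmetric trace-free square-integrable tensor fields. -/
def Ltr (Ω : PolyhedralDomain n) : Submodule ℝ (L2 Ω (T n n)) where
  carrier := {r | ∀ᵐ x ∂Ω.vol, (∀ i j, r x (i, j) = r x (j, i)) ∧ tr (r x) = 0}
  add_mem' {r s} hr hs := by
    filter_upwards [hr, hs, Lp.coeFn_add r s] with x h1 h2 h
    rw [h]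
    refine ⟨fun i j => by simp [h1.1 i j, h2.1 i j], ?_⟩
    have a := h1.2
    have b := h2.2
    simp only [tr] at a b
    simp [tr, Finset.sum_add_distrib, a, b]
  zero_mem' := by
    filter_upwards [Lp.coeFn_zero (T n n) 2 Ω.vol] with x h
    rw [h]
    simp [tr]
  smul_mem' c r hr := by
    filter_upwards [hr, Lp.coeFn_smul c r] with x h1 h
    rw [h]
    refine ⟨fun i j => by simp [h1.1 i j], ?_⟩
    have a := h1.2
    simp only [tr] at a
    simp [tr, ← Finset.mul_sum, a]

/-- `ℍ = L²_tr(Ω) × H₀(div; Ω) × H¹₀(Ω)` with its natural Hilbert norm. -/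
abbrev HH (Ω : PolyhedralDomain n) := WithLp 2 (Ltr Ω × WithLp 2 (Hdiv0 Ω × H10 Ω n))

/-- The component `t` of `(t, σ, u) ∈ ℍ`. -/
def HH.t {Ω : PolyhedralDomain n} (x : HH Ω) : L2 Ω (T n n) := x.fst.1
/-- The component `σ` of `(t, σ, u) ∈ ℍ`. -/
def HH.σ {Ω : PolyhedralDomain n} (x : HH Ω) : L2 Ω (T n n) := x.snd.fst.1.fst
/-- `div σ` for `(t, σ, u) ∈ ℍ`. -/
def HH.divσ {Ω : PolyhedralDomain n} (x : HH Ω) : L2 Ω (E n) := x.snd.fst.1.snd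
/-- The component `u` of `(t, σ, u) ∈ ℍ`, as an element of `H¹₀(Ω)`. -/
def HH.vel {Ω : PolyhedralDomain n} (x : HH Ω) : H10 Ω n := x.snd.snd
/-- The component `u` of `(t, σ, u) ∈ ℍ`, as a vector field. -/
def HH.u {Ω : PolyhedralDomain n} (x : HH Ω) : L2 Ω (E n) := x.snd.snd.1.fst
/-- `∇u` for `(t, σ, u) ∈ ℍ`. -/
def HH.gradu {Ω : PolyhedralDomain n} (x : HH Ω) : L2 Ω (T n n) := x.snd.snd.1.snd

/-! ### Traces -/

/-- `φ|_Γ_D = g` in the sense of traces: `g` is the `L²(Γ_D)`-limit of the restrictions to `Γ_D` of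
functions smooth up to the boundary that converge to `φ` in `H¹(Ω)`. -/
def HasTrace {Ω : PolyhedralDomain n} {ΓD : Set (E n)} {m : ℕ} (φ : H1 Ω m)
    (g : Lp (E m) 2 (surf ΓD)) : Prop :=
  ∃ η : ℕ → E n → E m, (∀ k, ContDiff ℝ ∞ (η k)) ∧
    Tendsto (fun k => eLpNorm (fun x => η k x - φ.1.fst x) 2 Ω.vol) atTop (𝓝 0) ∧
    Tendsto (fun k => eLpNorm (fun x => gradField (η k) x - φ.1.snd x) 2 Ω.vol) atTop (𝓝 0) ∧
    Tendsto (fun k => eLpNorm (fun x => η k x - g x) 2 (surf ΓD)) atTop (𝓝 0)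

/-- `H¹_{Γ_D}(Ω)` (two components): the functions of `H¹(Ω)` with vanishing trace on `Γ_D`. -/
def H1D (Ω : PolyhedralDomain n) (ΓD : Set (E n)) : Set (H1 Ω 2) :=
  {ψ | HasTrace ψ (0 : Lp (E 2) 2 (surf ΓD))}

/-- `H^{1/2}(Γ_D)`: the traces on `Γ_D` of the functions of `H¹(Ω)`. -/
def HHalf (Ω : PolyhedralDomain n) (ΓD : Set (E n)) : Set (Lp (E 2) 2 (surf ΓD)) :=
  {g | ∃ φ : H1 Ω 2, HasTrace φ g}

/-- `‖g‖_{1/2,Γ_D}`: the least `H¹`-norm of an extension of `g` to `Ω`. -/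
def halfNorm (Ω : PolyhedralDomain n) {ΓD : Set (E n)} (g : Lp (E 2) 2 (surf ΓD)) : ℝ :=
  sInf {a | ∃ φ : H1 Ω 2, HasTrace φ g ∧ a = ‖φ‖}

/-! ### The variational problem -/

/-- The form `A_φ`. -/
def formA (Ω : PolyhedralDomain n) (ν : E 2 → ℝ) (γ κ₁ κ₂ κ₃ : ℝ) (φ : H1 Ω 2) (x y : HH Ω) : ℝ :=
  2 * ∫ ξ, ν (φ.1.fst ξ) * inner ℝ (x.t ξ) (y.t ξ - κ₃ • dev (y.σ ξ)) ∂Ω.vol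
  + ∫ ξ, inner ℝ (x.t ξ) (dev (y.σ ξ) - κ₁ • symPart (y.gradu ξ)) ∂Ω.vol
  - ∫ ξ, inner ℝ (dev (x.σ ξ)) (y.t ξ - κ₃ • dev (y.σ ξ)) ∂Ω.vol
  + (1 - κ₂ * γ) * ∫ ξ, inner ℝ (x.u ξ) (y.divσ ξ) ∂Ω.vol
  - ∫ ξ, inner ℝ (y.u ξ) (x.divσ ξ) ∂Ω.vol
  + ∫ ξ, inner ℝ (skewPart (x.gradu ξ)) (y.σ ξ) ∂Ω.vol
  - ∫ ξ, inner ℝ (x.σ ξ) (skewPart (y.gradu ξ)) ∂Ω.vol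
  + γ * ∫ ξ, inner ℝ (x.u ξ) (y.u ξ) ∂Ω.vol
  + κ₂ * ∫ ξ, inner ℝ (x.divσ ξ) (y.divσ ξ) ∂Ω.vol
  + κ₁ * ∫ ξ, inner ℝ (symPart (x.gradu ξ)) (symPart (y.gradu ξ)) ∂Ω.vol

/-- The form `B_w`. -/
def formB (Ω : PolyhedralDomain n) (κ₃ : ℝ) (w : H10 Ω n) (x y : HH Ω) : ℝ :=
  ∫ ξ, inner ℝ (dev (dyad (x.u ξ) (w.1.fst ξ))) (κ₃ • dev (y.σ ξ) - y.t ξ) ∂Ω.vol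

/-- The functional `F_φ`. -/
def formF (Ω : PolyhedralDomain n) (κ₂ : ℝ) (α : E 2) (g : E n) (φ : H1 Ω 2) (y : HH Ω) : ℝ :=
  ∫ ξ, inner ℝ α (φ.1.fst ξ) * inner ℝ g (y.u ξ - κ₂ • y.divσ ξ) ∂Ω.vol

/-- The form `C`, for the diffusion tensor `K = diag(k₁, k₂)`. -/
def formC (Ω : PolyhedralDomain n) (k : Fin 2 → E n → ℝ) (χ ψ : H1 Ω 2) : ℝ :=
  ∫ ξ, inner ℝ (diagMul (fun i => k i ξ) (χ.1.snd ξ)) (ψ.1.snd ξ) ∂Ω.vol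

/-- The functional `G_{w,φ}`. -/
def formG (Ω : PolyhedralDomain n) (w : H10 Ω n) (φ ψ : H1 Ω 2) : ℝ :=
  -∫ ξ, inner ℝ (tmul (φ.1.snd ξ) (w.1.fst ξ)) (ψ.1.fst ξ) ∂Ω.vol

/-- `x` solves the decoupled flow problem with given `(w, φ)`, that is `x = 𝒜(w, φ)`. -/
def SolvesFlow (Ω : PolyhedralDomain n) (ν : E 2 → ℝ) (γ κ₁ κ₂ κ₃ : ℝ) (α : E 2) (g : E n)
    (w : H10 Ω n) (φ : H1 Ω 2) (x : HH Ω) : Prop :=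
  ∀ y : HH Ω, formA Ω ν γ κ₁ κ₂ κ₃ φ x y + formB Ω κ₃ w x y = formF Ω κ₂ α g φ y

/-- `(x, φ)`, with `x = (t, σ, u)`, solves the semi-augmented mixed-primal problem. -/
def IsSolution (Ω : PolyhedralDomain n) {ΓD : Set (E n)} (ν : E 2 → ℝ) (γ κ₁ κ₂ κ₃ : ℝ)
    (α : E 2) (g : E n) (k : Fin 2 → E n → ℝ) (φD : Lp (E 2) 2 (surf ΓD))
    (x : HH Ω) (φ : H1 Ω 2) : Prop :=
  HasTrace φ φD ∧ SolvesFlow Ω ν γ κ₁ κ₂ κ₃ α g x.vel φ x ∧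
    ∀ ψ ∈ H1D Ω ΓD, formC Ω k φ ψ = formG Ω x.vel φ ψ

/-- The norm `‖t‖_{ε,Ω}` of `H^ε(Ω)`, `0 < ε < 1` (Sobolev–Slobodeckij); it is `∞` off `H^ε(Ω)`. -/
def fracNorm {Ω : PolyhedralDomain n} (ε : ℝ) (t : L2 Ω (T n n)) : ℝ≥0∞ :=
  (‖t‖ₑ ^ 2 + ∫⁻ x, ∫⁻ y, ‖t x - t y‖ₑ ^ 2 / ENNReal.ofReal (‖x - y‖ ^ (n + 2 * ε))
    ∂Ω.vol ∂Ω.vol) ^ (1 / 2 : ℝ)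

/-! ### Constants

The constants of the functional inequalities are the best ones, as elements of `[0, ∞]`. -/

/-- The norm of the injection `H¹(Ω; ℝᵐ) → L^q(Ω; ℝᵐ)`. -/
def sobolevConst (Ω : PolyhedralDomain n) (m : ℕ) (q : ℝ≥0∞) : ℝ≥0∞ :=
  sInf {c | ∀ u : H1 Ω m, eLpNorm u.1.fst q Ω.vol ≤ c * ‖u‖ₑ}

/-- `c₁(Ω) = ‖i‖²`, with `i` the injection of `H¹(Ω)` into `L⁴(Ω)`. -/
def c1 (Ω : PolyhedralDomain n) : ℝ≥0∞ := sobolevConst Ω n 4 ^ 2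

/-- `c₂(Ω)`: the best constant in `c₂ ‖τ‖₀² ≤ ‖τᵈ‖₀² + ‖div τ‖₀²` on `H₀(div; Ω)`. -/
def c2 (Ω : PolyhedralDomain n) : ℝ :=
  sSup {c | ∀ τ : Hdiv0 Ω,
    c * ‖τ.1.fst‖ ^ 2 ≤ ∫ ξ, ‖dev (τ.1.fst ξ)‖ ^ 2 ∂Ω.vol + ‖τ.1.snd‖ ^ 2}

/-- `c_gp`: the best constant in `‖ψ‖₁ ≤ c_gp |ψ|₁` on `H¹_{Γ_D}(Ω)`. -/
def cgp (Ω : PolyhedralDomain n) (ΓD : Set (E n)) : ℝ≥0∞ :=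
  sInf {c | ∀ ψ ∈ H1D Ω ΓD, ‖ψ‖ₑ ≤ c * ‖ψ.1.snd‖ₑ}

/-- `C_ε`: the norm of the injection of `H^ε(Ω)` into `L^{2n/(n-2ε)}(Ω)`, for tensor fields. -/
def Ceps (Ω : PolyhedralDomain n) (ε : ℝ) : ℝ≥0∞ :=
  sInf {c | ∀ t : L2 Ω (T n n), fracNorm ε t < ⊤ →
    eLpNorm t (ENNReal.ofReal (2 * n / (n - 2 * ε))) Ω.vol ≤ c * fracNorm ε t}

/-- The norm of the injection of `H¹(Ω)` into `L^{n/ε}(Ω)`. -/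
def Ceps' (Ω : PolyhedralDomain n) (ε : ℝ) : ℝ≥0∞ := sobolevConst Ω 2 (ENNReal.ofReal (n / ε))

/-- The ellipticity constant `α(Ω)` of the forms `A_φ`. -/
def ellA (Ω : PolyhedralDomain n) (ν₁ ν₂ γ κ₁ κ₂ κ₃ δ₁ δ₂ δ₃ : ℝ) : ℝ :=
  min (2 * ν₁ - κ₃ * ν₂ / δ₁ - κ₁ / (2 * δ₃))
    (min (c2 Ω * min (κ₃ * (1 - ν₂ * δ₁)) (κ₂ / 2 * (1 - γ * δ₂ / 2)))
      (min (κ₂ / 2 * (1 - γ * δ₂ / 2))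
        (min (γ * (1 - κ₂ / (2 * δ₂))) (κ₁ / 2 * (1 - δ₃)))))

/-- The radius `r₀ = α(Ω) / (2 c₁(Ω) (2 + κ₃²)^{1/2})`; here `a = α(Ω)`. -/
def r0 (Ω : PolyhedralDomain n) (a κ₃ : ℝ) : ℝ≥0∞ :=
  ENNReal.ofReal a / (2 * c1 Ω * ENNReal.ofReal (√(2 + κ₃ ^ 2)))

/-- `C_𝒜 = 2 √2 (2 + κ₂²)^{1/2} / α(Ω)`; here `a = α(Ω)`. -/
def CA (a κ₂ : ℝ) : ℝ := 2 * √2 * √(2 + κ₂ ^ 2) / a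

/-- `‖K‖_{∞,Ω}` for `K = diag(k₁, k₂)`. -/
def normK (Ω : PolyhedralDomain n) (k : Fin 2 → E n → ℝ) : ℝ≥0∞ := ⨆ i, eLpNorm (k i) ⊤ Ω.vol

/-- The ellipticity constant of `C` on `H¹_{Γ_D}(Ω)`. -/
def ellC (Ω : PolyhedralDomain n) (ΓD : Set (E n)) (k₀ : ℝ) : ℝ≥0∞ :=
  ENNReal.ofReal k₀ / cgp Ω ΓD ^ 2

/-- `C_ℬ`. -/
def CB (Ω : PolyhedralDomain n) (ΓD : Set (E n)) (k : Fin 2 → E n → ℝ) (k₀ : ℝ) : ℝ≥0∞ :=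
  max ((ellC Ω ΓD k₀)⁻¹ * c1 Ω) ((ellC Ω ΓD k₀)⁻¹ * normK Ω k + 1)

/-- `L_𝒜`; here `a = α(Ω)`. -/
def LA (Ω : PolyhedralDomain n) (a Lν κ₂ κ₃ ε : ℝ) : ℝ≥0∞ :=
  ENNReal.ofReal (2 / a) *
    max (c1 Ω * ENNReal.ofReal √(2 + κ₃ ^ 2))
      (max (ENNReal.ofReal (2 * Lν * √(2 + κ₃ ^ 2)) * Ceps Ω ε)
        (ENNReal.ofReal (√2 * √(2 + κ₂ ^ 2))))

/-- `L_ℬ`. -/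
def LB (Ω : PolyhedralDomain n) (ΓD : Set (E n)) (k₀ r : ℝ) : ℝ≥0∞ :=
  ENNReal.ofReal r * c1 Ω / ellC Ω ΓD k₀

/-- `L_Lip`; here `a = α(Ω)`, `d = |α| |g|`, and `Chat` is the constant of the `ε`-regularity
estimate. -/
def LLip (Ω : PolyhedralDomain n) (ΓD : Set (E n)) (a Lν κ₂ κ₃ ε k₀ r Chat d : ℝ) : ℝ≥0∞ :=
  ENNReal.ofReal (r * CA a κ₂) * (1 + LB Ω ΓD k₀ r) * LA Ω a Lν κ₂ κ₃ ε * ENNReal.ofReal d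
  + (1 + LB Ω ΓD k₀ r) * LA Ω a Lν κ₂ κ₃ ε * ENNReal.ofReal d *
      (ENNReal.ofReal r * Ceps' Ω ε * ENNReal.ofReal Chat + 1)
  + LB Ω ΓD k₀ r

end

end DoubleDiffusive

open DoubleDiffusive

/-!
Freezing the viscosity and the buoyancy at `φ` and the convective velocity at `w` decouples the
system. The flow problem becomes linear, and under the conditions on `κᵢ` and `δᵢ` the form `A_φ` is
elliptic with constant `α(Ω)`; as `|B_w| ≤ c₁ (2 + κ₃²)^{1/2} ‖w‖₁`, half of the ellipticity
survives for `‖w‖₁ ≤ r < r₀`. The Lax–Milgram theorem then yields `t⃗ = 𝒜(w, φ)` with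
`‖t⃗‖ ≤ r C_𝒜 |α| |g|`, and, applied on `H¹_{Γ_D}` after lifting the Dirichlet datum, the
solution `ℬ(u, φ)` of the transport problem with the bound of the theorem.

The solutions of the coupled problem are the fixed points of `(w, φ) ↦ (u, ℬ(u, φ))`, where `u` is
the velocity component of `𝒜(w, φ)`. The smallness assumption says that this map sends `W_r` into
itself. It is Lipschitz with constant `L_Lip` for the norm `‖w‖₁ + ‖φ‖₁`: the term
`(ν(φ) - ν(φ')) t`, which is only a product of two `L²` functions a priori, is controlled by
Hölder's inequality with `t ∈ L^{2n/(n-2ε)}` (from the `ε`-regularity) and `φ - φ' ∈ L^{n/ε}`. The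
contraction principle concludes.
-/

namespace DoubleDiffusive

noncomputable section

/-! ### Lax–Milgram and coupled fixed points -/

section Abstract

section LaxMilgram

variable {V : Type*} [NormedAddCommGroup V] [InnerProductSpace ℝ V] [CompleteSpace V]

lemma exists_forall_eq_of_coercive (B : V →L[ℝ] V →L[ℝ] ℝ) (F : V →L[ℝ] ℝ) {c : ℝ} (hc : 0 < c)
    (hB : ∀ v, c * ‖v‖ ^ 2 ≤ B v v) : ∃ v, ∀ w, B v w = F w := by
  have hcoercive : IsCoercive B := ⟨c, hc, fun v => by simpa only [sq, mul_assoc] using hB v⟩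
  refine ⟨hcoercive.continuousLinearEquivOfBilin.symm ((InnerProductSpace.toDual ℝ V).symm F),
    fun w => ?_⟩
  rw [← hcoercive.continuousLinearEquivOfBilin_apply, ContinuousLinearEquiv.apply_symm_apply,
    InnerProductSpace.toDual_symm_apply]

lemma exists_mem_forall_eq_of_coercive (B : V →L[ℝ] V →L[ℝ] ℝ) (F : V →L[ℝ] ℝ)
    {S : Submodule ℝ V} (hS : IsClosed (S : Set V)) {c : ℝ} (hc : 0 < c)
    (hB : ∀ v ∈ S, c * ‖v‖ ^ 2 ≤ B v v) : ∃ v ∈ S, ∀ w ∈ S, B v w = F w := by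
  have : CompleteSpace S := hS.completeSpace_coe
  obtain ⟨v, hv⟩ := exists_forall_eq_of_coercive (B.bilinearComp S.subtypeL S.subtypeL)
    (F ∘L S.subtypeL) hc fun v => hB v v.2
  exact ⟨v, v.2, fun w hw => hv ⟨w, hw⟩⟩

end LaxMilgram

lemma mul_le_of_mul_sq_le {c N z : ℝ} (hN : 0 ≤ N) (hz : 0 ≤ z) (h : c * z ^ 2 ≤ N * z) :
    c * z ≤ N := by
  rcases hz.eq_or_lt with rfl | hz
  · simpa only [mul_zero] using hN
  · exact le_of_mul_le_mul_right (by linarith [mul_assoc c z z, sq z]) hz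

lemma existsUnique_fixedPoint_of_relation {X : Type*} [MetricSpace X] [CompleteSpace X]
    {S : Set X} (hS : IsClosed S) (hne : S.Nonempty) {R : X → X → Prop} {K : ℝ≥0∞} (hK : K < 1)
    (hex : ∀ p ∈ S, ∃ q ∈ S, R p q)
    (hlip : ∀ p ∈ S, ∀ p' ∈ S, ∀ q q', R p q → R p' q' → edist q q' ≤ K * edist p p') :
    ∃! p, p ∈ S ∧ R p p := by
  choose f hfS hfR using hex
  have : CompleteSpace S := hS.completeSpace_coe
  have : Nonempty S := hne.to_subtype
  lift K to NNReal using hK.ne_top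
  have hcontr : ContractingWith K fun p : S => (⟨f p p.2, hfS p p.2⟩ : S) :=
    ⟨by exact_mod_cast hK, fun p q => hlip p p.2 q q.2 _ _ (hfR _ _) (hfR _ _)⟩
  obtain ⟨p, hp⟩ : ∃ p : S, f p p.2 = p :=
    ⟨_, congrArg Subtype.val hcontr.fixedPoint_isFixedPt⟩
  have hRp : R p p := by simpa only [hp] using hfR p p.2
  refine ⟨p, ⟨p.2, hRp⟩, fun q ⟨hqS, hRq⟩ => ?_⟩
  by_contra hne
  have hle := hlip q hqS p p.2 q p hRq hRp
  refine hle.not_gt ?_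
  calc (K : ℝ≥0∞) * edist q p < 1 * edist q p :=
        ENNReal.mul_lt_mul_left (edist_pos.2 hne).ne' (edist_ne_top q p) hK
    _ = edist q p := one_mul _

lemma add_le_contraction_mul_add {K₁ K₂ L s t a b : ℝ≥0∞} (hs : s ≤ K₁ * a + K₂ * b)
    (ht : t ≤ L * (s + b)) : s + t ≤ ((1 + L) * K₁ + (1 + L) * K₂ + L) * (a + b) :=
  calc s + t ≤ s + L * (s + b) := by gcongr
    _ = (1 + L) * s + L * b := by ring
    _ ≤ (1 + L) * (K₁ * a + K₂ * b) + L * b := by gcongr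
    _ ≤ (1 + L) * (K₁ * a + K₂ * b) + L * b + (((1 + L) * K₂ + L) * a + (1 + L) * K₁ * b) :=
        le_self_add
    _ = ((1 + L) * K₁ + (1 + L) * K₂ + L) * (a + b) := by ring

/-- The iteration `(w, φ) ↦ x ↦ (v x, χ)`, where `x` solves `A` with data `(w, φ)` and `χ` solves
`B` with data `(v x, φ)`, contracts the `ℓ¹`-distance of the pairs `(w, φ)`. -/
lemma existsUnique_coupled_fixedPoint {X W Φ : Type*} [MetricSpace X] [MetricSpace W]
    [CompleteSpace W] [MetricSpace Φ] [CompleteSpace Φ] {v : X → W} (hv : LipschitzWith 1 v)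
    {S : Set (W × Φ)} (hS : IsClosed S) (hne : S.Nonempty) {A : W → Φ → X → Prop}
    {B : W → Φ → Φ → Prop} {K₁ K₂ L : ℝ≥0∞}
    (hAex : ∀ p ∈ S, ∃ x, A p.1 p.2 x)
    (hBex : ∀ p ∈ S, ∀ x, A p.1 p.2 x → ∃ χ, B (v x) p.2 χ ∧ (v x, χ) ∈ S)
    (hA : ∀ p ∈ S, ∀ p' ∈ S, ∀ x x', A p.1 p.2 x → A p'.1 p'.2 x' →
      edist x x' ≤ K₁ * edist p.1 p'.1 + K₂ * edist p.2 p'.2)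
    (hB : ∀ p ∈ S, ∀ p' ∈ S, ∀ x x', A p.1 p.2 x → A p'.1 p'.2 x' → ∀ χ χ',
      B (v x) p.2 χ → B (v x') p'.2 χ' →
      edist χ χ' ≤ L * (edist (v x) (v x') + edist p.2 p'.2))
    (hK : (1 + L) * K₁ + (1 + L) * K₂ + L < 1) :
    ∃! q : X × Φ, A (v q.1) q.2 q.1 ∧ B (v q.1) q.2 q.2 ∧ (v q.1, q.2) ∈ S := by
  let R : WithLp 1 (W × Φ) → WithLp 1 (W × Φ) → Prop := fun p q =>
    ∃ x, A p.fst p.snd x ∧ q.fst = v x ∧ B (v x) p.snd q.snd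
  have hex : ∀ p ∈ WithLp.ofLp (p := 1) ⁻¹' S, ∃ q ∈ WithLp.ofLp (p := 1) ⁻¹' S, R p q := by
    intro p hp
    obtain ⟨x, hx⟩ := hAex _ hp
    obtain ⟨χ, hχ, hS⟩ := hBex _ hp x hx
    exact ⟨WithLp.toLp 1 (v x, χ), hS, x, hx, rfl, hχ⟩
  have hcontr : ∀ p ∈ WithLp.ofLp (p := 1) ⁻¹' S, ∀ p' ∈ WithLp.ofLp (p := 1) ⁻¹' S, ∀ q q',
      R p q → R p' q' → edist q q' ≤ ((1 + L) * K₁ + (1 + L) * K₂ + L) * edist p p' := by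
    rintro p hp p' hp' q q' ⟨x, hx, hqx, hq⟩ ⟨x', hx', hqx', hq'⟩
    have hvx : edist (v x) (v x') ≤ edist x x' := by
      simpa only [ENNReal.coe_one, one_mul] using hv x x'
    simp only [WithLp.prod_edist_eq_add (p := 1) (by simp), ENNReal.toReal_one, ENNReal.rpow_one,
      div_one, hqx, hqx']
    exact add_le_contraction_mul_add (hvx.trans (hA _ hp _ hp' x x' hx hx'))
      (hB _ hp _ hp' x x' hx hx' _ _ hq hq')
  obtain ⟨p, ⟨hpS, x, hx, hpx, hp⟩, hunique⟩ :=
    existsUnique_fixedPoint_of_relation (hS.preimage (WithLp.prod_continuous_ofLp 1 W Φ))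
      ⟨WithLp.toLp 1 hne.some, hne.some_mem⟩ hK hex hcontr
  have hfst : v x = p.fst := hpx.symm
  refine ⟨(x, p.snd), ⟨by rwa [hfst], by rwa [hfst] at hp ⊢, by rwa [hfst]⟩, ?_⟩
  rintro ⟨x', φ'⟩ ⟨hx', hφ', hS'⟩
  obtain rfl : p = WithLp.toLp 1 (v x', φ') := (hunique _ ⟨hS', x', hx', rfl, hφ'⟩).symm
  have hxx' : edist x' x = 0 := by
    simpa using hA (v x', φ') hS' (v x', φ') hS' x' x hx' hx
  exact Prod.ext (edist_eq_zero.1 hxx') rfl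

end Abstract

/-! ### Tensor algebra -/

section Tensor

variable {m n : ℕ}

/-- The deviatoric part, as a continuous linear map. -/
def devL (n : ℕ) : T n n →L[ℝ] T n n :=
  LinearMap.toContinuousLinearMap
    { toFun := dev
      map_add' := fun σ τ => by
        ext p
        simp only [dev, tr, PiLp.add_apply, Finset.sum_add_distrib]
        split_ifs <;> ring
      map_smul' := fun c τ => by
        ext p
        simp only [dev, tr, PiLp.smul_apply, smul_eq_mul, ← Finset.mul_sum, RingHom.id_apply]
        split_ifs <;> ring }

/-- The symmetric part, as a continuous linear map. -/
def symL (n : ℕ) : T n n →L[ℝ] T n n :=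
  LinearMap.toContinuousLinearMap
    { toFun := symPart
      map_add' := fun σ τ => by
        ext p
        simp only [symPart, PiLp.add_apply]
        ring
      map_smul' := fun c τ => by
        ext p
        simp only [symPart, PiLp.smul_apply, smul_eq_mul, RingHom.id_apply]
        ring }

/-- The skew-symmetric part, as a continuous linear map. -/
def skewL (n : ℕ) : T n n →L[ℝ] T n n :=
  LinearMap.toContinuousLinearMap
    { toFun := skewPart
      map_add' := fun σ τ => by
        ext p
        simp only [skewPart, PiLp.add_apply]
        ring
      map_smul' := fun c τ => by
        ext p
        simp only [skewPart, PiLp.smul_apply, smul_eq_mul, RingHom.id_apply]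
        ring }

lemma norm_dev_sq (τ : T n n) : ‖dev τ‖ ^ 2 = ‖τ‖ ^ 2 - tr τ ^ 2 / n := by
  have hrow (i : Fin n) : ∑ j, dev τ (i, j) ^ 2 =
      ∑ j, τ (i, j) ^ 2 - (2 * (tr τ / n) * τ (i, i) - (tr τ / n) ^ 2) := by
    have hentry (j : Fin n) : dev τ (i, j) ^ 2 =
        τ (i, j) ^ 2 - if i = j then 2 * (tr τ / n) * τ (i, j) - (tr τ / n) ^ 2 else 0 := by
      simp only [dev]
      split_ifs <;> ring
    simp [hentry]
  simp only [EuclideanSpace.real_norm_sq_eq, Fintype.sum_prod_type, hrow, Finset.sum_sub_distrib,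
    ← Finset.mul_sum, show ∑ i, τ (i, i) = tr τ from rfl, Finset.sum_const, Finset.card_univ,
    Fintype.card_fin, nsmul_eq_mul]
  rcases eq_or_ne n 0 with rfl | hn
  · simp
  · field

lemma norm_dev_le (τ : T n n) : ‖dev τ‖ ≤ ‖τ‖ := by
  refine (sq_le_sq₀ (norm_nonneg _) (norm_nonneg _)).1 ?_
  rw [norm_dev_sq]
  exact sub_le_self _ (by positivity)

lemma two_mul_norm_symPart_sq (τ : T n n) :
    2 * ‖symPart τ‖ ^ 2 = ‖τ‖ ^ 2 + ∑ i, ∑ j, τ (i, j) * τ (j, i) := by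
  have hentry (i j : Fin n) : ((τ (i, j) + τ (j, i)) / 2) ^ 2 =
      1 / 4 * τ (i, j) ^ 2 + 1 / 4 * τ (j, i) ^ 2 + 1 / 2 * (τ (i, j) * τ (j, i)) := by ring
  have htranspose : ∑ i, ∑ j, τ (j, i) ^ 2 = ∑ i, ∑ j, τ (i, j) ^ 2 := Finset.sum_comm
  simp only [EuclideanSpace.real_norm_sq_eq, Fintype.sum_prod_type, symPart, hentry,
    Finset.sum_add_distrib, ← Finset.mul_sum, htranspose]
  ring

lemma norm_dyad (v : E m) (w : E n) : ‖dyad v w‖ = ‖v‖ * ‖w‖ := by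
  rw [← sq_eq_sq₀ (by positivity) (by positivity), mul_pow]
  simp only [EuclideanSpace.real_norm_sq_eq, Finset.sum_mul_sum, Fintype.sum_prod_type, dyad,
    mul_pow]

/-- The dyadic product, as a continuous bilinear map. -/
def dyadL (m n : ℕ) : E m →L[ℝ] E n →L[ℝ] T m n :=
  LinearMap.mkContinuous₂
    (LinearMap.mk₂ ℝ dyad
      (fun v v' w => by ext p; simp [dyad, add_mul])
      (fun c v w => by ext p; simp [dyad, mul_assoc])
      (fun v w w' => by ext p; simp [dyad, mul_add])
      (fun c v w => by ext p; simp [dyad, mul_left_comm])) 1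
    (fun v w => by simp [norm_dyad])

lemma norm_dyadL_le : ‖dyadL m n‖ ≤ 1 := LinearMap.mkContinuous₂_norm_le _ zero_le_one _

lemma inner_tmul (τ : T m n) (w : E n) (v : E m) :
    inner ℝ (tmul τ w) v = inner ℝ τ (dyad v w) := by
  simp only [PiLp.inner_apply, Fintype.sum_prod_type, tmul, dyad, RCLike.inner_apply, conj_trivial,
    Finset.mul_sum]
  exact Finset.sum_congr rfl fun i _ => Finset.sum_congr rfl fun j _ => by ring

/-- The restriction `eᵢ ⊗ eᵢ τ` of a tensor to its `i`-th row. -/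
def rowL (m n : ℕ) (i : Fin m) : T m n →L[ℝ] T m n :=
  LinearMap.toContinuousLinearMap
    { toFun := diagMul (Pi.single i 1)
      map_add' := fun σ τ => by ext p; simp [diagMul, mul_add]
      map_smul' := fun c τ => by ext p; simp [diagMul, mul_left_comm] }

lemma sum_smul_rowL (d : Fin m → ℝ) (τ : T m n) : (∑ i, d i • rowL m n i) τ = diagMul d τ := by
  ext p
  simp [rowL, diagMul, Pi.single_apply]

lemma norm_diagMul_le {d : Fin m → ℝ} {c : ℝ} (hd : ∀ i, |d i| ≤ c) (hc : 0 ≤ c) (τ : T m n) :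
    ‖diagMul d τ‖ ≤ c * ‖τ‖ := by
  refine (sq_le_sq₀ (norm_nonneg _) (by positivity)).1 ?_
  rw [mul_pow, EuclideanSpace.real_norm_sq_eq, EuclideanSpace.real_norm_sq_eq, Finset.mul_sum]
  refine Finset.sum_le_sum fun p _ => ?_
  simp only [diagMul, mul_pow]
  exact mul_le_mul_of_nonneg_right (sq_le_sq.2 (by simpa only [abs_of_nonneg hc] using hd p.1))
    (sq_nonneg _)

lemma le_inner_diagMul {d : Fin m → ℝ} {c : ℝ} (hd : ∀ i, c ≤ d i) (τ : T m n) :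
    c * ‖τ‖ ^ 2 ≤ inner ℝ (diagMul d τ) τ := by
  rw [EuclideanSpace.real_norm_sq_eq, PiLp.inner_apply, Finset.mul_sum]
  refine Finset.sum_le_sum fun p _ => ?_
  simp only [diagMul, RCLike.inner_apply, conj_trivial]
  nlinarith [hd p.1, sq_nonneg (τ p)]

/-- The rank-one map `z ↦ (α · z) g`. -/
def buoyL (α : E m) (g : E n) : E m →L[ℝ] E n := (innerSL ℝ α).smulRight g

lemma buoyL_apply (α z : E m) (g : E n) : buoyL α g z = (inner ℝ α z : ℝ) • g := rfl

lemma norm_buoyL_apply_le (α z : E m) (g : E n) : ‖buoyL α g z‖ ≤ ‖α‖ * ‖g‖ * ‖z‖ :=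
  calc ‖buoyL α g z‖ = ‖(inner ℝ α z : ℝ)‖ * ‖g‖ := by rw [buoyL_apply, norm_smul]
    _ ≤ ‖α‖ * ‖z‖ * ‖g‖ := by gcongr; exact norm_inner_le_norm α z
    _ = ‖α‖ * ‖g‖ * ‖z‖ := by ring

end Tensor

/-! ### Square-integrable fields -/

section Lp

variable {X V W : Type*} [MeasurableSpace X] {μ : Measure X} [NormedAddCommGroup V]
  [NormedAddCommGroup W]

lemma integral_inner_eq [InnerProductSpace ℝ V] (f g : Lp V 2 μ) {f' g' : X → V} (hf : f =ᵐ[μ] f')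
    (hg : g =ᵐ[μ] g') : ∫ x, inner ℝ (f' x) (g' x) ∂μ = inner ℝ f g := by
  rw [L2.inner_def]
  refine integral_congr_ae ?_
  filter_upwards [hf, hg] with x hfx hgx
  rw [hfx, hgx]

lemma integral_norm_sq_eq [InnerProductSpace ℝ V] (f : Lp V 2 μ) {f' : X → V} (hf : f =ᵐ[μ] f') :
    ∫ x, ‖f' x‖ ^ 2 ∂μ = ‖f‖ ^ 2 := by
  simp only [← real_inner_self_eq_norm_sq, integral_inner_eq f f hf hf]

lemma coeFn_sub_smul [NormedSpace ℝ V] {p : ℝ≥0∞} (c : ℝ) (f g : Lp V p μ) {f' g' : X → V}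
    (hf : f =ᵐ[μ] f') (hg : g =ᵐ[μ] g') :
    (f - c • g : Lp V p μ) =ᵐ[μ] fun x => f' x - c • g' x := by
  filter_upwards [Lp.coeFn_sub f (c • g), Lp.coeFn_smul c g, hf, hg] with x hsub hsmul hfx hgx
  rw [hsub, Pi.sub_apply, hsmul, Pi.smul_apply, hfx, hgx]

variable [NormedSpace ℝ V] [NormedSpace ℝ W]

lemma isClosed_setOf_ae_apply_eq_zero (p : ℝ≥0∞) [Fact (1 ≤ p)] (L : V →L[ℝ] W) :
    IsClosed {f : Lp V p μ | ∀ᵐ x ∂μ, L (f x) = 0} := by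
  have hker : {f : Lp V p μ | ∀ᵐ x ∂μ, L (f x) = 0} = {f | L.compLpL p μ f = 0} := by
    ext f
    rw [Set.mem_ofPred_eq, Set.mem_ofPred_eq, Lp.eq_zero_iff_ae_eq_zero]
    exact eventually_congr <| by
      filter_upwards [L.coeFn_compLpL f] with x hx
      rw [hx, Pi.zero_apply]
  rw [hker]
  exact isClosed_eq (L.compLpL p μ).continuous continuous_const

open Classical in
/-- Pointwise application of an essentially bounded field of operators `A`, as an operator on
square-integrable fields. It is `0` if `A` is not essentially bounded. -/
def mulOp (μ : Measure X) (A : X → V →L[ℝ] W) : Lp V 2 μ →L[ℝ] Lp W 2 μ :=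
  if hA : MemLp A ⊤ μ then (ContinuousLinearMap.id ℝ (V →L[ℝ] W)).holderL μ ⊤ 2 2 (hA.toLp A) else 0

lemma coeFn_mulOp {A : X → V →L[ℝ] W} (hA : MemLp A ⊤ μ) (f : Lp V 2 μ) :
    mulOp μ A f =ᵐ[μ] fun x => A x (f x) := by
  rw [mulOp, dif_pos hA]
  filter_upwards [(ContinuousLinearMap.id ℝ (V →L[ℝ] W)).coeFn_holder (r := 2) (hA.toLp A) f,
    hA.coeFn_toLp] with x hmul hAx
  refine hmul.trans ?_
  rw [hAx, ContinuousLinearMap.id_apply]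

attribute [irreducible] mulOp

lemma norm_mulOp_le {A : X → V →L[ℝ] W} (hA : MemLp A ⊤ μ) {c : ℝ}
    (hc : ∀ᵐ x ∂μ, ∀ v, ‖A x v‖ ≤ c * ‖v‖) (f : Lp V 2 μ) : ‖mulOp μ A f‖ ≤ c * ‖f‖ := by
  refine Lp.norm_le_mul_norm_of_ae_le_mul ?_
  filter_upwards [coeFn_mulOp hA f, hc] with x hx hcx
  rw [hx]
  exact hcx _

lemma le_inner_mulOp {V : Type*} [NormedAddCommGroup V] [InnerProductSpace ℝ V]
    {A : X → V →L[ℝ] V} (hA : MemLp A ⊤ μ) {c : ℝ}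
    (hc : ∀ᵐ x ∂μ, ∀ v, c * ‖v‖ ^ 2 ≤ inner ℝ (A x v) v) (f : Lp V 2 μ) :
    c * ‖f‖ ^ 2 ≤ inner ℝ (mulOp μ A f) f := by
  rw [← real_inner_self_eq_norm_sq, L2.inner_def, L2.inner_def, ← integral_const_mul]
  refine integral_mono_ae ((L2.integrable_inner f f).const_mul _) (L2.integrable_inner _ _) ?_
  filter_upwards [coeFn_mulOp hA f, hc] with x hx hcx
  simpa only [hx, real_inner_self_eq_norm_sq] using hcx _

end Lp

variable {n m : ℕ} {Ω : PolyhedralDomain n}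

/-- The deviatoric part of a tensor field. -/
def devLp (Ω : PolyhedralDomain n) : L2 Ω (T n n) →L[ℝ] L2 Ω (T n n) := (devL n).compLpL 2 Ω.vol

/-- The symmetric part of a tensor field. -/
def symLp (Ω : PolyhedralDomain n) : L2 Ω (T n n) →L[ℝ] L2 Ω (T n n) := (symL n).compLpL 2 Ω.vol

/-- The skew-symmetric part of a tensor field. -/
def skewLp (Ω : PolyhedralDomain n) : L2 Ω (T n n) →L[ℝ] L2 Ω (T n n) := (skewL n).compLpL 2 Ω.vol

lemma coeFn_devLp (τ : L2 Ω (T n n)) : devLp Ω τ =ᵐ[Ω.vol] fun x => dev (τ x) :=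
  (devL n).coeFn_compLpL τ

lemma coeFn_symLp (τ : L2 Ω (T n n)) : symLp Ω τ =ᵐ[Ω.vol] fun x => symPart (τ x) :=
  (symL n).coeFn_compLpL τ

lemma coeFn_skewLp (τ : L2 Ω (T n n)) : skewLp Ω τ =ᵐ[Ω.vol] fun x => skewPart (τ x) :=
  (skewL n).coeFn_compLpL τ

attribute [irreducible] devLp symLp skewLp

lemma norm_devLp_le (τ : L2 Ω (T n n)) : ‖devLp Ω τ‖ ≤ ‖τ‖ := by
  refine Lp.norm_le_norm_of_ae_le ?_
  filter_upwards [coeFn_devLp τ] with x hx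
  rw [hx]
  exact norm_dev_le _

/-! ### Completeness of the function spaces -/

lemma continuous_integral_coord {ι : Type} [Fintype ι] (i : ι) {f : E n → ℝ}
    (hf : MemLp f 2 Ω.vol) :
    Continuous fun u : L2 Ω (EuclideanSpace ℝ ι) => ∫ x, u x i * f x ∂Ω.vol := by
  have hinner (u : L2 Ω (EuclideanSpace ℝ ι)) : ∫ x, u x i * f x ∂Ω.vol =
      inner ℝ (hf.toLp f)
        ((EuclideanSpace.proj i : EuclideanSpace ℝ ι →L[ℝ] ℝ).compLpL 2 Ω.vol u) := by
    rw [← integral_inner_eq _ _ hf.coeFn_toLp (ContinuousLinearMap.coeFn_compLpL _ u)]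
    rfl
  simp only [hinner]
  fun_prop

lemma isClosed_H1 : IsClosed (H1 Ω m : Set (SobPair Ω m)) := by
  change IsClosed {p : SobPair Ω m | IsWeakGrad Ω p.fst p.snd}
  simp only [IsWeakGrad, Set.ofPred_forall]
  refine isClosed_iInter fun η => isClosed_iInter fun hη => isClosed_iInter fun i =>
    isClosed_iInter fun j => isClosed_eq ?_ ?_
  · exact (continuous_integral_coord i (hη.memLp_pd j)).comp (WithLp.fstL 2 ℝ _ _).continuous
  · exact ((continuous_integral_coord (i, j) hη.memLp).comp (WithLp.sndL 2 ℝ _ _).continuous).neg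

lemma isClosed_Hdiv0 : IsClosed (Hdiv0 Ω : Set (WithLp 2 (L2 Ω (T n n) × L2 Ω (E n)))) := by
  change IsClosed ({p : WithLp 2 (L2 Ω (T n n) × L2 Ω (E n)) | IsWeakDiv Ω p.fst p.snd} ∩
    {p | ∑ i, ∫ x, p.fst x (i, i) * 1 ∂Ω.vol = 0})
  refine IsClosed.inter ?_ (isClosed_eq (continuous_finsetSum _ fun i _ => ?_) continuous_const)
  · simp only [IsWeakDiv, Set.ofPred_forall]
    refine isClosed_iInter fun η => isClosed_iInter fun hη => isClosed_iInter fun i =>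
      isClosed_eq (continuous_finsetSum _ fun j _ => ?_) ?_
    · exact (continuous_integral_coord (i, j) (hη.memLp_pd j)).comp
        (WithLp.fstL 2 ℝ _ _).continuous
    · exact ((continuous_integral_coord i hη.memLp).comp (WithLp.sndL 2 ℝ _ _).continuous).neg
  · exact (continuous_integral_coord (i, i) (memLp_const (1 : ℝ))).comp
      (WithLp.fstL 2 ℝ _ _).continuous

lemma isClosed_Ltr : IsClosed (Ltr Ω : Set (L2 Ω (T n n))) := by
  have hLtr : (Ltr Ω : Set (L2 Ω (T n n))) =
      (⋂ i, ⋂ j, {τ | ∀ᵐ x ∂Ω.vol, (EuclideanSpace.proj (i, j) - EuclideanSpace.proj (j, i) :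
        T n n →L[ℝ] ℝ) (τ x) = 0}) ∩
      {τ | ∀ᵐ x ∂Ω.vol, (∑ i, EuclideanSpace.proj (i, i) : T n n →L[ℝ] ℝ) (τ x) = 0} := by
    ext τ
    change (∀ᵐ x ∂Ω.vol, (∀ i j, τ x (i, j) = τ x (j, i)) ∧ tr (τ x) = 0) ↔ _
    simp [eventually_and, eventually_all, sub_eq_zero, tr]
  rw [hLtr]
  exact (isClosed_iInter fun i => isClosed_iInter fun j =>
    isClosed_setOf_ae_apply_eq_zero 2 _).inter (isClosed_setOf_ae_apply_eq_zero 2 _)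

instance : CompleteSpace (H1 Ω m) := isClosed_H1.completeSpace_coe

instance : CompleteSpace (H10 Ω m) :=
  (Submodule.isClosed_topologicalClosure _).completeSpace_coe

instance : CompleteSpace (Hdiv0 Ω) := isClosed_Hdiv0.completeSpace_coe

instance : CompleteSpace (Ltr Ω) := isClosed_Ltr.completeSpace_coe

/-! ### Test functions -/

lemma contDiff_pd {f : E n → ℝ} (hf : ContDiff ℝ ∞ f) (j : Fin n) : ContDiff ℝ ∞ (pd f j) :=
  (hf.fderiv_right (m := ∞) (by simp)).clm_apply contDiff_const

lemma hasCompactSupport_pd {f : E n → ℝ} (hf : HasCompactSupport f) (j : Fin n) :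
    HasCompactSupport (pd f j) :=
  hf.fderiv_apply (𝕜 := ℝ) _

lemma integral_mul_pd {f g : E n → ℝ} (hf : ContDiff ℝ ∞ f) (hg : ContDiff ℝ ∞ g)
    (hgc : HasCompactSupport g) (j : Fin n) :
    ∫ x, f x * pd g j x = -∫ x, pd f j x * g x := by
  refine integral_mul_fderiv_eq_neg_fderiv_mul_of_integrable ?_ ?_ ?_
    (fun x _ => hf.differentiable (by simp) x) (fun x _ => hg.differentiable (by simp) x)
  · exact ((contDiff_pd hf j).continuous.mul hg.continuous).integrable_of_hasCompactSupport
      hgc.mul_left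
  · exact (hf.continuous.mul (contDiff_pd hg j).continuous).integrable_of_hasCompactSupport
      (hasCompactSupport_pd hgc j).mul_left
  · exact (hf.continuous.mul hg.continuous).integrable_of_hasCompactSupport hgc.mul_left

lemma pd_pd_apply {f : E n → ℝ} (hf : ContDiff ℝ ∞ f) (i j : Fin n) (x : E n) :
    pd (pd f i) j x =
      fderiv ℝ (fderiv ℝ f) x (EuclideanSpace.single j 1) (EuclideanSpace.single i 1) := by
  have hdiff : DifferentiableAt ℝ (fderiv ℝ f) x :=
    (hf.fderiv_right (m := 1) (by norm_cast)).differentiable (by simp) x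
  change fderiv ℝ (fun y => fderiv ℝ f y (EuclideanSpace.single i 1)) x _ = _
  rw [fderiv_clm_apply hdiff (differentiableAt_const _)]
  simp

lemma pd_comm {f : E n → ℝ} (hf : ContDiff ℝ ∞ f) (i j : Fin n) :
    pd (pd f i) j = pd (pd f j) i := by
  funext x
  rw [pd_pd_apply hf, pd_pd_apply hf]
  exact (hf.contDiffAt.isSymmSndFDerivAt (by simpa using ENat.LEInfty.out)) _ _

lemma integral_pd_mul_pd_comm {f g : E n → ℝ} (hf : ContDiff ℝ ∞ f) (hg : ContDiff ℝ ∞ g)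
    (hgc : HasCompactSupport g) (i j : Fin n) :
    ∫ x, pd f j x * pd g i x = ∫ x, pd f i x * pd g j x := by
  have hj := integral_mul_pd hf (contDiff_pd hg i) (hasCompactSupport_pd hgc i) j
  have hi := integral_mul_pd hf (contDiff_pd hg j) (hasCompactSupport_pd hgc j) i
  rw [pd_comm hg i j] at hj
  exact neg_injective (hj.symm.trans hi)

lemma gradField_apply {η : E n → E m} (hη : ContDiff ℝ ∞ η) (x : E n) (i : Fin m) (j : Fin n) :
    gradField η x (i, j) = pd (fun x => η x i) j x :=
  (congrArg (· (EuclideanSpace.single j 1)) ((EuclideanSpace.proj i : E m →L[ℝ] ℝ).hasFDerivAt.comp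
    x (hη.differentiable (by simp) x).hasFDerivAt).fderiv).symm

lemma IsTest.coord {η : E n → E m} (hη : IsTest Ω η) (i : Fin m) : IsTest Ω fun x => η x i := by
  have htsupport : tsupport (fun x => η x i) ⊆ tsupport η :=
    closure_mono fun x hx hηx => hx (by simp [hηx])
  exact ⟨contDiff_euclidean.1 hη.1 i, hη.2.1.mono' (subset_closure.trans htsupport),
    htsupport.trans hη.2.2⟩

lemma IsTest.eq_zero {η : E n → ℝ} (hη : IsTest Ω η) {x : E n} (hx : x ∉ Ω.carrier) : η x = 0 :=
  image_eq_zero_of_notMem_tsupport fun hsupp => hx (hη.2.2 hsupp)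

lemma IsTest.pd_eq_zero {η : E n → ℝ} (hη : IsTest Ω η) (j : Fin n) {x : E n}
    (hx : x ∉ Ω.carrier) : pd η j x = 0 := by
  have hfderiv : fderiv ℝ η x = 0 :=
    image_eq_zero_of_notMem_tsupport fun hsupp => hx (hη.2.2 (tsupport_fderiv_subset ℝ hsupp))
  rw [pd, hfderiv, zero_apply]

lemma integral_vol_eq_of_ae_eq {f g : E n → ℝ} (hfg : f =ᵐ[Ω.vol] g)
    (hg : ∀ x, x ∉ Ω.carrier → g x = 0) : ∫ x, f x ∂Ω.vol = ∫ x, g x :=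
  (integral_congr_ae hfg).trans (setIntegral_eq_integral_of_forall_compl_eq_zero hg)

lemma testPairs_le_H1 : testPairs Ω m ≤ H1 Ω m := by
  rintro p ⟨η, hη, hfst, hsnd⟩ ζ hζ i j
  have hleft : ∫ x, p.fst x i * pd ζ j x ∂Ω.vol = ∫ x, η x i * pd ζ j x :=
    integral_vol_eq_of_ae_eq (hfst.mono fun x hx => by simp only [hx]) fun x hx => by
      rw [hζ.pd_eq_zero j hx, mul_zero]
  have hright : ∫ x, p.snd x (i, j) * ζ x ∂Ω.vol = ∫ x, pd (fun x => η x i) j x * ζ x :=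
    integral_vol_eq_of_ae_eq (hsnd.mono fun x hx => by simp only [hx, gradField_apply hη.1])
      fun x hx => by rw [hζ.eq_zero hx, mul_zero]
  rw [hleft, hright, integral_mul_pd (hη.coord i).1 hζ.1 hζ.2.1]

lemma H10_le_H1 : H10 Ω m ≤ H1 Ω m :=
  Submodule.topologicalClosure_minimal _ testPairs_le_H1 isClosed_H1

/-- The inclusion of `H¹₀(Ω)` into `H¹(Ω)`. -/
def incl (Ω : PolyhedralDomain n) (m : ℕ) : H10 Ω m →L[ℝ] H1 Ω m :=
  (H10 Ω m).subtypeL.codRestrict (H1 Ω m) fun u => H10_le_H1 u.2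

/-! ### Korn's inequality -/

lemma integrable_coord_mul_coord (τ : L2 Ω (T n n)) (p q : Fin n × Fin n) :
    Integrable (fun x => τ x p * τ x q) Ω.vol :=
  integrable_coord_mul _ _ (memLp_coord τ q)

lemma two_mul_norm_symLp_sq (τ : L2 Ω (T n n)) : 2 * ‖symLp Ω τ‖ ^ 2 =
    ‖τ‖ ^ 2 + ∑ i, ∑ j, ∫ x, τ x (i, j) * τ x (j, i) ∂Ω.vol := by
  have hprod (i j : Fin n) := integrable_coord_mul_coord τ (i, j) (j, i)
  have hrow (i : Fin n) := integrable_finsetSum Finset.univ fun j _ => hprod i j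
  have hnorm : Integrable (fun x => ‖τ x‖ ^ 2) Ω.vol := (Lp.memLp τ).integrable_norm_pow two_ne_zero
  rw [← integral_norm_sq_eq _ (coeFn_symLp τ), ← integral_norm_sq_eq τ EventuallyEq.rfl,
    ← integral_const_mul]
  simp only [two_mul_norm_symPart_sq]
  rw [integral_add hnorm (integrable_finsetSum _ fun i _ => hrow i),
    integral_finsetSum _ fun i _ => hrow i]
  simp only [integral_finsetSum _ fun j _ => hprod _ j]

lemma integral_snd_mul_snd_comm {p : SobPair Ω n} (hp : p ∈ testPairs Ω n) (i j : Fin n) :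
    ∫ x, p.snd x (i, j) * p.snd x (j, i) ∂Ω.vol = ∫ x, p.snd x (i, i) * p.snd x (j, j) ∂Ω.vol := by
  obtain ⟨η, hη, -, hsnd⟩ := hp
  have hclassical (i j k l : Fin n) : ∫ x, p.snd x (i, j) * p.snd x (k, l) ∂Ω.vol =
      ∫ x, pd (fun x => η x i) j x * pd (fun x => η x k) l x :=
    integral_vol_eq_of_ae_eq
      (hsnd.mono fun x hx => by simp only [hx, gradField_apply hη.1])
      fun x hx => by rw [(hη.coord i).pd_eq_zero j hx, zero_mul]
  rw [hclassical, hclassical,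
    integral_pd_mul_pd_comm (hη.coord i).1 (hη.coord j).1 (hη.coord j).2.1]

lemma sum_integral_diag_mul_diag (τ : L2 Ω (T n n)) :
    ∑ i, ∑ j, ∫ x, τ x (i, i) * τ x (j, j) ∂Ω.vol = ∫ x, tr (τ x) ^ 2 ∂Ω.vol := by
  have hprod (i j : Fin n) := integrable_coord_mul_coord τ (i, i) (j, j)
  simp only [tr, sq, Finset.sum_mul_sum]
  rw [integral_finsetSum _ fun i _ => integrable_finsetSum _ fun j _ => hprod i j]
  simp only [integral_finsetSum _ fun j _ => hprod _ j]

lemma korn (u : H10 Ω n) : ‖u.1.snd‖ ^ 2 ≤ 2 * ‖symLp Ω u.1.snd‖ ^ 2 := by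
  have hclosed : IsClosed {p : SobPair Ω n | ‖p.snd‖ ^ 2 ≤ 2 * ‖symLp Ω p.snd‖ ^ 2} := by
    have : Continuous fun p : SobPair Ω n => p.snd := (WithLp.sndL 2 ℝ _ _).continuous
    exact isClosed_le (by fun_prop) (by fun_prop)
  refine closure_minimal (fun p hp => ?_) hclosed u.2
  rw [Set.mem_ofPred_eq, two_mul_norm_symLp_sq,
    Finset.sum_congr rfl fun i _ =>
      Finset.sum_congr rfl fun j _ => integral_snd_mul_snd_comm hp i j,
    sum_integral_diag_mul_diag]
  exact le_add_of_nonneg_right (integral_nonneg fun x => sq_nonneg _)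

/-! ### Traces -/

section Trace

variable {ΓD : Set (E n)}

lemma tendsto_Lp_iff_of_ae_eq {X V ι : Type*} [MeasurableSpace X] [NormedAddCommGroup V]
    {μ : Measure X} {p : ℝ≥0∞} [Fact (1 ≤ p)] {l : Filter ι} {F : ι → Lp V p μ}
    {f : ι → X → V} (hf : ∀ k, F k =ᵐ[μ] f k) (g : Lp V p μ) :
    Tendsto F l (𝓝 g) ↔ Tendsto (fun k => eLpNorm (fun x => f k x - g x) p μ) l (𝓝 0) := by
  rw [Lp.tendsto_Lp_iff_tendsto_eLpNorm']
  refine tendsto_congr fun k => eLpNorm_congr_ae ?_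
  filter_upwards [hf k] with x hx
  rw [Pi.sub_apply, hx]

lemma eventually_memLp_of_tendsto {X V ι : Type*} [MeasurableSpace X] [NormedAddCommGroup V]
    {μ : Measure X} {p : ℝ≥0∞} {l : Filter ι} {f : ι → X → V}
    (hf : ∀ k, AEStronglyMeasurable (f k) μ) (g : Lp V p μ)
    (hfg : Tendsto (fun k => eLpNorm (fun x => f k x - g x) p μ) l (𝓝 0)) :
    ∀ᶠ k in l, MemLp (f k) p μ := by
  filter_upwards [hfg.eventually_lt_const ENNReal.zero_lt_top] with k hk
  have hsub : MemLp (fun x => f k x - g x) p μ := ⟨(hf k).sub (Lp.aestronglyMeasurable g), hk⟩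
  exact (hsub.add (Lp.memLp g)).ae_eq (.of_forall fun x => sub_add_cancel (f k x) (g x))

lemma continuous_gradField {η : E n → E m} (hη : ContDiff ℝ ∞ η) : Continuous (gradField η) :=
  (PiLp.continuous_toLp 2 _).comp <| continuous_pi fun p =>
    (EuclideanSpace.proj p.1 : E m →L[ℝ] ℝ).continuous.comp
      ((hη.continuous_fderiv (by simp)).clm_apply continuous_const)

/-- The smooth vector fields that are square integrable together with their gradient and with their
restriction to `Γ_D`, as pairs of an element of `H¹(Ω; ℝᵐ)` and its boundary values. -/
def smoothTraces (Ω : PolyhedralDomain n) (ΓD : Set (E n)) (m : ℕ) :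
    Submodule ℝ (SobPair Ω m × Lp (E m) 2 (surf ΓD)) where
  carrier := {q | ∃ η : E n → E m, ContDiff ℝ ∞ η ∧ q.1.fst =ᵐ[Ω.vol] η ∧
    q.1.snd =ᵐ[Ω.vol] gradField η ∧ q.2 =ᵐ[surf ΓD] η}
  add_mem' := by
    rintro p q ⟨η, hη, hp, hp', hp''⟩ ⟨ζ, hζ, hq, hq', hq''⟩
    refine ⟨η + ζ, hη.add hζ, (Lp.coeFn_add _ _).trans (hp.add hq), ?_,
      (Lp.coeFn_add _ _).trans (hp''.add hq'')⟩
    filter_upwards [(Lp.coeFn_add p.1.snd q.1.snd).trans (hp'.add hq')] with x hx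
    refine hx.trans (PiLp.ext fun i => ?_)
    simp [gradField, fderiv_add (hη.differentiable (by simp) x) (hζ.differentiable (by simp) x)]
  zero_mem' := by
    refine ⟨0, contDiff_const, Lp.coeFn_zero _ _ _, ?_, Lp.coeFn_zero _ _ _⟩
    filter_upwards [Lp.coeFn_zero (T m n) 2 Ω.vol] with x hx
    refine hx.trans (PiLp.ext fun i => ?_)
    simp [gradField]
  smul_mem' := by
    rintro c p ⟨η, hη, hp, hp', hp''⟩
    refine ⟨c • η, hη.const_smul c, (Lp.coeFn_smul _ _).trans (hp.const_smul c), ?_,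
      (Lp.coeFn_smul _ _).trans (hp''.const_smul c)⟩
    filter_upwards [(Lp.coeFn_smul c p.1.snd).trans (hp'.const_smul c)] with x hx
    refine hx.trans (PiLp.ext fun i => ?_)
    simp [gradField, fderiv_const_smul (hη.differentiable (by simp) x)]

lemma hasTrace_iff_mem_topologicalClosure {φ : H1 Ω m} {g : Lp (E m) 2 (surf ΓD)} :
    HasTrace φ g ↔ (φ.1, g) ∈ (smoothTraces Ω ΓD m).topologicalClosure := by
  rw [← SetLike.mem_coe, Submodule.topologicalClosure_coe]
  constructor
  · rintro ⟨η, hη, hfst, hsnd, htrace⟩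
    have hmemLp := (eventually_memLp_of_tendsto
      (fun k => (hη k).continuous.aestronglyMeasurable) _ hfst).and
      ((eventually_memLp_of_tendsto
        (fun k => (continuous_gradField (hη k)).aestronglyMeasurable) _ hsnd).and
      (eventually_memLp_of_tendsto (fun k => (hη k).continuous.aestronglyMeasurable) _ htrace))
    obtain ⟨N, hN⟩ := eventually_atTop.1 hmemLp
    choose hη₁ hη₂ hη₃ using fun k => hN (k + N) (Nat.le_add_left N k)
    have hshift := tendsto_add_atTop_nat N
    refine mem_closure_of_tendsto (b := atTop)
      (f := fun k => (WithLp.toLp 2 ((hη₁ k).toLp _, (hη₂ k).toLp _), (hη₃ k).toLp _))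
      (Tendsto.prodMk_nhds (((WithLp.prod_continuous_toLp 2 _ _).tendsto φ.1.ofLp).comp
        (Tendsto.prodMk_nhds ?_ ?_)) ?_) (Eventually.of_forall fun k =>
          ⟨η (k + N), hη _, (hη₁ k).coeFn_toLp, (hη₂ k).coeFn_toLp, (hη₃ k).coeFn_toLp⟩)
    · exact (tendsto_Lp_iff_of_ae_eq (fun k => (hη₁ k).coeFn_toLp) _).2 (hfst.comp hshift)
    · exact (tendsto_Lp_iff_of_ae_eq (fun k => (hη₂ k).coeFn_toLp) _).2 (hsnd.comp hshift)
    · exact (tendsto_Lp_iff_of_ae_eq (fun k => (hη₃ k).coeFn_toLp) _).2 (htrace.comp hshift)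
  · intro hφ
    obtain ⟨q, hq, hlim⟩ := mem_closure_iff_seq_limit.1 hφ
    choose η hη hfst hsnd htrace using hq
    have hlim₁ : Tendsto (fun k => (q k).1) atTop (𝓝 φ.1) := (continuous_fst.tendsto _).comp hlim
    exact ⟨η, hη,
      (tendsto_Lp_iff_of_ae_eq hfst _).1 (((WithLp.fstL 2 ℝ _ _).continuous.tendsto _).comp hlim₁),
      (tendsto_Lp_iff_of_ae_eq hsnd _).1 (((WithLp.sndL 2 ℝ _ _).continuous.tendsto _).comp hlim₁),
      (tendsto_Lp_iff_of_ae_eq htrace _).1 ((continuous_snd.tendsto _).comp hlim)⟩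

lemma HasTrace.sub {φ ψ : H1 Ω m} {g h : Lp (E m) 2 (surf ΓD)}
    (hφ : HasTrace φ g) (hψ : HasTrace ψ h) : HasTrace (φ - ψ) (g - h) :=
  hasTrace_iff_mem_topologicalClosure.2 <| sub_mem
    (hasTrace_iff_mem_topologicalClosure.1 hφ) (hasTrace_iff_mem_topologicalClosure.1 hψ)

lemma HasTrace.add {φ ψ : H1 Ω m} {g h : Lp (E m) 2 (surf ΓD)}
    (hφ : HasTrace φ g) (hψ : HasTrace ψ h) : HasTrace (φ + ψ) (g + h) :=
  hasTrace_iff_mem_topologicalClosure.2 <| add_mem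
    (hasTrace_iff_mem_topologicalClosure.1 hφ) (hasTrace_iff_mem_topologicalClosure.1 hψ)

/-- `H¹_{Γ_D}(Ω)` as a submodule of `H¹(Ω)`. -/
def H1Dsub (Ω : PolyhedralDomain n) (ΓD : Set (E n)) : Submodule ℝ (H1 Ω 2) :=
  (smoothTraces Ω ΓD 2).topologicalClosure.comap
    ((LinearMap.inl ℝ _ _).comp (H1 Ω 2).subtype)

lemma mem_H1Dsub {ψ : H1 Ω 2} : ψ ∈ H1Dsub Ω ΓD ↔ ψ ∈ H1D Ω ΓD :=
  hasTrace_iff_mem_topologicalClosure.symm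

lemma isClosed_H1Dsub : IsClosed (H1Dsub Ω ΓD : Set (H1 Ω 2)) :=
  (Submodule.isClosed_topologicalClosure _).preimage
    (continuous_subtype_val.prodMk continuous_const)

lemma HasTrace.sub_mem_H1D {φ ψ : H1 Ω 2} {g : Lp (E 2) 2 (surf ΓD)}
    (hφ : HasTrace φ g) (hψ : HasTrace ψ g) : φ - ψ ∈ H1D Ω ΓD := by
  simpa only [H1D, Set.mem_ofPred_eq, sub_self] using hφ.sub hψ

end Trace

/-! ### Best constants -/

lemma le_sInf_mul {S : Set ℝ≥0∞} {x y : ℝ≥0∞} (hy : y ≠ ⊤) (hxy : y = 0 → x = 0)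
    (hS : ∀ c ∈ S, x ≤ c * y) : x ≤ sInf S * y := by
  rcases eq_or_ne y 0 with h | h
  · simp [hxy h]
  · rw [← ENNReal.div_le_iff h hy]
    exact le_sInf fun c hc => (ENNReal.div_le_iff h hy).2 (hS c hc)

lemma eLpNorm_zero_Lp {X V : Type*} [MeasurableSpace X] [NormedAddCommGroup V] {μ : Measure X}
    (p q : ℝ≥0∞) : eLpNorm (0 : Lp V p μ) q μ = 0 := by
  rw [eLpNorm_congr_ae (Lp.coeFn_zero V p μ), eLpNorm_zero]

lemma eLpNorm_le_sobolevConst (q : ℝ≥0∞) (u : H1 Ω m) :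
    eLpNorm u.1.fst q Ω.vol ≤ sobolevConst Ω m q * ‖u‖ₑ := by
  refine le_sInf_mul (by simp) (fun hu => ?_) fun c hc => hc u
  rw [enorm_eq_zero.1 hu]
  exact eLpNorm_zero_Lp 2 q

lemma enorm_le_cgp_mul {ΓD : Set (E n)} {ψ : H1 Ω 2} (hψ : ψ ∈ H1D Ω ΓD) (hcgp : cgp Ω ΓD ≠ ⊤) :
    ‖ψ‖ₑ ≤ cgp Ω ΓD * ‖ψ.1.snd‖ₑ := by
  refine le_sInf_mul (by simp) (fun hψ0 => ?_) fun c hc => hc ψ hψ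
  obtain ⟨c, hc, -⟩ := sInf_lt_iff.1 hcgp.lt_top
  simpa [hψ0] using hc ψ hψ

lemma eLpNorm_le_Ceps_mul_fracNorm {ε : ℝ} {t : L2 Ω (T n n)} (ht : fracNorm ε t ≠ ⊤) :
    eLpNorm t (ENNReal.ofReal (2 * n / (n - 2 * ε))) Ω.vol ≤ Ceps Ω ε * fracNorm ε t := by
  refine le_sInf_mul ht (fun ht0 => ?_) fun c hc => hc t ht.lt_top
  have htnorm : ‖t‖ₑ = 0 := by
    have hsum := (ENNReal.rpow_eq_zero_iff_of_pos (by norm_num)).1 ht0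
    exact pow_eq_zero_iff two_ne_zero |>.1 (add_eq_zero.1 hsum).1
  rw [enorm_eq_zero.1 htnorm]
  exact eLpNorm_zero_Lp 2 _

lemma c2_nonneg : 0 ≤ c2 Ω :=
  Real.sSup_nonneg' ⟨0, fun τ => by rw [zero_mul]; positivity, le_rfl⟩

lemma c2_mul_le (hc : c2 Ω ≠ 0) (τ : Hdiv0 Ω) :
    c2 Ω * ‖τ.1.fst‖ ^ 2 ≤ ‖devLp Ω τ.1.fst‖ ^ 2 + ‖τ.1.snd‖ ^ 2 := by
  rw [← integral_norm_sq_eq _ (coeFn_devLp τ.1.fst)]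
  set S : Set ℝ := {c | ∀ τ : Hdiv0 Ω,
    c * ‖τ.1.fst‖ ^ 2 ≤ ∫ ξ, ‖dev (τ.1.fst ξ)‖ ^ 2 ∂Ω.vol + ‖τ.1.snd‖ ^ 2}
  have hne : S.Nonempty := ⟨0, fun τ => by rw [zero_mul]; positivity⟩
  have hbdd : BddAbove S := not_imp_comm.1 Real.sSup_of_not_bddAbove hc
  have hclosed : IsClosed S := by
    simp only [S, Set.ofPred_forall]
    exact isClosed_iInter fun τ => isClosed_le (by fun_prop) continuous_const
  exact hclosed.csSup_mem hne hbdd τ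

lemma vol_ne_zero : Ω.vol ≠ 0 := by
  rw [PolyhedralDomain.vol, Ne, Measure.restrict_eq_zero]
  exact (Ω.isOpen.measure_pos _ Ω.isConnected.nonempty).ne'

/-- The constant field `c`, as an element of `H¹(Ω; ℝᵐ)`. -/
def constH1 (Ω : PolyhedralDomain n) (c : E m) : H1 Ω m where
  val := WithLp.toLp 2 ((memLp_const c).toLp _, 0)
  property η hη i j := by
    have hfst : ∫ x, (memLp_const (p := 2) (μ := Ω.vol) c).toLp _ x i * pd η j x ∂Ω.vol =
        ∫ x, c i * pd η j x :=
      integral_vol_eq_of_ae_eq ((memLp_const c).coeFn_toLp.mono fun x hx => by dsimp only; rw [hx])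
        fun x hx => by rw [hη.pd_eq_zero j hx, mul_zero]
    change ∫ x, (memLp_const (p := 2) (μ := Ω.vol) c).toLp _ x i * pd η j x ∂Ω.vol =
      -∫ x, (0 : L2 Ω (T m n)) x (i, j) * η x ∂Ω.vol
    rw [hfst, integral_zero_coord, integral_mul_pd contDiff_const hη.1 hη.2.1]
    simp [pd]

lemma coeFn_constH1 (c : E m) : (constH1 Ω c).1.fst =ᵐ[Ω.vol] fun _ => c :=
  (memLp_const c).coeFn_toLp

lemma sobolevConst_ne_zero [NeZero m] {q : ℝ≥0∞} (hq : q ≠ 0) : sobolevConst Ω m q ≠ 0 := by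
  intro hzero
  let e : E m := EuclideanSpace.single 0 1
  have he : e ≠ 0 := fun h => by simpa [e] using congrArg norm h
  have hnorm := eLpNorm_le_sobolevConst q (constH1 Ω e)
  rw [hzero, zero_mul, eLpNorm_congr_ae (coeFn_constH1 e), eLpNorm_const _ hq vol_ne_zero,
    nonpos_iff_eq_zero] at hnorm
  simp [he, vol_ne_zero] at hnorm

/-! ### Monotonicity of the Sobolev constants in the number of components -/

section Extension

variable {ι κ : Type*} [Fintype ι] [Fintype κ] (f : ι → κ)

/-- The coordinates of `ℝ^ι` placed at the indices `f i`, and `0` at the indices outside the range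
of `f`. -/
def extendL : EuclideanSpace ℝ ι →L[ℝ] EuclideanSpace ℝ κ :=
  LinearMap.toContinuousLinearMap ((WithLp.linearEquiv 2 ℝ (κ → ℝ)).symm.toLinearMap ∘ₗ
    Function.ExtendByZero.linearMap ℝ f ∘ₗ (WithLp.linearEquiv 2 ℝ (ι → ℝ)).toLinearMap)

variable {f}

lemma extendL_apply (hf : f.Injective) (v : EuclideanSpace ℝ ι) (i : ι) : extendL f v (f i) = v i :=
  hf.extend_apply _ _ i

lemma extendL_apply_of_notMem (v : EuclideanSpace ℝ ι) {j : κ} (hj : j ∉ Set.range f) :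
    extendL f v j = 0 :=
  Function.extend_apply' _ _ j hj

lemma norm_extendL (hf : f.Injective) (v : EuclideanSpace ℝ ι) : ‖extendL f v‖ = ‖v‖ := by
  rw [EuclideanSpace.norm_eq, EuclideanSpace.norm_eq]
  refine congrArg Real.sqrt (Fintype.sum_of_injective f hf _ _ (fun j hj => ?_) fun i => ?_).symm
  · simp [extendL_apply_of_notMem v hj]
  · rw [extendL_apply hf]

end Extension

lemma norm_compLpL_of_isometry {X V W : Type*} [MeasurableSpace X] {μ : Measure X}
    [NormedAddCommGroup V] [NormedSpace ℝ V] [NormedAddCommGroup W] [NormedSpace ℝ W] {p : ℝ≥0∞}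
    [Fact (1 ≤ p)] {L : V →L[ℝ] W} (hL : ∀ v, ‖L v‖ = ‖v‖) (f : Lp V p μ) :
    ‖L.compLpL p μ f‖ = ‖f‖ := by
  rw [Lp.norm_def, Lp.norm_def]
  refine congrArg ENNReal.toReal (eLpNorm_congr_norm_ae ?_)
  filter_upwards [L.coeFn_compLpL f] with x hx
  rw [hx, hL]

/-- A field of `H¹(Ω; ℝᵐ)` extended to `m'` components, the new ones being `0`. -/
def extendH1 {m' : ℕ} (h : m ≤ m') (u : H1 Ω m) : H1 Ω m' where
  val := WithLp.toLp 2 ((extendL (Fin.castLE h)).compLpL 2 Ω.vol u.1.fst,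
    (extendL (Prod.map (Fin.castLE h) id)).compLpL 2 Ω.vol u.1.snd)
  property η hη i j := by
    have hfst := integral_congr_ae (μ := Ω.vol)
      (((extendL (Fin.castLE h)).coeFn_compLpL u.1.fst).mono fun x hx =>
        congrArg (fun v : E m' => v i * pd η j x) hx)
    have hsnd := integral_congr_ae (μ := Ω.vol)
      (((extendL (Prod.map (Fin.castLE h) id)).coeFn_compLpL u.1.snd).mono fun x hx =>
        congrArg (fun v : T m' n => v (i, j) * η x) hx)
    refine hfst.trans (Eq.trans ?_ (congrArg Neg.neg hsnd).symm)
    by_cases hi : i ∈ Set.range (Fin.castLE h)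
    · obtain ⟨i, rfl⟩ := hi
      have hrow (v : T m n) := extendL_apply ((Fin.castLE_injective h).prodMap
        (Function.injective_id (α := Fin n))) v (i, j)
      simp only [Prod.map_apply, id_eq] at hrow
      simpa only [extendL_apply (Fin.castLE_injective h), hrow] using u.2 η hη i j
    · have hij : (i, j) ∉ Set.range (Prod.map (Fin.castLE h) (id : Fin n → Fin n)) :=
        fun ⟨q, hq⟩ => hi ⟨q.1, congrArg Prod.fst hq⟩
      simp only [extendL_apply_of_notMem _ hi, extendL_apply_of_notMem _ hij, zero_mul,
        integral_zero, neg_zero]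

lemma norm_extendH1 {m' : ℕ} (h : m ≤ m') (u : H1 Ω m) : ‖extendH1 h u‖ = ‖u‖ := by
  change ‖(extendH1 h u).1‖ = ‖u.1‖
  rw [WithLp.prod_norm_eq_of_L2, WithLp.prod_norm_eq_of_L2]
  congr 3
  · exact norm_compLpL_of_isometry (norm_extendL (Fin.castLE_injective h)) _
  · exact norm_compLpL_of_isometry
      (norm_extendL ((Fin.castLE_injective h).prodMap Function.injective_id)) _

lemma sobolevConst_mono {m' : ℕ} (h : m ≤ m') (q : ℝ≥0∞) :
    sobolevConst Ω m q ≤ sobolevConst Ω m' q := by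
  refine le_sInf fun c hc => sInf_le fun u => ?_
  have hfst : (extendH1 h u).1.fst =ᵐ[Ω.vol] fun x => extendL (Fin.castLE h) (u.1.fst x) :=
    (extendL (Fin.castLE h)).coeFn_compLpL _
  calc eLpNorm u.1.fst q Ω.vol = eLpNorm (extendH1 h u).1.fst q Ω.vol :=
        eLpNorm_congr_norm_ae <| hfst.mono fun x hx => by
          rw [hx, norm_extendL (Fin.castLE_injective h)]
    _ ≤ c * ‖extendH1 h u‖ₑ := hc _
    _ = c * ‖u‖ₑ := by rw [← ofReal_norm, norm_extendH1, ofReal_norm]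

/-! ### The embeddings into `L^q` -/

lemma memLp_of_sobolevConst_ne_top {q : ℝ≥0∞} (hq : sobolevConst Ω m q ≠ ⊤) (u : H1 Ω m) :
    MemLp u.1.fst q Ω.vol :=
  ⟨Lp.aestronglyMeasurable _, (eLpNorm_le_sobolevConst q u).trans_lt
    (ENNReal.mul_lt_top hq.lt_top (by simp))⟩

/-- The injection of `H¹(Ω; ℝᵐ)` into `L^q(Ω; ℝᵐ)`. -/
def embL (Ω : PolyhedralDomain n) (m : ℕ) (q : ℝ≥0∞) [Fact (1 ≤ q)]
    (hq : sobolevConst Ω m q ≠ ⊤) : H1 Ω m →L[ℝ] Lp (E m) q Ω.vol :=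
  LinearMap.mkContinuous
    { toFun := fun u => (memLp_of_sobolevConst_ne_top hq u).toLp _
      map_add' := fun u v => by
        rw [← MemLp.toLp_add]
        exact MemLp.toLp_congr _ _ (Lp.coeFn_add u.1.fst v.1.fst)
      map_smul' := fun c u => by
        rw [RingHom.id_apply, ← MemLp.toLp_const_smul]
        exact MemLp.toLp_congr _ _ (Lp.coeFn_smul c u.1.fst) }
    (sobolevConst Ω m q).toReal fun u => by
      change ‖(memLp_of_sobolevConst_ne_top hq u).toLp _‖ ≤ _
      rw [Lp.norm_toLp, ← toReal_enorm u, ← ENNReal.toReal_mul]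
      exact ENNReal.toReal_mono (ENNReal.mul_ne_top hq (by simp)) (eLpNorm_le_sobolevConst q u)

lemma coeFn_embL {q : ℝ≥0∞} [Fact (1 ≤ q)] (hq : sobolevConst Ω m q ≠ ⊤) (u : H1 Ω m) :
    embL Ω m q hq u =ᵐ[Ω.vol] u.1.fst :=
  (memLp_of_sobolevConst_ne_top hq u).coeFn_toLp

lemma norm_embL_le {q : ℝ≥0∞} [Fact (1 ≤ q)] (hq : sobolevConst Ω m q ≠ ⊤) (u : H1 Ω m) :
    ‖embL Ω m q hq u‖ ≤ (sobolevConst Ω m q).toReal * ‖u‖ :=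
  (embL Ω m q hq).le_of_opNorm_le (LinearMap.mkContinuous_norm_le _ ENNReal.toReal_nonneg _) u

attribute [irreducible] embL

/-! ### The product `v ⊗ w` -/

instance : Fact ((1 : ℝ≥0∞) ≤ 4) := ⟨by norm_num⟩

instance : ENNReal.HolderTriple 4 4 2 := ⟨by
  rw [← ENNReal.toReal_eq_toReal_iff' (by simp) (by simp), ENNReal.toReal_add (by simp) (by simp)]
  norm_num [ENNReal.toReal_inv]⟩

lemma sobolevConst_four_ne_top (hc : c1 Ω ≠ ⊤) (hmn : m ≤ n) : sobolevConst Ω m 4 ≠ ⊤ :=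
  ne_top_of_le_ne_top (fun htop => hc (by rw [c1, htop]; rfl)) (sobolevConst_mono hmn 4)

/-- The map `(w, v) ↦ v ⊗ w` for `w ∈ H¹₀(Ω)` and `v ∈ H¹(Ω; ℝᵐ)`; it is `L²`-valued because both
factors belong to `L⁴`. -/
def dyadOp (hc : c1 Ω ≠ ⊤) (hmn : m ≤ n) : H10 Ω n →L[ℝ] H1 Ω m →L[ℝ] L2 Ω (T m n) :=
  ((dyadL m n).holderL Ω.vol 4 4 2).flip.bilinearComp
    (embL Ω n 4 (sobolevConst_four_ne_top hc le_rfl) ∘L incl Ω n)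
    (embL Ω m 4 (sobolevConst_four_ne_top hc hmn))

lemma coeFn_dyadOp (hc : c1 Ω ≠ ⊤) (hmn : m ≤ n) (w : H10 Ω n) (v : H1 Ω m) :
    dyadOp hc hmn w v =ᵐ[Ω.vol] fun ξ => dyad (v.1.fst ξ) (w.1.fst ξ) := by
  have hm := sobolevConst_four_ne_top hc hmn
  have hn := sobolevConst_four_ne_top hc le_rfl
  filter_upwards [coeFn_embL hm v, coeFn_embL hn (incl Ω n w),
    (dyadL m n).coeFn_holder (r := 2) (embL Ω m 4 hm v) (embL Ω n 4 hn (incl Ω n w))]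
    with ξ hv hw hmul
  refine Eq.trans hmul ?_
  rw [hv, hw]
  rfl

lemma norm_dyadOp_le (hc : c1 Ω ≠ ⊤) (hmn : m ≤ n) (w : H10 Ω n) (v : H1 Ω m) :
    ‖dyadOp hc hmn w v‖ ≤ (c1 Ω).toReal * ‖w‖ * ‖v‖ := by
  have hm := sobolevConst_four_ne_top hc hmn
  have hn := sobolevConst_four_ne_top hc le_rfl
  have hv : ‖embL Ω m 4 hm v‖ ≤ (sobolevConst Ω n 4).toReal * ‖v‖ :=
    (norm_embL_le hm v).trans (mul_le_mul_of_nonneg_right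
      (ENNReal.toReal_mono hn (sobolevConst_mono hmn 4)) (norm_nonneg v))
  have hw : ‖embL Ω n 4 hn (incl Ω n w)‖ ≤ (sobolevConst Ω n 4).toReal * ‖w‖ := norm_embL_le hn _
  calc ‖dyadOp hc hmn w v‖ ≤ ‖dyadL m n‖ * ‖embL Ω m 4 hm v‖ * ‖embL Ω n 4 hn (incl Ω n w)‖ :=
        (dyadL m n).norm_holder_apply_apply_le _ _
    _ ≤ 1 * ((sobolevConst Ω n 4).toReal * ‖v‖) * ((sobolevConst Ω n 4).toReal * ‖w‖) := by
        gcongr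
        exact norm_dyadL_le
    _ = (c1 Ω).toReal * ‖w‖ * ‖v‖ := by
        rw [c1, ENNReal.toReal_pow]
        ring

attribute [irreducible] dyadOp

/-! ### The components of `ℍ` -/

/-- The bounded linear map `(t, σ, u) ↦ t`. -/
def tL (Ω : PolyhedralDomain n) : HH Ω →L[ℝ] L2 Ω (T n n) :=
  (Ltr Ω).subtypeL ∘L WithLp.fstL 2 ℝ _ _

/-- The bounded linear map `(t, σ, u) ↦ σ`. -/
def σL (Ω : PolyhedralDomain n) : HH Ω →L[ℝ] L2 Ω (T n n) :=
  WithLp.fstL 2 ℝ _ _ ∘L (Hdiv0 Ω).subtypeL ∘L WithLp.fstL 2 ℝ _ _ ∘L WithLp.sndL 2 ℝ _ _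

/-- The bounded linear map `(t, σ, u) ↦ div σ`. -/
def divL (Ω : PolyhedralDomain n) : HH Ω →L[ℝ] L2 Ω (E n) :=
  WithLp.sndL 2 ℝ _ _ ∘L (Hdiv0 Ω).subtypeL ∘L WithLp.fstL 2 ℝ _ _ ∘L WithLp.sndL 2 ℝ _ _

/-- The bounded linear map `(t, σ, u) ↦ u`, with values in `H¹₀(Ω)`. -/
def velL (Ω : PolyhedralDomain n) : HH Ω →L[ℝ] H10 Ω n :=
  WithLp.sndL 2 ℝ _ _ ∘L WithLp.sndL 2 ℝ _ _

/-- The bounded linear map `(t, σ, u) ↦ u`, with values in `L²(Ω)`. -/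
def uL (Ω : PolyhedralDomain n) : HH Ω →L[ℝ] L2 Ω (E n) :=
  WithLp.fstL 2 ℝ _ _ ∘L (H10 Ω n).subtypeL ∘L velL Ω

/-- The bounded linear map `(t, σ, u) ↦ ∇u`. -/
def graduL (Ω : PolyhedralDomain n) : HH Ω →L[ℝ] L2 Ω (T n n) :=
  WithLp.sndL 2 ℝ _ _ ∘L (H10 Ω n).subtypeL ∘L velL Ω

lemma HH.norm_vel_sq (x : HH Ω) : ‖x.vel‖ ^ 2 = ‖x.u‖ ^ 2 + ‖x.gradu‖ ^ 2 :=
  WithLp.prod_norm_sq_eq_of_L2 x.vel.1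

lemma HH.norm_sq (x : HH Ω) : ‖x‖ ^ 2 =
    ‖x.t‖ ^ 2 + (‖x.σ‖ ^ 2 + ‖x.divσ‖ ^ 2) + (‖x.u‖ ^ 2 + ‖x.gradu‖ ^ 2) := by
  have hσ : ‖x.snd.fst‖ ^ 2 = ‖x.σ‖ ^ 2 + ‖x.divσ‖ ^ 2 :=
    WithLp.prod_norm_sq_eq_of_L2 x.snd.fst.1
  rw [← HH.norm_vel_sq, ← hσ, WithLp.prod_norm_sq_eq_of_L2, WithLp.prod_norm_sq_eq_of_L2,
    ← add_assoc]
  rfl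

lemma HH.norm_vel_le (x : HH Ω) : ‖x.vel‖ ≤ ‖x‖ :=
  (WithLp.norm_snd_le _ x.snd).trans (WithLp.norm_snd_le _ x)

lemma norm_sub_smul_le {V : Type*} [NormedAddCommGroup V] [NormedSpace ℝ V] (x y : V) (κ : ℝ)
    {N : ℝ} (hN : 0 ≤ N) (hxy : ‖x‖ ^ 2 + ‖y‖ ^ 2 ≤ N ^ 2) :
    ‖x - κ • y‖ ≤ √(1 + κ ^ 2) * N := by
  have htriangle : ‖x - κ • y‖ ≤ ‖x‖ + |κ| * ‖y‖ := by
    simpa only [norm_smul, Real.norm_eq_abs] using norm_sub_le x (κ • y)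
  refine htriangle.trans (le_of_sq_le_sq ?_ (by positivity))
  calc (‖x‖ + |κ| * ‖y‖) ^ 2 ≤ (1 + |κ| ^ 2) * (‖x‖ ^ 2 + ‖y‖ ^ 2) := by
        nlinarith [sq_nonneg (|κ| * ‖x‖ - ‖y‖)]
    _ ≤ (1 + |κ| ^ 2) * N ^ 2 := by gcongr
    _ = (√(1 + κ ^ 2) * N) ^ 2 := by rw [sq_abs, mul_pow, Real.sq_sqrt (by positivity)]

lemma sqrt_one_add_le (κ : ℝ) : √(1 + κ ^ 2) ≤ √(2 + κ ^ 2) := Real.sqrt_le_sqrt (by linarith)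

lemma HH.norm_t_sub_smul_devLp_le (κ : ℝ) (y : HH Ω) :
    ‖y.t - κ • devLp Ω y.σ‖ ≤ √(2 + κ ^ 2) * ‖y‖ := by
  refine (norm_sub_smul_le _ _ κ (norm_nonneg y) ?_).trans
    (mul_le_mul_of_nonneg_right (sqrt_one_add_le κ) (norm_nonneg y))
  have hdev : ‖devLp Ω y.σ‖ ^ 2 ≤ ‖y.σ‖ ^ 2 := by gcongr; exact norm_devLp_le _
  nlinarith [HH.norm_sq y, sq_nonneg ‖y.divσ‖, sq_nonneg ‖y.u‖, sq_nonneg ‖y.gradu‖]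

lemma HH.norm_u_sub_smul_divσ_le (κ : ℝ) (y : HH Ω) :
    ‖y.u - κ • y.divσ‖ ≤ √(2 + κ ^ 2) * ‖y‖ := by
  refine (norm_sub_smul_le _ _ κ (norm_nonneg y) ?_).trans
    (mul_le_mul_of_nonneg_right (sqrt_one_add_le κ) (norm_nonneg y))
  nlinarith [HH.norm_sq y, sq_nonneg ‖y.t‖, sq_nonneg ‖y.σ‖, sq_nonneg ‖y.gradu‖]

/-! ### The form `A_φ` and its ellipticity -/

/-- The bounded bilinear form `(x, y) ↦ ⟪f x, g y⟫`. -/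
def pairL {X Y V : Type*} [NormedAddCommGroup X] [NormedSpace ℝ X] [NormedAddCommGroup Y]
    [NormedSpace ℝ Y] [NormedAddCommGroup V] [InnerProductSpace ℝ V] (f : X →L[ℝ] V)
    (g : Y →L[ℝ] V) : X →L[ℝ] Y →L[ℝ] ℝ :=
  (innerSL ℝ : V →L[ℝ] V →L[ℝ] ℝ).bilinearComp f g

/-- Multiplication by the scalar field `ν(φ)`, as an operator on `L²(Ω)`. -/
def viscOp (ν : E 2 → ℝ) (φ : H1 Ω 2) : L2 Ω (T n n) →L[ℝ] L2 Ω (T n n) :=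
  mulOp Ω.vol fun ξ => ν (φ.1.fst ξ) • ContinuousLinearMap.id ℝ (T n n)

section Viscosity

variable {ν : E 2 → ℝ} {ν₁ ν₂ : ℝ}

lemma memLp_visc (hν : Continuous ν) (hν₂ : ∀ a, |ν a| ≤ ν₂) (φ : H1 Ω 2) :
    MemLp (fun ξ => ν (φ.1.fst ξ) • ContinuousLinearMap.id ℝ (T n n)) ⊤ Ω.vol := by
  refine memLp_top_of_bound
    ((hν.comp_aestronglyMeasurable (Lp.aestronglyMeasurable φ.1.fst)).smul_const _) ν₂
    (Eventually.of_forall fun ξ => ?_)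
  rw [norm_smul, Real.norm_eq_abs]
  exact (mul_le_of_le_one_right (abs_nonneg _) ContinuousLinearMap.norm_id_le).trans (hν₂ _)

lemma coeFn_viscOp (hν : Continuous ν) (hν₂ : ∀ a, |ν a| ≤ ν₂) (φ : H1 Ω 2) (t : L2 Ω (T n n)) :
    viscOp ν φ t =ᵐ[Ω.vol] fun ξ => ν (φ.1.fst ξ) • t ξ :=
  coeFn_mulOp (memLp_visc hν hν₂ φ) t

lemma norm_viscOp_le (hν : Continuous ν) (hν₂ : ∀ a, |ν a| ≤ ν₂) (φ : H1 Ω 2) (t : L2 Ω (T n n)) :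
    ‖viscOp ν φ t‖ ≤ ν₂ * ‖t‖ :=
  norm_mulOp_le (memLp_visc hν hν₂ φ) (Eventually.of_forall fun ξ τ =>
    (norm_smul (ν (φ.1.fst ξ)) τ).trans_le (mul_le_mul_of_nonneg_right (hν₂ _) (norm_nonneg τ))) t

lemma le_inner_viscOp (hν : Continuous ν) (hν₂ : ∀ a, |ν a| ≤ ν₂) (hν₁ : ∀ a, ν₁ ≤ ν a)
    (φ : H1 Ω 2) (t : L2 Ω (T n n)) : ν₁ * ‖t‖ ^ 2 ≤ inner ℝ (viscOp ν φ t) t :=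
  le_inner_mulOp (memLp_visc hν hν₂ φ) (Eventually.of_forall fun ξ τ => by
    change _ ≤ inner ℝ (ν (φ.1.fst ξ) • τ) τ
    rw [real_inner_smul_left, real_inner_self_eq_norm_sq]
    exact mul_le_mul_of_nonneg_right (hν₁ _) (sq_nonneg _)) t

attribute [irreducible] viscOp

/-- Hölder's inequality with `1 / p + 1 / q = 1 / 2`: this is where the extra integrability of `t`
provided by the `ε`-regularity enters. -/
lemma enorm_viscOp_sub_le {K : NNReal} (hν : LipschitzWith K ν) (hν₂ : ∀ a, |ν a| ≤ ν₂)
    (φ φ' : H1 Ω 2) (t : L2 Ω (T n n)) {p q : ℝ≥0∞} [ENNReal.HolderTriple p q 2] :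
    ‖viscOp ν φ t - viscOp ν φ' t‖ₑ ≤
      K * eLpNorm (φ - φ').1.fst p Ω.vol * eLpNorm t q Ω.vol := by
  calc ‖viscOp ν φ t - viscOp ν φ' t‖ₑ
      ≤ eLpNorm (fun ξ => (K * ‖(φ - φ').1.fst ξ‖) • t ξ) 2 Ω.vol := by
        rw [Lp.enorm_def]
        refine eLpNorm_mono_ae ?_
        filter_upwards [Lp.coeFn_sub (viscOp ν φ t) (viscOp ν φ' t),
          coeFn_viscOp hν.continuous hν₂ φ t, coeFn_viscOp hν.continuous hν₂ φ' t,
          Lp.coeFn_sub φ.1.fst φ'.1.fst] with ξ hsub hφ hφ' (hdiff : (φ - φ').1.fst ξ = _)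
        rw [hsub, Pi.sub_apply, hφ, hφ', ← sub_smul, norm_smul, norm_smul, hdiff, norm_mul,
          norm_norm, NNReal.norm_eq]
        exact mul_le_mul_of_nonneg_right (hν.norm_sub_le _ _) (norm_nonneg _)
    _ ≤ K * eLpNorm (φ - φ').1.fst p Ω.vol * eLpNorm t q Ω.vol :=
        eLpNorm_le_eLpNorm_mul_eLpNorm_of_nnnorm (Lp.aestronglyMeasurable _)
          (Lp.aestronglyMeasurable t) (fun a b => (K * ‖a‖) • b) K <|
          Eventually.of_forall fun ξ => by
            rw [nnnorm_smul, nnnorm_mul, nnnorm_norm, NNReal.nnnorm_eq]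

end Viscosity

/-- The form `A_φ` with arbitrary bounded operators in place of the components of `ℍ`, which
separates its algebraic shape from the function spaces. -/
def flowForm {X V U : Type*} [NormedAddCommGroup X] [NormedSpace ℝ X] [NormedAddCommGroup V]
    [InnerProductSpace ℝ V] [NormedAddCommGroup U] [InnerProductSpace ℝ U]
    (νt t σ σd e s : X →L[ℝ] V) (u d : X →L[ℝ] U) (γ κ₁ κ₂ κ₃ : ℝ) : X →L[ℝ] X →L[ℝ] ℝ :=
  (2 : ℝ) • pairL νt (t - κ₃ • σd) + pairL t (σd - κ₁ • e) - pairL σd (t - κ₃ • σd)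
    + (1 - κ₂ * γ) • pairL u d - pairL d u + pairL s σ - pairL σ s
    + γ • pairL u u + κ₂ • pairL d d + κ₁ • pairL e e

/-- The form `A_φ` as a bounded bilinear form, with an operator `M` in place of multiplication by
`ν(φ)`. -/
def flowA (M : L2 Ω (T n n) →L[ℝ] L2 Ω (T n n)) (γ κ₁ κ₂ κ₃ : ℝ) : HH Ω →L[ℝ] HH Ω →L[ℝ] ℝ :=
  flowForm (M ∘L tL Ω) (tL Ω) (σL Ω) (devLp Ω ∘L σL Ω) (symLp Ω ∘L graduL Ω)
    (skewLp Ω ∘L graduL Ω) (uL Ω) (divL Ω) γ κ₁ κ₂ κ₃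

lemma flowA_apply (M : L2 Ω (T n n) →L[ℝ] L2 Ω (T n n)) (γ κ₁ κ₂ κ₃ : ℝ) (x y : HH Ω) :
    flowA M γ κ₁ κ₂ κ₃ x y =
      2 * inner ℝ (M x.t) (y.t - κ₃ • devLp Ω y.σ)
      + inner ℝ x.t (devLp Ω y.σ - κ₁ • symLp Ω y.gradu)
      - inner ℝ (devLp Ω x.σ) (y.t - κ₃ • devLp Ω y.σ)
      + (1 - κ₂ * γ) * inner ℝ x.u y.divσ - inner ℝ x.divσ y.u
      + inner ℝ (skewLp Ω x.gradu) y.σ - inner ℝ x.σ (skewLp Ω y.gradu)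
      + γ * inner ℝ x.u y.u + κ₂ * inner ℝ x.divσ y.divσ
      + κ₁ * inner ℝ (symLp Ω x.gradu) (symLp Ω y.gradu) := rfl

attribute [irreducible] flowA

lemma formA_eq_flowA {ν : E 2 → ℝ} {ν₂ : ℝ} (hν : Continuous ν) (hν₂ : ∀ a, |ν a| ≤ ν₂)
    (γ κ₁ κ₂ κ₃ : ℝ) (φ : H1 Ω 2) (x y : HH Ω) :
    formA Ω ν γ κ₁ κ₂ κ₃ φ x y = flowA (viscOp ν φ) γ κ₁ κ₂ κ₃ x y := by
  have hy := coeFn_sub_smul κ₃ y.t (devLp Ω y.σ) EventuallyEq.rfl (coeFn_devLp _)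
  have hy' := coeFn_sub_smul κ₁ (devLp Ω y.σ) (symLp Ω y.gradu) (coeFn_devLp _) (coeFn_symLp _)
  rw [flowA_apply, formA]
  simp only [← real_inner_smul_left]
  rw [integral_inner_eq _ _ (coeFn_viscOp hν hν₂ φ x.t) hy,
    integral_inner_eq _ _ EventuallyEq.rfl hy',
    integral_inner_eq _ _ (coeFn_devLp x.σ) hy,
    integral_inner_eq x.u y.divσ EventuallyEq.rfl EventuallyEq.rfl,
    integral_inner_eq y.u x.divσ EventuallyEq.rfl EventuallyEq.rfl,
    integral_inner_eq _ y.σ (coeFn_skewLp x.gradu) EventuallyEq.rfl,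
    integral_inner_eq x.σ _ EventuallyEq.rfl (coeFn_skewLp y.gradu),
    integral_inner_eq x.u y.u EventuallyEq.rfl EventuallyEq.rfl,
    integral_inner_eq x.divσ y.divσ EventuallyEq.rfl EventuallyEq.rfl,
    integral_inner_eq _ _ (coeFn_symLp x.gradu) (coeFn_symLp y.gradu)]
  simp only [real_inner_smul_left, real_inner_comm y.u x.divσ]

lemma flowA_sub_flowA (M M' : L2 Ω (T n n) →L[ℝ] L2 Ω (T n n)) (γ κ₁ κ₂ κ₃ : ℝ) (x y : HH Ω) :
    flowA M γ κ₁ κ₂ κ₃ x y - flowA M' γ κ₁ κ₂ κ₃ x y =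
      2 * inner ℝ (M x.t - M' x.t) (y.t - κ₃ • devLp Ω y.σ) := by
  rw [flowA_apply, flowA_apply, inner_sub_left]
  ring

lemma flowA_apply_self (M : L2 Ω (T n n) →L[ℝ] L2 Ω (T n n)) (γ κ₁ κ₂ κ₃ : ℝ) (x : HH Ω) :
    flowA M γ κ₁ κ₂ κ₃ x x =
      2 * inner ℝ (M x.t) x.t - 2 * κ₃ * inner ℝ (M x.t) (devLp Ω x.σ)
      - κ₁ * inner ℝ x.t (symLp Ω x.gradu) - κ₂ * γ * inner ℝ x.u x.divσ
      + κ₃ * ‖devLp Ω x.σ‖ ^ 2 + κ₂ * ‖x.divσ‖ ^ 2 + γ * ‖x.u‖ ^ 2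
      + κ₁ * ‖symLp Ω x.gradu‖ ^ 2 := by
  rw [flowA_apply, real_inner_comm x.u x.divσ, real_inner_comm x.σ (skewLp Ω x.gradu)]
  simp only [inner_sub_right, real_inner_smul_right, real_inner_self_eq_norm_sq]
  rw [real_inner_comm x.t (devLp Ω x.σ)]
  ring

lemma mul_le_young {δ : ℝ} (hδ : 0 < δ) (a b : ℝ) :
    a * b ≤ a ^ 2 / (2 * δ) + δ / 2 * b ^ 2 := by
  rw [div_add' _ _ _ (by positivity), le_div_iff₀ (by positivity)]
  nlinarith [sq_nonneg (a - δ * b)]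

section Ellipticity

variable {M : L2 Ω (T n n) →L[ℝ] L2 Ω (T n n)} {ν₁ ν₂ γ κ₁ κ₂ κ₃ δ₁ δ₂ δ₃ : ℝ}

lemma le_flowA_apply_self (hν₂ : 0 ≤ ν₂) (hγ : 0 ≤ γ) (hκ₁ : 0 ≤ κ₁) (hκ₂ : 0 ≤ κ₂) (hκ₃ : 0 ≤ κ₃)
    (hδ₁ : 0 < δ₁) (hδ₂ : 0 < δ₂) (hδ₃ : 0 < δ₃) (hM : ∀ t, ‖M t‖ ≤ ν₂ * ‖t‖)
    (hM' : ∀ t, ν₁ * ‖t‖ ^ 2 ≤ inner ℝ (M t) t) (x : HH Ω) :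
    (2 * ν₁ - κ₃ * ν₂ / δ₁ - κ₁ / (2 * δ₃)) * ‖x.t‖ ^ 2
      + κ₃ * (1 - ν₂ * δ₁) * ‖devLp Ω x.σ‖ ^ 2 + κ₂ * (1 - γ * δ₂ / 2) * ‖x.divσ‖ ^ 2
      + γ * (1 - κ₂ / (2 * δ₂)) * ‖x.u‖ ^ 2 + κ₁ * (1 - δ₃ / 2) * ‖symLp Ω x.gradu‖ ^ 2
      ≤ flowA M γ κ₁ κ₂ κ₃ x x := by
  have hMtσ : inner ℝ (M x.t) (devLp Ω x.σ) ≤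
      ν₂ * (‖x.t‖ ^ 2 / (2 * δ₁) + δ₁ / 2 * ‖devLp Ω x.σ‖ ^ 2) :=
    calc inner ℝ (M x.t) (devLp Ω x.σ) ≤ ν₂ * ‖x.t‖ * ‖devLp Ω x.σ‖ :=
          (real_inner_le_norm _ _).trans (mul_le_mul_of_nonneg_right (hM _) (norm_nonneg _))
      _ ≤ ν₂ * (‖x.t‖ ^ 2 / (2 * δ₁) + δ₁ / 2 * ‖devLp Ω x.σ‖ ^ 2) := by
          rw [mul_assoc]
          exact mul_le_mul_of_nonneg_left (mul_le_young hδ₁ _ _) hν₂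
  have hte := (real_inner_le_norm x.t (symLp Ω x.gradu)).trans (mul_le_young hδ₃ _ _)
  have hud := (real_inner_le_norm x.u x.divσ).trans (mul_le_young hδ₂ _ _)
  have hMtσ' := mul_le_mul_of_nonneg_left hMtσ (by positivity : 0 ≤ 2 * κ₃)
  have hte' := mul_le_mul_of_nonneg_left hte hκ₁
  have hud' := mul_le_mul_of_nonneg_left hud (mul_nonneg hκ₂ hγ)
  rw [flowA_apply_self]
  linear_combination 2 * hM' x.t + hMtσ' + hte' + hud'

lemma mul_norm_sq_le_flowA {a μ : ℝ} (ha : 0 ≤ a) (hμ : 0 ≤ μ) (hν₂ : 0 ≤ ν₂) (hγ : 0 ≤ γ)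
    (hκ₁ : 0 ≤ κ₁) (hκ₂ : 0 ≤ κ₂) (hκ₃ : 0 ≤ κ₃) (hδ₁ : 0 < δ₁) (hδ₂ : 0 < δ₂) (hδ₃ : 0 < δ₃)
    (hat : a ≤ 2 * ν₁ - κ₃ * ν₂ / δ₁ - κ₁ / (2 * δ₃)) (hc2 : c2 Ω ≠ 0) (haσ : a ≤ c2 Ω * μ)
    (hμσ : μ ≤ κ₃ * (1 - ν₂ * δ₁)) (hμd : μ ≤ κ₂ / 2 * (1 - γ * δ₂ / 2))
    (had : a ≤ κ₂ / 2 * (1 - γ * δ₂ / 2)) (hau : a ≤ γ * (1 - κ₂ / (2 * δ₂)))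
    (hae : a ≤ κ₁ / 2 * (1 - δ₃)) (hM : ∀ t, ‖M t‖ ≤ ν₂ * ‖t‖)
    (hM' : ∀ t, ν₁ * ‖t‖ ^ 2 ≤ inner ℝ (M t) t) (x : HH Ω) :
    a * ‖x‖ ^ 2 ≤ flowA M γ κ₁ κ₂ κ₃ x x := by
  have hσ : a * ‖x.σ‖ ^ 2 ≤
      κ₃ * (1 - ν₂ * δ₁) * ‖devLp Ω x.σ‖ ^ 2 + κ₂ / 2 * (1 - γ * δ₂ / 2) * ‖x.divσ‖ ^ 2 :=
    calc a * ‖x.σ‖ ^ 2 ≤ c2 Ω * μ * ‖x.σ‖ ^ 2 := by gcongr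
      _ = μ * (c2 Ω * ‖x.σ‖ ^ 2) := by ring
      _ ≤ μ * (‖devLp Ω x.σ‖ ^ 2 + ‖x.divσ‖ ^ 2) := by
          gcongr
          exact c2_mul_le hc2 x.snd.fst
      _ ≤ _ := by
          rw [mul_add]
          gcongr
  have hgrad : a * ‖x.gradu‖ ^ 2 ≤ κ₁ * (1 - δ₃) * ‖symLp Ω x.gradu‖ ^ 2 :=
    calc a * ‖x.gradu‖ ^ 2 ≤ a * (2 * ‖symLp Ω x.gradu‖ ^ 2) := by
          gcongr
          exact korn x.vel
      _ ≤ κ₁ / 2 * (1 - δ₃) * (2 * ‖symLp Ω x.gradu‖ ^ 2) := by gcongr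
      _ = κ₁ * (1 - δ₃) * ‖symLp Ω x.gradu‖ ^ 2 := by ring
  have hslack : 0 ≤ κ₁ * δ₃ / 2 * ‖symLp Ω x.gradu‖ ^ 2 := by positivity
  refine ((congrArg (a * ·) (HH.norm_sq x)).trans_le ?_).trans
    (le_flowA_apply_self hν₂ hγ hκ₁ hκ₂ hκ₃ hδ₁ hδ₂ hδ₃ hM hM' x)
  linear_combination mul_le_mul_of_nonneg_right hat (sq_nonneg ‖x.t‖) + hσ +
    mul_le_mul_of_nonneg_right had (sq_nonneg ‖x.divσ‖) +
    mul_le_mul_of_nonneg_right hau (sq_nonneg ‖x.u‖) + hgrad + hslack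

lemma flowA_coercive (hν₂ : 0 ≤ ν₂) (hγ : 0 ≤ γ) (hκ₁ : 0 ≤ κ₁) (hκ₂ : 0 ≤ κ₂) (hκ₃ : 0 ≤ κ₃)
    (hδ₁ : 0 < δ₁) (hδ₂ : 0 < δ₂) (hδ₃ : 0 < δ₃) (ha : 0 < ellA Ω ν₁ ν₂ γ κ₁ κ₂ κ₃ δ₁ δ₂ δ₃)
    (hM : ∀ t, ‖M t‖ ≤ ν₂ * ‖t‖) (hM' : ∀ t, ν₁ * ‖t‖ ^ 2 ≤ inner ℝ (M t) t) (x : HH Ω) :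
    ellA Ω ν₁ ν₂ γ κ₁ κ₂ κ₃ δ₁ δ₂ δ₃ * ‖x‖ ^ 2 ≤ flowA M γ κ₁ κ₂ κ₃ x x := by
  obtain ⟨hat, haσ, had, hau, hae⟩ : _ ≤ _ ∧ _ ≤ _ ∧ _ ≤ _ ∧ _ ≤ _ ∧ _ ≤ _ := by
    simpa only [le_min_iff] using (ellA.eq_def Ω ν₁ ν₂ γ κ₁ κ₂ κ₃ δ₁ δ₂ δ₃).le
  have hc2μ := ha.trans_le haσ
  exact mul_norm_sq_le_flowA ha.le (pos_of_mul_pos_right hc2μ c2_nonneg).le hν₂ hγ hκ₁ hκ₂ hκ₃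
    hδ₁ hδ₂ hδ₃ hat (left_ne_zero_of_mul hc2μ.ne') haσ (min_le_left _ _) (min_le_right _ _)
    had hau hae hM hM' x

end Ellipticity

/-! ### The form `B_w` and the functional `F_φ` -/

/-- The form `B_w` as a bounded bilinear form. -/
def flowB (hc : c1 Ω ≠ ⊤) (κ₃ : ℝ) (w : H10 Ω n) : HH Ω →L[ℝ] HH Ω →L[ℝ] ℝ :=
  -pairL (devLp Ω ∘L dyadOp hc le_rfl w ∘L incl Ω n ∘L velL Ω) (tL Ω - κ₃ • (devLp Ω ∘L σL Ω))

lemma flowB_apply (hc : c1 Ω ≠ ⊤) (κ₃ : ℝ) (w : H10 Ω n) (x y : HH Ω) :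
    flowB hc κ₃ w x y =
      -inner ℝ (devLp Ω (dyadOp hc le_rfl w (incl Ω n x.vel))) (y.t - κ₃ • devLp Ω y.σ) := rfl

attribute [irreducible] flowB

lemma formB_eq_flowB (hc : c1 Ω ≠ ⊤) (κ₃ : ℝ) (w : H10 Ω n) (x y : HH Ω) :
    formB Ω κ₃ w x y = flowB hc κ₃ w x y := by
  have hy := coeFn_sub_smul κ₃ y.t (devLp Ω y.σ) EventuallyEq.rfl (coeFn_devLp _)
  have hdev : devLp Ω (dyadOp hc le_rfl w (incl Ω n x.vel)) =ᵐ[Ω.vol]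
      fun ξ => dev (dyad (x.u ξ) (w.1.fst ξ)) :=
    (coeFn_devLp _).trans ((coeFn_dyadOp hc le_rfl w (incl Ω n x.vel)).fun_comp dev)
  rw [flowB_apply, ← integral_inner_eq _ _ hdev hy, formB, ← integral_neg]
  simp only [← inner_neg_right, neg_sub]

lemma abs_flowB_le (hc : c1 Ω ≠ ⊤) (κ₃ : ℝ) (w : H10 Ω n) (x y : HH Ω) :
    |flowB hc κ₃ w x y| ≤ (c1 Ω).toReal * ‖w‖ * ‖x.vel‖ * (√(2 + κ₃ ^ 2) * ‖y‖) := by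
  rw [flowB_apply, abs_neg]
  exact (abs_real_inner_le_norm _ _).trans <| mul_le_mul
    ((norm_devLp_le _).trans (norm_dyadOp_le hc le_rfl w (incl Ω n x.vel)))
    (HH.norm_t_sub_smul_devLp_le κ₃ y) (norm_nonneg _) (by positivity)

lemma flowB_sub (hc : c1 Ω ≠ ⊤) (κ₃ : ℝ) (w w' : H10 Ω n) (x y : HH Ω) :
    flowB hc κ₃ (w - w') x y = flowB hc κ₃ w x y - flowB hc κ₃ w' x y := by
  simp only [flowB_apply, map_sub, sub_apply, inner_sub_left]
  ring

/-- The functional `F_φ` as a bounded linear functional. -/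
def flowF (κ₂ : ℝ) (α : E 2) (g : E n) (φ : H1 Ω 2) : HH Ω →L[ℝ] ℝ :=
  pairL ((buoyL α g).compLpL 2 Ω.vol) (uL Ω - κ₂ • divL Ω) φ.1.fst

lemma flowF_apply (κ₂ : ℝ) (α : E 2) (g : E n) (φ : H1 Ω 2) (y : HH Ω) :
    flowF κ₂ α g φ y = inner ℝ ((buoyL α g).compLpL 2 Ω.vol φ.1.fst) (y.u - κ₂ • y.divσ) := rfl

attribute [irreducible] flowF

lemma formF_eq_flowF (κ₂ : ℝ) (α : E 2) (g : E n) (φ : H1 Ω 2) (y : HH Ω) :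
    formF Ω κ₂ α g φ y = flowF κ₂ α g φ y := by
  rw [flowF_apply, ← integral_inner_eq _ _ ((buoyL α g).coeFn_compLpL φ.1.fst)
    (coeFn_sub_smul κ₂ y.u y.divσ EventuallyEq.rfl EventuallyEq.rfl), formF]
  simp only [buoyL_apply, real_inner_smul_left]

lemma abs_flowF_le (κ₂ : ℝ) (α : E 2) (g : E n) (φ : H1 Ω 2) (y : HH Ω) :
    |flowF κ₂ α g φ y| ≤ ‖α‖ * ‖g‖ * ‖φ.1.fst‖ * (√(2 + κ₂ ^ 2) * ‖y‖) := by
  have hbuoy : ‖(buoyL α g).compLpL 2 Ω.vol φ.1.fst‖ ≤ ‖α‖ * ‖g‖ * ‖φ.1.fst‖ := by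
    refine Lp.norm_le_mul_norm_of_ae_le_mul ?_
    filter_upwards [(buoyL α g).coeFn_compLpL φ.1.fst] with ξ hξ
    exact hξ ▸ norm_buoyL_apply_le _ _ _
  rw [flowF_apply]
  exact (abs_real_inner_le_norm _ _).trans <|
    mul_le_mul hbuoy (HH.norm_u_sub_smul_divσ_le κ₂ y) (norm_nonneg _) (by positivity)

lemma flowF_sub (κ₂ : ℝ) (α : E 2) (g : E n) (φ φ' : H1 Ω 2) (y : HH Ω) :
    flowF κ₂ α g (φ - φ') y = flowF κ₂ α g φ y - flowF κ₂ α g φ' y := by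
  rw [flowF_apply, flowF_apply, flowF_apply, ← inner_sub_left, ← map_sub]
  rfl

/-! ### The transport forms -/

/-- The map `φ ↦ ∇φ` on `H¹(Ω)²`. -/
def gradL (Ω : PolyhedralDomain n) : H1 Ω 2 →L[ℝ] L2 Ω (T 2 n) :=
  WithLp.sndL 2 ℝ _ _ ∘L (H1 Ω 2).subtypeL

/-- The field of operators `τ ↦ 𝕂 τ`, for `𝕂 = diag(k₁, k₂)`. -/
def diffField (k : Fin 2 → E n → ℝ) (ξ : E n) : T 2 n →L[ℝ] T 2 n := ∑ i, k i ξ • rowL 2 n i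

lemma memLp_top_sum_smul {X W : Type*} [MeasurableSpace X] {μ : Measure X} [NormedAddCommGroup W]
    [NormedSpace ℝ W] {k : Fin m → X → ℝ} (hk : ∀ i, MemLp (k i) ⊤ μ) (A : Fin m → W) :
    MemLp (fun ξ => ∑ i, k i ξ • A i) ⊤ μ :=
  memLp_finsetSum Finset.univ fun i _ => (hk i).of_le_mul (c := ‖A i‖) ((hk i).1.smul_const _)
    (Eventually.of_forall fun ξ => by rw [norm_smul, mul_comm])

/-- The form `C` as a bounded bilinear form. -/
def transC (k : Fin 2 → E n → ℝ) : H1 Ω 2 →L[ℝ] H1 Ω 2 →L[ℝ] ℝ :=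
  pairL (mulOp Ω.vol (diffField k) ∘L gradL Ω) (gradL Ω)

lemma transC_apply (k : Fin 2 → E n → ℝ) (χ ψ : H1 Ω 2) :
    transC k χ ψ = inner ℝ (mulOp Ω.vol (diffField k) χ.1.snd) ψ.1.snd := rfl

attribute [irreducible] transC

section Diffusion

variable {k : Fin 2 → E n → ℝ} (hk : ∀ i, MemLp (k i) ⊤ Ω.vol)

include hk

lemma formC_eq_transC (χ ψ : H1 Ω 2) : formC Ω k χ ψ = transC k χ ψ := by
  have hK : mulOp Ω.vol (diffField k) χ.1.snd =ᵐ[Ω.vol]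
      fun ξ => diagMul (fun i => k i ξ) (χ.1.snd ξ) :=
    (coeFn_mulOp (memLp_top_sum_smul hk _) χ.1.snd).trans
      (Eventually.of_forall fun ξ => sum_smul_rowL _ _)
  rw [transC_apply, ← integral_inner_eq _ _ hK EventuallyEq.rfl, formC]

lemma normK_ne_top : normK Ω k ≠ ⊤ :=
  iSup_ne_top fun i => (hk i).2.ne

lemma abs_transC_le (χ ψ : H1 Ω 2) :
    |transC k χ ψ| ≤ (normK Ω k).toReal * ‖χ‖ * ‖ψ‖ := by
  have hk_le : ∀ᵐ ξ ∂Ω.vol, ∀ i, |k i ξ| ≤ (normK Ω k).toReal := by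
    refine ae_all_iff.2 fun i => ?_
    filter_upwards [ae_le_eLpNormEssSup (f := k i) (μ := Ω.vol)] with ξ hξ
    rw [← Real.norm_eq_abs, ← toReal_enorm]
    rw [← eLpNorm_exponent_top] at hξ
    exact ENNReal.toReal_mono (normK_ne_top hk)
      (hξ.trans (le_iSup (fun i => eLpNorm (k i) ⊤ Ω.vol) i))
  have hK := norm_mulOp_le (memLp_top_sum_smul hk _)
    (hk_le.mono fun ξ hξ τ => (congrArg norm (sum_smul_rowL _ τ)).trans_le
      (norm_diagMul_le hξ ENNReal.toReal_nonneg τ)) χ.1.snd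
  rw [transC_apply]
  calc |inner ℝ (mulOp Ω.vol (diffField k) χ.1.snd) ψ.1.snd|
      ≤ (normK Ω k).toReal * ‖χ.1.snd‖ * ‖ψ.1.snd‖ :=
        (abs_real_inner_le_norm _ _).trans (mul_le_mul_of_nonneg_right hK (norm_nonneg _))
    _ ≤ (normK Ω k).toReal * ‖χ‖ * ‖ψ‖ := by
        gcongr
        exacts [WithLp.norm_snd_le _ χ.1, WithLp.norm_snd_le _ ψ.1]

lemma le_transC_self {k₀ : ℝ} (hk₀ : ∀ᵐ x ∂Ω.vol, ∀ i, k₀ ≤ k i x) (ψ : H1 Ω 2) :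
    k₀ * ‖ψ.1.snd‖ ^ 2 ≤ transC k ψ ψ := by
  rw [transC_apply]
  refine le_inner_mulOp (memLp_top_sum_smul hk _) (hk₀.mono fun ξ hξ τ => ?_) ψ.1.snd
  exact (le_inner_diagMul hξ τ).trans_eq (by rw [sum_smul_rowL])

end Diffusion

/-- The map `φ ↦ G_{w,φ}` as a bounded bilinear form. -/
def transG (hc : c1 Ω ≠ ⊤) (hn : 2 ≤ n) (w : H10 Ω n) : H1 Ω 2 →L[ℝ] H1 Ω 2 →L[ℝ] ℝ :=
  -pairL (gradL Ω) (dyadOp hc hn w)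

section Convection

variable (hc : c1 Ω ≠ ⊤) (hn : 2 ≤ n)

lemma transG_apply (w : H10 Ω n) (φ ψ : H1 Ω 2) :
    transG hc hn w φ ψ = -inner ℝ φ.1.snd (dyadOp hc hn w ψ) := rfl

attribute [irreducible] transG

lemma formG_eq_transG (w : H10 Ω n) (φ ψ : H1 Ω 2) : formG Ω w φ ψ = transG hc hn w φ ψ := by
  rw [transG_apply, ← integral_inner_eq _ _ EventuallyEq.rfl (coeFn_dyadOp hc hn w ψ), formG]
  simp only [inner_tmul]

lemma abs_transG_le (w : H10 Ω n) (φ ψ : H1 Ω 2) :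
    |transG hc hn w φ ψ| ≤ (c1 Ω).toReal * ‖w‖ * ‖φ‖ * ‖ψ‖ := by
  rw [transG_apply, abs_neg]
  calc |inner ℝ φ.1.snd (dyadOp hc hn w ψ)| ≤ ‖φ‖ * ((c1 Ω).toReal * ‖w‖ * ‖ψ‖) :=
        (abs_real_inner_le_norm _ _).trans <| mul_le_mul (WithLp.norm_snd_le _ φ.1)
          (norm_dyadOp_le hc hn w ψ) (norm_nonneg _) (norm_nonneg _)
    _ = (c1 Ω).toReal * ‖w‖ * ‖φ‖ * ‖ψ‖ := by ring

lemma transG_sub_left (w w' : H10 Ω n) (φ ψ : H1 Ω 2) :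
    transG hc hn (w - w') φ ψ = transG hc hn w φ ψ - transG hc hn w' φ ψ := by
  simp only [transG_apply, map_sub, sub_apply, inner_sub_right]
  ring

end Convection

/-! ### The decoupled flow problem -/

/-- The form `A_φ + B_w`, where the operator `M` is the multiplication by `ν(φ)`. -/
def flowAB (M : L2 Ω (T n n) →L[ℝ] L2 Ω (T n n)) (hc : c1 Ω ≠ ⊤) (γ κ₁ κ₂ κ₃ : ℝ) (w : H10 Ω n) :
    HH Ω →L[ℝ] HH Ω →L[ℝ] ℝ :=
  flowA M γ κ₁ κ₂ κ₃ + flowB hc κ₃ w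

lemma flowAB_apply (M : L2 Ω (T n n) →L[ℝ] L2 Ω (T n n)) (hc : c1 Ω ≠ ⊤) (γ κ₁ κ₂ κ₃ : ℝ)
    (w : H10 Ω n) (x y : HH Ω) :
    flowAB M hc γ κ₁ κ₂ κ₃ w x y = flowA M γ κ₁ κ₂ κ₃ x y + flowB hc κ₃ w x y := rfl

lemma flowAB_sub_left (M : L2 Ω (T n n) →L[ℝ] L2 Ω (T n n)) (hc : c1 Ω ≠ ⊤) (γ κ₁ κ₂ κ₃ : ℝ)
    (w : H10 Ω n) (x x' y : HH Ω) :
    flowAB M hc γ κ₁ κ₂ κ₃ w (x - x') y =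
      flowAB M hc γ κ₁ κ₂ κ₃ w x y - flowAB M hc γ κ₁ κ₂ κ₃ w x' y :=
  ContinuousLinearMap.map_sub₂ _ _ _ _

attribute [irreducible] flowAB

lemma flowAB_coercive {M : L2 Ω (T n n) →L[ℝ] L2 Ω (T n n)} (hc : c1 Ω ≠ ⊤) {γ κ₁ κ₂ κ₃ a : ℝ}
    (hA : ∀ x, a * ‖x‖ ^ 2 ≤ flowA M γ κ₁ κ₂ κ₃ x x) {w : H10 Ω n}
    (hw : (c1 Ω).toReal * ‖w‖ * √(2 + κ₃ ^ 2) ≤ a / 2) (x : HH Ω) :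
    a / 2 * ‖x‖ ^ 2 ≤ flowAB M hc γ κ₁ κ₂ κ₃ w x x := by
  have hB : |flowB hc κ₃ w x x| ≤ a / 2 * ‖x‖ ^ 2 :=
    calc |flowB hc κ₃ w x x|
        ≤ (c1 Ω).toReal * ‖w‖ * ‖x.vel‖ * (√(2 + κ₃ ^ 2) * ‖x‖) := abs_flowB_le hc κ₃ w x x
      _ ≤ (c1 Ω).toReal * ‖w‖ * ‖x‖ * (√(2 + κ₃ ^ 2) * ‖x‖) := by
          gcongr
          exact x.norm_vel_le
      _ = (c1 Ω).toReal * ‖w‖ * √(2 + κ₃ ^ 2) * ‖x‖ ^ 2 := by ring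
      _ ≤ a / 2 * ‖x‖ ^ 2 := by gcongr
  rw [flowAB_apply]
  linarith [hA x, neg_le_of_abs_le hB]

lemma CA_nonneg {a κ₂ : ℝ} (ha : 0 ≤ a) : 0 ≤ CA a κ₂ := by
  unfold CA
  positivity

section Flow

variable {ν : E 2 → ℝ} {ν₂ γ κ₁ κ₂ κ₃ a : ℝ} {α : E 2} {g : E n} {w w' : H10 Ω n}
  {φ φ' : H1 Ω 2} {x x' : HH Ω}

lemma solvesFlow_iff (hν : Continuous ν) (hν₂ : ∀ a, |ν a| ≤ ν₂) (hc : c1 Ω ≠ ⊤) :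
    SolvesFlow Ω ν γ κ₁ κ₂ κ₃ α g w φ x ↔
      ∀ y, flowAB (viscOp ν φ) hc γ κ₁ κ₂ κ₃ w x y = flowF κ₂ α g φ y := by
  refine forall_congr' fun y => Iff.of_eq (congrArg₂ (· = ·) ?_ (formF_eq_flowF κ₂ α g φ y))
  exact (congrArg₂ (· + ·) (formA_eq_flowA hν hν₂ γ κ₁ κ₂ κ₃ φ x y)
    (formB_eq_flowB hc κ₃ w x y)).trans (flowAB_apply (viscOp ν φ) hc γ κ₁ κ₂ κ₃ w x y).symm

lemma exists_solvesFlow (hν : Continuous ν) (hν₂ : ∀ a, |ν a| ≤ ν₂) {hc : c1 Ω ≠ ⊤} (ha : 0 < a)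
    (hAB : ∀ x, a / 2 * ‖x‖ ^ 2 ≤ flowAB (viscOp ν φ) hc γ κ₁ κ₂ κ₃ w x x) :
    ∃ x, SolvesFlow Ω ν γ κ₁ κ₂ κ₃ α g w φ x :=
  (exists_forall_eq_of_coercive (V := HH Ω) (flowAB (viscOp ν φ) hc γ κ₁ κ₂ κ₃ w)
    (flowF κ₂ α g φ) (half_pos ha) hAB).imp fun _ => (solvesFlow_iff hν hν₂ hc).2

lemma norm_le_of_solvesFlow (hν : Continuous ν) (hν₂ : ∀ a, |ν a| ≤ ν₂) {hc : c1 Ω ≠ ⊤}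
    (ha : 0 < a) (hAB : ∀ x, a / 2 * ‖x‖ ^ 2 ≤ flowAB (viscOp ν φ) hc γ κ₁ κ₂ κ₃ w x x)
    (hx : SolvesFlow Ω ν γ κ₁ κ₂ κ₃ α g w φ x) :
    ‖x‖ ≤ CA a κ₂ * (‖α‖ * ‖g‖ * ‖φ.1.fst‖) := by
  have hF : flowF κ₂ α g φ x ≤ ‖α‖ * ‖g‖ * ‖φ.1.fst‖ * √(2 + κ₂ ^ 2) * ‖x‖ :=
    (le_of_abs_le (abs_flowF_le κ₂ α g φ x)).trans_eq (mul_assoc _ _ _).symm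
  have hbound := mul_le_of_mul_sq_le (by positivity) (norm_nonneg x)
    (((hAB x).trans_eq ((solvesFlow_iff hν hν₂ hc).1 hx x)).trans hF)
  have hsqrt : (1 : ℝ) ≤ √2 := Real.one_le_sqrt.2 one_le_two
  calc ‖x‖ = 2 / a * (a / 2 * ‖x‖) := by field_simp
    _ ≤ 2 / a * (√2 * (‖α‖ * ‖g‖ * ‖φ.1.fst‖ * √(2 + κ₂ ^ 2))) := by
        refine mul_le_mul_of_nonneg_left (hbound.trans ?_) (by positivity)
        exact le_mul_of_one_le_left (by positivity) hsqrt
    _ = CA a κ₂ * (‖α‖ * ‖g‖ * ‖φ.1.fst‖) := by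
        rw [CA]
        ring

lemma flowAB_sub_apply_of_solvesFlow (hν : Continuous ν) (hν₂ : ∀ a, |ν a| ≤ ν₂) (hc : c1 Ω ≠ ⊤)
    (hx : SolvesFlow Ω ν γ κ₁ κ₂ κ₃ α g w φ x) (hx' : SolvesFlow Ω ν γ κ₁ κ₂ κ₃ α g w' φ' x')
    (y : HH Ω) :
    flowAB (viscOp ν φ) hc γ κ₁ κ₂ κ₃ w (x - x') y =
      flowF κ₂ α g (φ - φ') y
      - 2 * inner ℝ (viscOp ν φ x'.t - viscOp ν φ' x'.t) (y.t - κ₃ • devLp Ω y.σ)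
      - flowB hc κ₃ (w - w') x' y := by
  have hy := (solvesFlow_iff hν hν₂ hc).1 hx y
  have hy' := (solvesFlow_iff hν hν₂ hc).1 hx' y
  have hsub := flowAB_sub_left (viscOp ν φ) hc γ κ₁ κ₂ κ₃ w x x' y
  have hsplit := flowAB_apply (viscOp ν φ) hc γ κ₁ κ₂ κ₃ w x' y
  have hsplit' := flowAB_apply (viscOp ν φ') hc γ κ₁ κ₂ κ₃ w' x' y
  have hF := flowF_sub κ₂ α g φ φ' y
  have hA := flowA_sub_flowA (viscOp ν φ) (viscOp ν φ') γ κ₁ κ₂ κ₃ x' y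
  have hB := flowB_sub hc κ₃ w w' x' y
  linarith

lemma norm_sub_le_of_solvesFlow (hν : Continuous ν) (hν₂ : ∀ a, |ν a| ≤ ν₂) {hc : c1 Ω ≠ ⊤}
    (hAB : ∀ x, a / 2 * ‖x‖ ^ 2 ≤ flowAB (viscOp ν φ) hc γ κ₁ κ₂ κ₃ w x x)
    (hx : SolvesFlow Ω ν γ κ₁ κ₂ κ₃ α g w φ x) (hx' : SolvesFlow Ω ν γ κ₁ κ₂ κ₃ α g w' φ' x') :
    a / 2 * ‖x - x'‖ ≤ ‖α‖ * ‖g‖ * ‖φ - φ'‖ * √(2 + κ₂ ^ 2)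
      + 2 * (‖viscOp ν φ x'.t - viscOp ν φ' x'.t‖ * √(2 + κ₃ ^ 2))
      + (c1 Ω).toReal * ‖w - w'‖ * ‖x'.vel‖ * √(2 + κ₃ ^ 2) := by
  have hF (y : HH Ω) : flowF κ₂ α g (φ - φ') y ≤
      ‖α‖ * ‖g‖ * ‖φ - φ'‖ * (√(2 + κ₂ ^ 2) * ‖y‖) := by
    refine (le_of_abs_le (abs_flowF_le κ₂ α g (φ - φ') y)).trans ?_
    gcongr
    exact WithLp.norm_fst_le _ (φ - φ').1
  have hM (y : HH Ω) :
      -inner ℝ (viscOp ν φ x'.t - viscOp ν φ' x'.t) (y.t - κ₃ • devLp Ω y.σ) ≤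
        ‖viscOp ν φ x'.t - viscOp ν φ' x'.t‖ * (√(2 + κ₃ ^ 2) * ‖y‖) :=
    (neg_le_abs _).trans <| (abs_real_inner_le_norm _ _).trans <|
      mul_le_mul_of_nonneg_left (HH.norm_t_sub_smul_devLp_le κ₃ y) (norm_nonneg _)
  have hB (y : HH Ω) : -flowB hc κ₃ (w - w') x' y ≤
      (c1 Ω).toReal * ‖w - w'‖ * ‖x'.vel‖ * (√(2 + κ₃ ^ 2) * ‖y‖) :=
    (neg_le_abs _).trans (abs_flowB_le hc κ₃ (w - w') x' y)
  refine mul_le_of_mul_sq_le (by positivity) (norm_nonneg _) <|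
    ((hAB _).trans_eq (flowAB_sub_apply_of_solvesFlow hν hν₂ hc hx hx' _)).trans ?_
  linarith only [hF (x - x'), hM (x - x'), hB (x - x')]

end Flow

lemma holderTriple_div_two {d ε : ℝ} (hε : 0 < ε) (hd : 2 * ε < d) :
    ENNReal.HolderTriple (ENNReal.ofReal (d / ε)) (ENNReal.ofReal (2 * d / (d - 2 * ε))) 2 where
  inv_add_inv_eq_inv := by
    have hd₀ : 0 < d := by linarith
    have : 0 < d - 2 * ε := sub_pos.2 hd
    rw [← ENNReal.ofReal_inv_of_pos (by positivity), ← ENNReal.ofReal_inv_of_pos (by positivity),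
      ← ENNReal.ofReal_add (by positivity) (by positivity), ← ENNReal.ofReal_ofNat 2,
      ← ENNReal.ofReal_inv_of_pos two_pos]
    congr 1
    field_simp
    ring

lemma enorm_le_of_half_mul_norm_le {V : Type*} [NormedAddCommGroup V] {z : V} {a p q s : ℝ}
    (ha : 0 < a) (h : a / 2 * ‖z‖ ≤ p + q + s) :
    ‖z‖ₑ ≤ ENNReal.ofReal (2 / a) * (ENNReal.ofReal p + ENNReal.ofReal q + ENNReal.ofReal s) :=
  calc ‖z‖ₑ = ENNReal.ofReal (2 / a * (a / 2 * ‖z‖)) := by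
        rw [← ofReal_norm]
        field_simp
    _ = ENNReal.ofReal (2 / a) * ENNReal.ofReal (a / 2 * ‖z‖) :=
        ENNReal.ofReal_mul (by positivity)
    _ ≤ ENNReal.ofReal (2 / a) * (ENNReal.ofReal p + ENNReal.ofReal q + ENNReal.ofReal s) := by
        gcongr
        exact (ENNReal.ofReal_le_ofReal h).trans <|
          ENNReal.ofReal_add_le.trans (add_le_add_left ENNReal.ofReal_add_le _)

lemma mul_add_mul_add_mul_le_max_mul (p q s x y z : ℝ≥0∞) :
    s * x + q * y + p * z ≤ max p (max q s) * (x + y + z) := by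
  rw [mul_add, mul_add]
  gcongr
  exacts [(le_max_right q s).trans (le_max_right p _), (le_max_left q s).trans (le_max_right p _),
    le_max_left p _]

section FlowLipschitz

variable {ν : E 2 → ℝ} {Lν ν₂ ε : ℝ}

lemma enorm_viscOp_sub_le_fracNorm (hν : LipschitzWith Lν.toNNReal ν) (hν₂ : ∀ a, |ν a| ≤ ν₂)
    (hε : 0 < ε) (hεn : 2 * ε < n) (φ φ' : H1 Ω 2) {t : L2 Ω (T n n)} (ht : fracNorm ε t ≠ ⊤) :
    ‖viscOp ν φ t - viscOp ν φ' t‖ₑ ≤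
      ENNReal.ofReal Lν * (Ceps' Ω ε * ‖φ - φ'‖ₑ) * (Ceps Ω ε * fracNorm ε t) := by
  have := holderTriple_div_two hε hεn
  refine (enorm_viscOp_sub_le hν hν₂ φ φ' t (p := ENNReal.ofReal (n / ε))
    (q := ENNReal.ofReal (2 * n / (n - 2 * ε)))).trans ?_
  exact mul_le_mul' (mul_le_mul' le_rfl (eLpNorm_le_sobolevConst _ _))
    (eLpNorm_le_Ceps_mul_fracNorm ht)

variable {γ κ₁ κ₂ κ₃ a r Chat : ℝ} {α : E 2} {g : E n} {w w' : H10 Ω n} {φ φ' : H1 Ω 2}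
  {x x' : HH Ω}

lemma ofReal_mul_viscOp_sub_le (hν : LipschitzWith Lν.toNNReal ν) (hν₂ : ∀ a, |ν a| ≤ ν₂)
    (hε : 0 < ε) (hεn : 2 * ε < n) (hLν : 0 ≤ Lν) {d s : ℝ} (hd : 0 ≤ d)
    (hChat : 0 ≤ Chat) {t : L2 Ω (T n n)} (ht : fracNorm ε t ≤ ENNReal.ofReal (Chat * d * r)) :
    ENNReal.ofReal (2 * (‖viscOp ν φ t - viscOp ν φ' t‖ * s)) ≤
      ENNReal.ofReal (2 * Lν * s) * Ceps Ω ε *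
        (ENNReal.ofReal d * (ENNReal.ofReal r * Ceps' Ω ε * ENNReal.ofReal Chat * ‖φ - φ'‖ₑ)) := by
  have hvisc : ‖viscOp ν φ t - viscOp ν φ' t‖ₑ ≤ ENNReal.ofReal Lν * (Ceps' Ω ε * ‖φ - φ'‖ₑ) *
      (Ceps Ω ε * ENNReal.ofReal (Chat * d * r)) := by
    refine (enorm_viscOp_sub_le_fracNorm hν hν₂ hε hεn φ φ' ?_).trans (by gcongr)
    exact (ht.trans_lt ENNReal.ofReal_lt_top).ne
  rw [ENNReal.ofReal_mul zero_le_two, ENNReal.ofReal_mul (norm_nonneg _), ofReal_norm]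
  refine (mul_le_mul_right (mul_le_mul_left hvisc _) _).trans_eq ?_
  rw [ENNReal.ofReal_mul (by positivity), ENNReal.ofReal_mul (by positivity),
    ENNReal.ofReal_mul (by positivity), ENNReal.ofReal_mul zero_le_two]
  ring

lemma edist_le_of_solvesFlow (hLip : LipschitzWith Lν.toNNReal ν) (hν₂ : ∀ a, |ν a| ≤ ν₂)
    {hc : c1 Ω ≠ ⊤} (hε : 0 < ε) (hεn : 2 * ε < n) (ha : 0 < a) (hr : 0 ≤ r) (hLν : 0 ≤ Lν)
    (hChat : 0 ≤ Chat) (hAB : ∀ x, a / 2 * ‖x‖ ^ 2 ≤ flowAB (viscOp ν φ) hc γ κ₁ κ₂ κ₃ w x x)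
    (hx : SolvesFlow Ω ν γ κ₁ κ₂ κ₃ α g w φ x) (hx' : SolvesFlow Ω ν γ κ₁ κ₂ κ₃ α g w' φ' x')
    (hreg : fracNorm ε x'.t ≤ ENNReal.ofReal (Chat * (‖α‖ * ‖g‖) * r))
    (hbd : ‖x'.vel‖ ≤ r * CA a κ₂ * (‖α‖ * ‖g‖)) :
    edist x x' ≤
      LA Ω a Lν κ₂ κ₃ ε * ENNReal.ofReal (‖α‖ * ‖g‖) * ENNReal.ofReal (r * CA a κ₂) * edist w w'
      + LA Ω a Lν κ₂ κ₃ ε * ENNReal.ofReal (‖α‖ * ‖g‖)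
        * (ENNReal.ofReal r * Ceps' Ω ε * ENNReal.ofReal Chat + 1) * edist φ φ' := by
  have hF : ENNReal.ofReal (‖α‖ * ‖g‖ * ‖φ - φ'‖ * √(2 + κ₂ ^ 2)) ≤
      ENNReal.ofReal (√2 * √(2 + κ₂ ^ 2)) * (ENNReal.ofReal (‖α‖ * ‖g‖) * ‖φ - φ'‖ₑ) := by
    rw [ENNReal.ofReal_mul (by positivity), ENNReal.ofReal_mul (by positivity), ofReal_norm,
      mul_comm]
    gcongr
    exact le_mul_of_one_le_left (by positivity) (Real.one_le_sqrt.2 one_le_two)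
  have hT := ofReal_mul_viscOp_sub_le (φ := φ) (φ' := φ') (s := √(2 + κ₃ ^ 2)) hLip hν₂ hε hεn hLν
    (by positivity) hChat hreg
  have hB : ENNReal.ofReal ((c1 Ω).toReal * ‖w - w'‖ * ‖x'.vel‖ * √(2 + κ₃ ^ 2)) ≤
      c1 Ω * ENNReal.ofReal √(2 + κ₃ ^ 2) *
        (ENNReal.ofReal (‖α‖ * ‖g‖) * (ENNReal.ofReal (r * CA a κ₂) * ‖w - w'‖ₑ)) := by
    have hCA : 0 ≤ r * CA a κ₂ := mul_nonneg hr (CA_nonneg ha.le)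
    calc _ ≤ ENNReal.ofReal
          ((c1 Ω).toReal * ‖w - w'‖ * (r * CA a κ₂ * (‖α‖ * ‖g‖)) * √(2 + κ₃ ^ 2)) := by gcongr
      _ = _ := by
        rw [ENNReal.ofReal_mul (by positivity), ENNReal.ofReal_mul (by positivity),
          ENNReal.ofReal_mul (by positivity), ENNReal.ofReal_mul hCA, ENNReal.ofReal_toReal hc,
          ofReal_norm]
        ring
  rw [edist_eq_enorm_sub, edist_eq_enorm_sub, edist_eq_enorm_sub, LA]
  refine (enorm_le_of_half_mul_norm_le ha
    (norm_sub_le_of_solvesFlow hLip.continuous hν₂ hAB hx hx')).trans <|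
    (mul_le_mul_right ((add_le_add (add_le_add hF hT) hB).trans
      (mul_add_mul_add_mul_le_max_mul _ _ _ _ _ _)) _).trans_eq ?_
  ring

end FlowLipschitz

/-! ### The decoupled transport problem -/

/-- `χ` solves the transport problem with Dirichlet datum `φD` whose convective term is frozen at
`(w, φ)`; the relation is the operator `ℬ` of the fixed-point argument. -/
def SolvesTransport (Ω : PolyhedralDomain n) {ΓD : Set (E n)} (k : Fin 2 → E n → ℝ)
    (φD : Lp (E 2) 2 (surf ΓD)) (w : H10 Ω n) (φ χ : H1 Ω 2) : Prop :=
  HasTrace χ φD ∧ ∀ ψ ∈ H1D Ω ΓD, formC Ω k χ ψ = formG Ω w φ ψ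

lemma isSolution_iff {ΓD : Set (E n)} {ν : E 2 → ℝ} {γ κ₁ κ₂ κ₃ : ℝ} {α : E 2} {g : E n}
    {k : Fin 2 → E n → ℝ} {φD : Lp (E 2) 2 (surf ΓD)} {x : HH Ω} {φ : H1 Ω 2} :
    IsSolution Ω ν γ κ₁ κ₂ κ₃ α g k φD x φ ↔
      SolvesFlow Ω ν γ κ₁ κ₂ κ₃ α g x.vel φ x ∧ SolvesTransport Ω k φD x.vel φ φ :=
  and_left_comm

lemma le_halfNorm {ΓD : Set (E n)} {φD : Lp (E 2) 2 (surf ΓD)} (hφD : φD ∈ HHalf Ω ΓD) {b : ℝ}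
    (hb : ∀ φ : H1 Ω 2, HasTrace φ φD → b ≤ ‖φ‖) : b ≤ halfNorm Ω φD := by
  obtain ⟨φ, hφ⟩ := hφD
  refine le_csInf ⟨‖φ‖, φ, hφ, rfl⟩ ?_
  rintro _ ⟨ψ, hψ, rfl⟩
  exact hb ψ hψ

section Transport

variable {ΓD : Set (E n)} {k : Fin 2 → E n → ℝ} {k₀ : ℝ}

lemma norm_sq_le_transC (hk : ∀ i, MemLp (k i) ⊤ Ω.vol) (hk₀ : 0 < k₀)
    (hk₀k : ∀ᵐ x ∂Ω.vol, ∀ i, k₀ ≤ k i x) (hell : ellC Ω ΓD k₀ ≠ 0) {ψ : H1 Ω 2}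
    (hψ : ψ ∈ H1D Ω ΓD) : ‖ψ‖ ^ 2 ≤ (ellC Ω ΓD k₀)⁻¹.toReal * transC k ψ ψ := by
  have hcgp : cgp Ω ΓD ≠ ⊤ := fun h => hell (by simp [ellC, h])
  have hpoincare : ‖ψ‖ ≤ (cgp Ω ΓD).toReal * ‖ψ.1.snd‖ := by
    simpa only [ENNReal.toReal_mul, toReal_enorm] using
      ENNReal.toReal_mono (ENNReal.mul_ne_top hcgp enorm_ne_top) (enorm_le_cgp_mul hψ hcgp)
  have hinv : (ellC Ω ΓD k₀)⁻¹.toReal = (cgp Ω ΓD).toReal ^ 2 / k₀ := by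
    rw [ellC, ENNReal.toReal_inv, ENNReal.toReal_div, ENNReal.toReal_ofReal hk₀.le,
      ENNReal.toReal_pow, inv_div]
  calc ‖ψ‖ ^ 2 ≤ ((cgp Ω ΓD).toReal * ‖ψ.1.snd‖) ^ 2 := by gcongr
    _ = (cgp Ω ΓD).toReal ^ 2 / k₀ * (k₀ * ‖ψ.1.snd‖ ^ 2) := by field_simp
    _ ≤ (ellC Ω ΓD k₀)⁻¹.toReal * transC k ψ ψ := by
        rw [hinv]
        gcongr
        exact le_transC_self hk hk₀k ψ

variable {φD : Lp (E 2) 2 (surf ΓD)} {w w' : H10 Ω n} {φ φ' χ χ' : H1 Ω 2}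

lemma SolvesTransport.transC_eq (hχ : SolvesTransport Ω k φD w φ χ)
    (hk : ∀ i, MemLp (k i) ⊤ Ω.vol) (hc : c1 Ω ≠ ⊤) (hn : 2 ≤ n) {ψ : H1 Ω 2}
    (hψ : ψ ∈ H1D Ω ΓD) : transC k χ ψ = transG hc hn w φ ψ := by
  rw [← formC_eq_transC hk, ← formG_eq_transG, hχ.2 ψ hψ]

lemma exists_solvesTransport (hk : ∀ i, MemLp (k i) ⊤ Ω.vol) (hk₀ : 0 < k₀)
    (hk₀k : ∀ᵐ x ∂Ω.vol, ∀ i, k₀ ≤ k i x) (hell : ellC Ω ΓD k₀ ≠ 0) (hc : c1 Ω ≠ ⊤) (hn : 2 ≤ n)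
    (hφD : φD ∈ HHalf Ω ΓD) : ∃ χ, SolvesTransport Ω k φD w φ χ := by
  obtain ⟨φe, hφe⟩ := hφD
  have hcoercive : ∀ v ∈ H1Dsub Ω ΓD,
      ((ellC Ω ΓD k₀)⁻¹.toReal + 1)⁻¹ * ‖v‖ ^ 2 ≤ transC k v v := fun v hv => by
    have hpos : 0 ≤ transC k v v := (by positivity : 0 ≤ k₀ * ‖v.1.snd‖ ^ 2).trans
      (le_transC_self hk hk₀k v)
    rw [inv_mul_le_iff₀ (by positivity), add_one_mul]
    exact (norm_sq_le_transC hk hk₀ hk₀k hell (mem_H1Dsub.1 hv)).trans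
      (le_add_of_nonneg_right hpos)
  obtain ⟨v, hv, hsolves⟩ := exists_mem_forall_eq_of_coercive (transC k)
    (transG hc hn w φ - transC k φe) isClosed_H1Dsub (by positivity) hcoercive
  refine ⟨v + φe, by simpa only [zero_add] using HasTrace.add (mem_H1Dsub.1 hv) hφe, fun ψ hψ => ?_⟩
  rw [formC_eq_transC hk, formG_eq_transG hc hn, ContinuousLinearMap.map_add₂,
    hsolves ψ (mem_H1Dsub.2 hψ), sub_apply, sub_add_cancel]

lemma norm_le_of_transC_le (hk : ∀ i, MemLp (k i) ⊤ Ω.vol) (hk₀ : 0 < k₀)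
    (hk₀k : ∀ᵐ x ∂Ω.vol, ∀ i, k₀ ≤ k i x) (hell : ellC Ω ΓD k₀ ≠ 0) {ψ : H1 Ω 2}
    (hψ : ψ ∈ H1D Ω ΓD) {N : ℝ} (hN : 0 ≤ N) (h : transC k ψ ψ ≤ N * ‖ψ‖) :
    ‖ψ‖ ≤ (ellC Ω ΓD k₀)⁻¹.toReal * N := by
  refine (one_mul ‖ψ‖).symm.trans_le (mul_le_of_mul_sq_le (by positivity) (norm_nonneg ψ) ?_)
  rw [one_mul, mul_assoc]
  exact (norm_sq_le_transC hk hk₀ hk₀k hell hψ).trans (by gcongr)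

lemma norm_le_of_solvesTransport_of_hasTrace (hk : ∀ i, MemLp (k i) ⊤ Ω.vol) (hk₀ : 0 < k₀)
    (hk₀k : ∀ᵐ x ∂Ω.vol, ∀ i, k₀ ≤ k i x) (hell : ellC Ω ΓD k₀ ≠ 0) (hc : c1 Ω ≠ ⊤) (hn : 2 ≤ n)
    (hχ : SolvesTransport Ω k φD w φ χ) {φe : H1 Ω 2} (hφe : HasTrace φe φD) :
    ‖χ‖ ≤ (ellC Ω ΓD k₀)⁻¹.toReal * (c1 Ω).toReal * (‖w‖ * ‖φ‖)
      + ((ellC Ω ΓD k₀)⁻¹.toReal * (normK Ω k).toReal + 1) * ‖φe‖ := by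
  have hmem : χ - φe ∈ H1D Ω ΓD := hχ.1.sub_mem_H1D hφe
  have hsub : transC k (χ - φe) (χ - φe) ≤
      ((c1 Ω).toReal * ‖w‖ * ‖φ‖ + (normK Ω k).toReal * ‖φe‖) * ‖χ - φe‖ := by
    rw [ContinuousLinearMap.map_sub₂, hχ.transC_eq hk hc hn hmem, add_mul, sub_eq_add_neg]
    exact add_le_add (le_of_abs_le (abs_transG_le hc hn w φ _))
      ((neg_le_abs _).trans (abs_transC_le hk φe _))
  have hbound := norm_le_of_transC_le hk hk₀ hk₀k hell hmem (by positivity) hsub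
  linarith [norm_le_norm_sub_add χ φe]

lemma CB_eq_ofReal (hk : ∀ i, MemLp (k i) ⊤ Ω.vol) (hell : ellC Ω ΓD k₀ ≠ 0) (hc : c1 Ω ≠ ⊤) :
    CB Ω ΓD k k₀ = ENNReal.ofReal (max ((ellC Ω ΓD k₀)⁻¹.toReal * (c1 Ω).toReal)
      ((ellC Ω ΓD k₀)⁻¹.toReal * (normK Ω k).toReal + 1)) := by
  have hinv : (ellC Ω ΓD k₀)⁻¹ ≠ ⊤ := ENNReal.inv_ne_top.2 hell
  rw [CB, ENNReal.ofReal_max, ENNReal.ofReal_add (by positivity) zero_le_one, ENNReal.ofReal_one,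
    ← ENNReal.toReal_mul, ← ENNReal.toReal_mul, ENNReal.ofReal_toReal (ENNReal.mul_ne_top hinv hc),
    ENNReal.ofReal_toReal (ENNReal.mul_ne_top hinv (normK_ne_top hk))]

lemma ofReal_norm_le_of_solvesTransport (hk : ∀ i, MemLp (k i) ⊤ Ω.vol) (hk₀ : 0 < k₀)
    (hk₀k : ∀ᵐ x ∂Ω.vol, ∀ i, k₀ ≤ k i x) (hell : ellC Ω ΓD k₀ ≠ 0) (hc : c1 Ω ≠ ⊤) (hn : 2 ≤ n)
    (hφD : φD ∈ HHalf Ω ΓD) (hχ : SolvesTransport Ω k φD w φ χ) :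
    ENNReal.ofReal ‖χ‖ ≤ CB Ω ΓD k k₀ * ENNReal.ofReal (‖w‖ * ‖φ‖ + halfNorm Ω φD) := by
  rw [CB_eq_ofReal hk hell hc]
  set b := max ((ellC Ω ΓD k₀)⁻¹.toReal * (c1 Ω).toReal)
    ((ellC Ω ΓD k₀)⁻¹.toReal * (normK Ω k).toReal + 1)
  have hb : 0 < b := lt_max_of_lt_right (by positivity)
  rw [← ENNReal.ofReal_mul hb.le]
  refine ENNReal.ofReal_le_ofReal ?_
  rw [← div_le_iff₀' hb, ← sub_le_iff_le_add']
  refine le_halfNorm hφD fun φe hφe => ?_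
  rw [sub_le_iff_le_add', div_le_iff₀' hb, mul_add]
  refine (norm_le_of_solvesTransport_of_hasTrace hk hk₀ hk₀k hell hc hn hχ hφe).trans ?_
  gcongr
  exacts [le_max_left _ _, le_max_right _ _]

lemma SolvesTransport.transC_sub_eq (hχ : SolvesTransport Ω k φD w φ χ)
    (hχ' : SolvesTransport Ω k φD w' φ' χ') (hk : ∀ i, MemLp (k i) ⊤ Ω.vol) (hc : c1 Ω ≠ ⊤)
    (hn : 2 ≤ n) {ψ : H1 Ω 2} (hψ : ψ ∈ H1D Ω ΓD) :
    transC k (χ - χ') ψ = transG hc hn (w - w') φ ψ + transG hc hn w' (φ - φ') ψ := by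
  have hG : transG hc hn (w - w') φ ψ + transG hc hn w' (φ - φ') ψ =
      transG hc hn w φ ψ - transG hc hn w' φ' ψ := by
    have hlinear := ContinuousLinearMap.map_sub₂ (transG hc hn w') φ φ' ψ
    have hsub := transG_sub_left hc hn w w' φ ψ
    exact (congrArg₂ (· + ·) hsub hlinear).trans (sub_add_sub_cancel _ _ _)
  have hC := ContinuousLinearMap.map_sub₂ (transC k) χ χ' ψ
  exact hC.trans <| (congrArg₂ (· - ·) (hχ.transC_eq hk hc hn hψ)
    (hχ'.transC_eq hk hc hn hψ)).trans hG.symm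

lemma SolvesTransport.transC_sub_le (hχ : SolvesTransport Ω k φD w φ χ)
    (hχ' : SolvesTransport Ω k φD w' φ' χ') (hk : ∀ i, MemLp (k i) ⊤ Ω.vol) (hc : c1 Ω ≠ ⊤)
    (hn : 2 ≤ n) {r : ℝ} (hφ : ‖φ‖ ≤ r) (hw' : ‖w'‖ ≤ r) {ψ : H1 Ω 2} (hψ : ψ ∈ H1D Ω ΓD) :
    transC k (χ - χ') ψ ≤ r * (c1 Ω).toReal * (‖w - w'‖ + ‖φ - φ'‖) * ‖ψ‖ :=
  calc transC k (χ - χ') ψ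
      = transG hc hn (w - w') φ ψ + transG hc hn w' (φ - φ') ψ :=
        hχ.transC_sub_eq hχ' hk hc hn hψ
    _ ≤ (c1 Ω).toReal * ‖w - w'‖ * ‖φ‖ * ‖ψ‖ + (c1 Ω).toReal * ‖w'‖ * ‖φ - φ'‖ * ‖ψ‖ :=
        add_le_add (le_of_abs_le (abs_transG_le _ _ _ _ _))
          (le_of_abs_le (abs_transG_le _ _ _ _ _))
    _ ≤ (c1 Ω).toReal * ‖w - w'‖ * r * ‖ψ‖ + (c1 Ω).toReal * r * ‖φ - φ'‖ * ‖ψ‖ := by gcongr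
    _ = r * (c1 Ω).toReal * (‖w - w'‖ + ‖φ - φ'‖) * ‖ψ‖ := by ring

lemma LB_eq_ofReal (hell : ellC Ω ΓD k₀ ≠ 0) (hc : c1 Ω ≠ ⊤) {r : ℝ} (hr : 0 ≤ r) :
    LB Ω ΓD k₀ r = ENNReal.ofReal ((ellC Ω ΓD k₀)⁻¹.toReal * (r * (c1 Ω).toReal)) := by
  rw [LB, ENNReal.ofReal_mul (by positivity), ENNReal.ofReal_mul hr, ENNReal.ofReal_toReal hc,
    ENNReal.ofReal_toReal (ENNReal.inv_ne_top.2 hell), ENNReal.div_eq_inv_mul]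

lemma edist_le_of_solvesTransport (hk : ∀ i, MemLp (k i) ⊤ Ω.vol) (hk₀ : 0 < k₀)
    (hk₀k : ∀ᵐ x ∂Ω.vol, ∀ i, k₀ ≤ k i x) (hell : ellC Ω ΓD k₀ ≠ 0) (hc : c1 Ω ≠ ⊤) (hn : 2 ≤ n)
    (hχ : SolvesTransport Ω k φD w φ χ) (hχ' : SolvesTransport Ω k φD w' φ' χ') {r : ℝ}
    (hφ : ‖φ‖ ≤ r) (hw' : ‖w'‖ ≤ r) :
    edist χ χ' ≤ LB Ω ΓD k₀ r * (edist w w' + edist φ φ') := by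
  have hr : 0 ≤ r := (norm_nonneg _).trans hφ
  have hmem : χ - χ' ∈ H1D Ω ΓD := hχ.1.sub_mem_H1D hχ'.1
  have hbound := norm_le_of_transC_le hk hk₀ hk₀k hell hmem (by positivity)
    (hχ.transC_sub_le hχ' hk hc hn hφ hw' hmem)
  rw [edist_dist, edist_dist, edist_dist, dist_eq_norm, dist_eq_norm, dist_eq_norm,
    LB_eq_ofReal hell hc hr, ← ENNReal.ofReal_add (norm_nonneg _) (norm_nonneg _),
    ← ENNReal.ofReal_mul (by positivity)]
  exact ENNReal.ofReal_le_ofReal (hbound.trans_eq (mul_assoc _ _ _).symm)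

end Transport

/-! ### The coupled problem -/

lemma HH.lipschitzWith_vel : LipschitzWith 1 (HH.vel : HH Ω → H10 Ω n) :=
  LipschitzWith.mk_one fun x y => by
    rw [dist_eq_norm, dist_eq_norm]
    exact (x - y).norm_vel_le

/-- The set `W_r` of the paper, on which the fixed-point map `(w, φ) ↦ (u, φ̂)` of the decoupled
problems is a contraction. -/
def ballW (Ω : PolyhedralDomain n) (r : ℝ) : Set (H10 Ω n × H1 Ω 2) := {p | ‖p.1‖ + ‖p.2‖ ≤ r}

section BallW

variable {r : ℝ} {w : H10 Ω n} {φ : H1 Ω 2}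

lemma mem_ballW : (w, φ) ∈ ballW Ω r ↔ ‖w‖ + ‖φ‖ ≤ r := Iff.rfl

lemma isClosed_ballW : IsClosed (ballW Ω r) :=
  isClosed_le (continuous_fst.norm.add continuous_snd.norm) continuous_const

lemma zero_mem_ballW (hr : 0 ≤ r) : 0 ∈ ballW Ω r := by
  simpa only [ballW, Set.mem_ofPred_eq, Prod.fst_zero, Prod.snd_zero, norm_zero, add_zero] using hr

lemma norm_fst_le_of_mem_ballW (hp : (w, φ) ∈ ballW Ω r) : ‖w‖ ≤ r :=
  (le_add_of_nonneg_right (norm_nonneg φ)).trans hp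

lemma norm_snd_le_of_mem_ballW (hp : (w, φ) ∈ ballW Ω r) : ‖φ‖ ≤ r :=
  (le_add_of_nonneg_left (norm_nonneg w)).trans hp

end BallW

section Radius

variable {a κ₃ : ℝ} {s : ℝ≥0∞}

lemma pos_of_lt_r0 (h : s < r0 Ω a κ₃) : 0 < a := by
  by_contra hneg
  rw [r0, ENNReal.ofReal_of_nonpos (not_lt.1 hneg), ENNReal.zero_div] at h
  exact not_lt_zero h

lemma c1_ne_top_of_lt_r0 (h : s < r0 Ω a κ₃) : c1 Ω ≠ ⊤ := by
  intro hc
  have hsqrt : ENNReal.ofReal √(2 + κ₃ ^ 2) ≠ 0 :=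
    (ENNReal.ofReal_pos.2 (by positivity)).ne'
  rw [r0, hc, ENNReal.mul_top two_ne_zero, ENNReal.top_mul hsqrt, ENNReal.div_top] at h
  exact not_lt_zero h

lemma mul_le_half_of_lt_r0 {r : ℝ} (hr : 0 ≤ r) (h : ENNReal.ofReal r < r0 Ω a κ₃) :
    (c1 Ω).toReal * r * √(2 + κ₃ ^ 2) ≤ a / 2 := by
  have hmul := ENNReal.toReal_mono ENNReal.ofReal_ne_top (ENNReal.mul_lt_of_lt_div h).le
  rw [ENNReal.toReal_ofReal (pos_of_lt_r0 h).le] at hmul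
  simp only [ENNReal.toReal_mul, ENNReal.toReal_ofReal hr, ENNReal.toReal_ofNat,
    ENNReal.toReal_ofReal (Real.sqrt_nonneg _)] at hmul
  linarith

end Radius

lemma ellC_ne_zero_of_LB_ne_top [NeZero n] {ΓD : Set (E n)} {k₀ r : ℝ} (hr : 0 < r)
    (h : LB Ω ΓD k₀ r ≠ ⊤) : ellC Ω ΓD k₀ ≠ 0 := by
  intro hzero
  refine h ?_
  rw [LB, hzero, ENNReal.div_zero]
  exact mul_ne_zero (ENNReal.ofReal_pos.2 hr).ne'
    (pow_ne_zero _ (sobolevConst_ne_zero four_ne_zero))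

lemma add_le_of_smallness {C : ℝ≥0∞} {u y r A d h : ℝ} (hr : 0 ≤ r) (hA : 0 ≤ A)
    (hu : u ≤ r * A * d) (hy : ENNReal.ofReal y ≤ C * ENNReal.ofReal (r * u + h))
    (hsmall : ENNReal.ofReal (r * A) * (1 + ENNReal.ofReal r * C) * ENNReal.ofReal d
      + C * ENNReal.ofReal h ≤ ENNReal.ofReal r) : u + y ≤ r := by
  have hu' : ENNReal.ofReal u ≤ ENNReal.ofReal (r * A) * ENNReal.ofReal d := by
    rw [← ENNReal.ofReal_mul (mul_nonneg hr hA)]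
    exact ENNReal.ofReal_le_ofReal hu
  refine (ENNReal.ofReal_le_ofReal_iff hr).1 ?_
  calc ENNReal.ofReal (u + y) ≤ ENNReal.ofReal u + ENNReal.ofReal y := ENNReal.ofReal_add_le
    _ ≤ ENNReal.ofReal u + C * (ENNReal.ofReal r * ENNReal.ofReal u + ENNReal.ofReal h) := by
        rw [← ENNReal.ofReal_mul hr]
        gcongr
        exact hy.trans (by gcongr; exact ENNReal.ofReal_add_le)
    _ ≤ ENNReal.ofReal (r * A) * ENNReal.ofReal d + C * (ENNReal.ofReal r *
          (ENNReal.ofReal (r * A) * ENNReal.ofReal d) + ENNReal.ofReal h) := by gcongr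
    _ ≤ ENNReal.ofReal r := by
        refine le_trans (le_of_eq ?_) hsmall
        ring

section Coupled

variable {ΓD : Set (E n)} {ν : E 2 → ℝ} {ν₂ Lν γ κ₁ κ₂ κ₃ a : ℝ} {α : E 2} {g : E n}
  {k : Fin 2 → E n → ℝ} {k₀ r ε Chat : ℝ} {φD : Lp (E 2) 2 (surf ΓD)} {φ χ : H1 Ω 2}

lemma norm_le_mul_of_solvesFlow (hν : Continuous ν) (hν₂ : ∀ a, |ν a| ≤ ν₂) {hc : c1 Ω ≠ ⊤}
    (ha : 0 < a) {w : H10 Ω n} {x : HH Ω}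
    (hAB : ∀ x, a / 2 * ‖x‖ ^ 2 ≤ flowAB (viscOp ν φ) hc γ κ₁ κ₂ κ₃ w x x) (hφ : ‖φ‖ ≤ r)
    (hx : SolvesFlow Ω ν γ κ₁ κ₂ κ₃ α g w φ x) : ‖x‖ ≤ r * CA a κ₂ * (‖α‖ * ‖g‖) := by
  have hCA := CA_nonneg (κ₂ := κ₂) ha.le
  calc ‖x‖ ≤ CA a κ₂ * (‖α‖ * ‖g‖ * ‖φ.1.fst‖) := norm_le_of_solvesFlow hν hν₂ ha hAB hx
    _ ≤ CA a κ₂ * (‖α‖ * ‖g‖ * r) := by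
        gcongr
        exact (WithLp.norm_fst_le _ φ.1).trans hφ
    _ = r * CA a κ₂ * (‖α‖ * ‖g‖) := by ring

lemma ofReal_norm_le_mul_of_solvesTransport (hk : ∀ i, MemLp (k i) ⊤ Ω.vol) (hk₀ : 0 < k₀)
    (hk₀k : ∀ᵐ x ∂Ω.vol, ∀ i, k₀ ≤ k i x) (hell : ellC Ω ΓD k₀ ≠ 0) (hc : c1 Ω ≠ ⊤) (hn : 2 ≤ n)
    (hφD : φD ∈ HHalf Ω ΓD) {w : H10 Ω n} (hφ : ‖φ‖ ≤ r) (hχ : SolvesTransport Ω k φD w φ χ) :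
    ENNReal.ofReal ‖χ‖ ≤ CB Ω ΓD k k₀ * ENNReal.ofReal (r * ‖w‖ + halfNorm Ω φD) := by
  refine (ofReal_norm_le_of_solvesTransport hk hk₀ hk₀k hell hc hn hφD hχ).trans ?_
  rw [mul_comm ‖w‖]
  gcongr

lemma norm_vel_add_norm_le_of_smallness (hν : Continuous ν) (hν₂ : ∀ a, |ν a| ≤ ν₂)
    (hk : ∀ i, MemLp (k i) ⊤ Ω.vol) (hk₀ : 0 < k₀) (hk₀k : ∀ᵐ x ∂Ω.vol, ∀ i, k₀ ≤ k i x)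
    (hell : ellC Ω ΓD k₀ ≠ 0) (hc : c1 Ω ≠ ⊤) (hn : 2 ≤ n) (hφD : φD ∈ HHalf Ω ΓD) (ha : 0 < a)
    {w : H10 Ω n} {x : HH Ω}
    (hAB : ∀ x, a / 2 * ‖x‖ ^ 2 ≤ flowAB (viscOp ν φ) hc γ κ₁ κ₂ κ₃ w x x)
    (hsmall : ENNReal.ofReal (r * CA a κ₂) * (1 + ENNReal.ofReal r * CB Ω ΓD k k₀) *
        ENNReal.ofReal (‖α‖ * ‖g‖)
      + CB Ω ΓD k k₀ * ENNReal.ofReal (halfNorm Ω φD) ≤ ENNReal.ofReal r)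
    (hφ : ‖φ‖ ≤ r) (hx : SolvesFlow Ω ν γ κ₁ κ₂ κ₃ α g w φ x)
    (hχ : SolvesTransport Ω k φD x.vel φ χ) : ‖x.vel‖ + ‖χ‖ ≤ r :=
  add_le_of_smallness ((norm_nonneg φ).trans hφ) (CA_nonneg ha.le)
    (x.norm_vel_le.trans (norm_le_mul_of_solvesFlow hν hν₂ ha hAB hφ hx))
    (ofReal_norm_le_mul_of_solvesTransport hk hk₀ hk₀k hell hc hn hφD hφ hχ) hsmall

lemma LLip_eq (Ω : PolyhedralDomain n) (ΓD : Set (E n)) (a Lν κ₂ κ₃ ε k₀ r Chat d : ℝ) :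
    LLip Ω ΓD a Lν κ₂ κ₃ ε k₀ r Chat d =
      (1 + LB Ω ΓD k₀ r) * (LA Ω a Lν κ₂ κ₃ ε * ENNReal.ofReal d * ENNReal.ofReal (r * CA a κ₂))
      + (1 + LB Ω ΓD k₀ r) * (LA Ω a Lν κ₂ κ₃ ε * ENNReal.ofReal d
        * (ENNReal.ofReal r * Ceps' Ω ε * ENNReal.ofReal Chat + 1))
      + LB Ω ΓD k₀ r := by
  rw [LLip]
  ring

variable (ν γ κ₁ κ₂ κ₃ α g k φD) in
lemma existsUnique_isSolution_congr : (∃! p : HH Ω × H1 Ω 2,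
      IsSolution Ω ν γ κ₁ κ₂ κ₃ α g k φD p.1 p.2 ∧ ‖p.1.vel‖ + ‖p.2‖ ≤ r) ↔
    ∃! p : HH Ω × H1 Ω 2, SolvesFlow Ω ν γ κ₁ κ₂ κ₃ α g p.1.vel p.2 p.1 ∧
      SolvesTransport Ω k φD p.1.vel p.2 p.2 ∧ (p.1.vel, p.2) ∈ ballW Ω r :=
  existsUnique_congr fun p => by rw [isSolution_iff, and_assoc, mem_ballW]

lemma existsUnique_isSolution (hn : 2 ≤ n) (hLip : LipschitzWith Lν.toNNReal ν)
    (hν₂ : ∀ a, |ν a| ≤ ν₂) (hLν : 0 ≤ Lν) (hk : ∀ i, MemLp (k i) ⊤ Ω.vol) (hk₀ : 0 < k₀)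
    (hk₀k : ∀ᵐ x ∂Ω.vol, ∀ i, k₀ ≤ k i x) (hell : ellC Ω ΓD k₀ ≠ 0) (hc : c1 Ω ≠ ⊤)
    (hφD : φD ∈ HHalf Ω ΓD) (ha : 0 < a) (hr : 0 ≤ r)
    (hAB : ∀ (w : H10 Ω n) (φ : H1 Ω 2), ‖w‖ ≤ r → ∀ x,
      a / 2 * ‖x‖ ^ 2 ≤ flowAB (viscOp ν φ) hc γ κ₁ κ₂ κ₃ w x x)
    (hε : 0 < ε) (hεn : 2 * ε < n) (hChat : 0 ≤ Chat)
    (hreg : ∀ (w : H10 Ω n) (φ : H1 Ω 2), ‖w‖ + ‖φ‖ ≤ r →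
      ∀ x : HH Ω, SolvesFlow Ω ν γ κ₁ κ₂ κ₃ α g w φ x →
        fracNorm ε x.t ≤ ENNReal.ofReal (Chat * (‖α‖ * ‖g‖) * r))
    (hsmall : ENNReal.ofReal (r * CA a κ₂) * (1 + ENNReal.ofReal r * CB Ω ΓD k k₀) *
        ENNReal.ofReal (‖α‖ * ‖g‖)
      + CB Ω ΓD k k₀ * ENNReal.ofReal (halfNorm Ω φD) ≤ ENNReal.ofReal r)
    (hcontr : LLip Ω ΓD a Lν κ₂ κ₃ ε k₀ r Chat (‖α‖ * ‖g‖) < 1) :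
    ∃! p : HH Ω × H1 Ω 2,
      IsSolution Ω ν γ κ₁ κ₂ κ₃ α g k φD p.1 p.2 ∧ ‖p.1.vel‖ + ‖p.2‖ ≤ r := by
  have hν : Continuous ν := hLip.continuous
  have hball : ∀ p ∈ ballW Ω r, ∀ x, SolvesFlow Ω ν γ κ₁ κ₂ κ₃ α g p.1 p.2 x → ∀ χ,
      SolvesTransport Ω k φD x.vel p.2 χ → (x.vel, χ) ∈ ballW Ω r := fun p hp x hx χ hχ =>
    norm_vel_add_norm_le_of_smallness hν hν₂ hk hk₀ hk₀k hell hc hn hφD ha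
      (hAB _ _ (norm_fst_le_of_mem_ballW hp)) hsmall (norm_snd_le_of_mem_ballW hp) hx hχ
  have hflow := fun p (hp : p ∈ ballW Ω r) p' (hp' : p' ∈ ballW Ω r) x x'
      (hx : SolvesFlow Ω ν γ κ₁ κ₂ κ₃ α g p.1 p.2 x)
      (hx' : SolvesFlow Ω ν γ κ₁ κ₂ κ₃ α g p'.1 p'.2 x') =>
    edist_le_of_solvesFlow hLip hν₂ hε hεn ha hr hLν hChat
      (hAB p.1 p.2 (norm_fst_le_of_mem_ballW hp)) hx hx' (hreg p'.1 p'.2 hp' x' hx')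
      (x'.norm_vel_le.trans <| norm_le_mul_of_solvesFlow hν hν₂ ha
        (hAB _ _ (norm_fst_le_of_mem_ballW hp')) (norm_snd_le_of_mem_ballW hp') hx')
  have htransport := fun p (hp : p ∈ ballW Ω r) p' (hp' : p' ∈ ballW Ω r) (x x' : HH Ω)
      (_ : SolvesFlow Ω ν γ κ₁ κ₂ κ₃ α g p.1 p.2 x)
      (hx' : SolvesFlow Ω ν γ κ₁ κ₂ κ₃ α g p'.1 p'.2 x') χ χ'
      (hχ : SolvesTransport Ω k φD x.vel p.2 χ) (hχ' : SolvesTransport Ω k φD x'.vel p'.2 χ') =>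
    edist_le_of_solvesTransport hk hk₀ hk₀k hell hc hn hχ hχ' (norm_snd_le_of_mem_ballW hp)
      (norm_fst_le_of_mem_ballW (hball p' hp' x' hx' χ' hχ'))
  have hexists := fun p (hp : p ∈ ballW Ω r) x (hx : SolvesFlow Ω ν γ κ₁ κ₂ κ₃ α g p.1 p.2 x) =>
    (exists_solvesTransport hk hk₀ hk₀k hell hc hn hφD).imp fun χ hχ =>
      And.intro hχ (hball p hp x hx χ hχ)
  exact (existsUnique_isSolution_congr ν γ κ₁ κ₂ κ₃ α g k φD).2 <|
    existsUnique_coupled_fixedPoint HH.lipschitzWith_vel isClosed_ballW ⟨0, zero_mem_ballW hr⟩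
      (fun p hp => exists_solvesFlow hν hν₂ ha (hAB p.1 p.2 (norm_fst_le_of_mem_ballW hp)))
      hexists hflow htransport ((LLip_eq ..).symm.trans_lt hcontr)

end Coupled

lemma half_mul_norm_sq_le_flowAB {ν : E 2 → ℝ} {ν₁ ν₂ γ κ₁ κ₂ κ₃ δ₁ δ₂ δ₃ r : ℝ}
    (hν : Continuous ν) (hν₁ : ∀ a, ν₁ ≤ ν a) (hν₂ : ∀ a, |ν a| ≤ ν₂) (hγ : 0 ≤ γ) (hκ₁ : 0 ≤ κ₁)
    (hκ₂ : 0 ≤ κ₂) (hκ₃ : 0 ≤ κ₃) (hδ₁ : 0 < δ₁) (hδ₂ : 0 < δ₂) (hδ₃ : 0 < δ₃) (hr : 0 ≤ r)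
    (hr₀ : ENNReal.ofReal r < r0 Ω (ellA Ω ν₁ ν₂ γ κ₁ κ₂ κ₃ δ₁ δ₂ δ₃) κ₃) (hc : c1 Ω ≠ ⊤)
    {w : H10 Ω n} (φ : H1 Ω 2) (hw : ‖w‖ ≤ r) (x : HH Ω) :
    ellA Ω ν₁ ν₂ γ κ₁ κ₂ κ₃ δ₁ δ₂ δ₃ / 2 * ‖x‖ ^ 2 ≤
      flowAB (viscOp ν φ) hc γ κ₁ κ₂ κ₃ w x x := by
  refine flowAB_coercive hc
    (flowA_coercive ((abs_nonneg _).trans (hν₂ 0)) hγ hκ₁ hκ₂ hκ₃ hδ₁ hδ₂ hδ₃ (pos_of_lt_r0 hr₀)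
      (norm_viscOp_le hν hν₂ φ) (le_inner_viscOp hν hν₂ hν₁ φ)) ?_ x
  exact (by gcongr : _ ≤ _).trans (mul_le_half_of_lt_r0 hr hr₀)

end

end DoubleDiffusive

theorem mainTheorem1_general {n : ℕ} (hn : 2 ≤ n) (Ω : PolyhedralDomain n) (ΓD : Set (E n))
    (ν : E 2 → ℝ) (ν₁ ν₂ Lν : ℝ) (hν₁ : ∀ a, ν₁ ≤ ν a) (hν₂ : ∀ a, |ν a| ≤ ν₂)
    (hν : LipschitzWith Lν.toNNReal ν) (hLν : 0 ≤ Lν)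
    (k : Fin 2 → E n → ℝ) (k₀ : ℝ) (hk₀ : 0 < k₀) (hkinf : ∀ i, MemLp (k i) ⊤ Ω.vol)
    (hk : ∀ᵐ x ∂Ω.vol, ∀ i, k₀ ≤ k i x)
    (γ : ℝ) (hγ : 0 ≤ γ) (α : E 2) (g : E n)
    (φD : Lp (E 2) 2 (surf ΓD)) (hφD : φD ∈ HHalf Ω ΓD)
    (κ₁ κ₂ κ₃ δ₁ δ₂ δ₃ : ℝ) (hκ₁ : 0 ≤ κ₁) (hκ₂ : 0 ≤ κ₂) (hκ₃ : 0 ≤ κ₃)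
    (hδ₁ : 0 < δ₁) (hδ₂ : 0 < δ₂) (hδ₃ : 0 < δ₃)
    (a : ℝ) (ha : a = ellA Ω ν₁ ν₂ γ κ₁ κ₂ κ₃ δ₁ δ₂ δ₃)
    (r : ℝ) (hr : 0 < r) (hr₀ : ENNReal.ofReal r < r0 Ω a κ₃)
    (ε : ℝ) (hε : ε ∈ Set.Ioo 0 1) (Chat : ℝ) (hChat : 0 ≤ Chat)
    (hreg : ∀ (w : H10 Ω n) (φ : H1 Ω 2), ‖w‖ + ‖φ‖ ≤ r →
      ∀ x : HH Ω, SolvesFlow Ω ν γ κ₁ κ₂ κ₃ α g w φ x →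
        fracNorm ε x.t ≤ ENNReal.ofReal (Chat * ‖α‖ * ‖g‖ * ‖φ.1.fst‖))
    (hsmall : ENNReal.ofReal (r * CA a κ₂) * (1 + ENNReal.ofReal r * CB Ω ΓD k k₀) *
        ENNReal.ofReal (‖α‖ * ‖g‖)
      + CB Ω ΓD k k₀ * ENNReal.ofReal (halfNorm Ω φD) ≤ ENNReal.ofReal r)
    (hLip : LLip Ω ΓD a Lν κ₂ κ₃ ε k₀ r Chat (‖α‖ * ‖g‖) < 1) :
    (∃! p : HH Ω × H1 Ω 2,
      IsSolution Ω ν γ κ₁ κ₂ κ₃ α g k φD p.1 p.2 ∧ ‖p.1.vel‖ + ‖p.2‖ ≤ r) ∧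
    ∀ (x : HH Ω) (φ : H1 Ω 2),
      IsSolution Ω ν γ κ₁ κ₂ κ₃ α g k φD x φ → ‖x.vel‖ + ‖φ‖ ≤ r →
        ‖x‖ ≤ CA a κ₂ * r * ‖α‖ * ‖g‖ ∧
        ENNReal.ofReal ‖φ‖ ≤ CB Ω ΓD k k₀ * ENNReal.ofReal (r * ‖x.vel‖ + halfNorm Ω φD) := by
  have : NeZero n := ⟨by omega⟩
  have ha₀ : 0 < a := pos_of_lt_r0 hr₀
  have hc : c1 Ω ≠ ⊤ := c1_ne_top_of_lt_r0 hr₀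
  have hell : ellC Ω ΓD k₀ ≠ 0 :=
    ellC_ne_zero_of_LB_ne_top hr (ne_top_of_lt (le_add_self.trans_lt hLip))
  have hAB (w : H10 Ω n) (φ : H1 Ω 2) (hw : ‖w‖ ≤ r) (x : HH Ω) :
      a / 2 * ‖x‖ ^ 2 ≤ flowAB (viscOp ν φ) hc γ κ₁ κ₂ κ₃ w x x := by
    subst ha
    exact half_mul_norm_sq_le_flowAB hν.continuous hν₁ hν₂ hγ hκ₁ hκ₂ hκ₃ hδ₁ hδ₂ hδ₃ hr.le hr₀
      hc φ hw x
  have hεn : 2 * ε < n := by linarith [hε.2, show (2 : ℝ) ≤ n from mod_cast hn]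
  refine ⟨existsUnique_isSolution hn hν hν₂ hLν hkinf hk₀ hk hell hc hφD ha₀ hr.le hAB hε.1 hεn
    hChat (fun w φ hwφ x hx => (hreg w φ hwφ x hx).trans ?_) hsmall hLip,
    fun x φ hxφ hball => ?_⟩
  · rw [mul_assoc Chat]
    have hφ : ‖φ.1.fst‖ ≤ r := (WithLp.norm_fst_le _ φ.1).trans (norm_snd_le_of_mem_ballW hwφ)
    gcongr
  · obtain ⟨hflow, htransport⟩ := isSolution_iff.1 hxφ
    have hw : ‖x.vel‖ ≤ r := norm_fst_le_of_mem_ballW hball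
    have hφ : ‖φ‖ ≤ r := norm_snd_le_of_mem_ballW hball
    have hbound := norm_le_mul_of_solvesFlow hν.continuous hν₂ ha₀ (hAB _ φ hw) hφ hflow
    exact ⟨hbound.trans_eq (by ring),
      ofReal_norm_le_mul_of_solvesTransport hkinf hk₀ hk hell hc hn hφD hφ htransport⟩

theorem mainTheorem1 {n : ℕ} (hn : n = 2 ∨ n = 3) (Ω : PolyhedralDomain n)
    -- the Dirichlet part of the boundary
    (ΓD : Set (E n)) (hΓD : ΓD ⊆ Ω.boundary) (hΓDm : MeasurableSet ΓD)
    (hΓDpos : 0 < surf ΓD Set.univ)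
    -- viscosity
    (ν : E 2 → ℝ) (ν₁ ν₂ Lν : ℝ) (hν₁ : 0 < ν₁) (hν₂ : 0 < ν₂) (hLν : 0 < Lν)
    (hν : ∀ a, ν₁ ≤ ν a ∧ ν a ≤ ν₂) (hνLip : ∀ a b, |ν a - ν b| ≤ Lν * ‖a - b‖)
    -- diffusion tensor
    (k : Fin 2 → E n → ℝ) (k₀ : ℝ) (hk₀ : 0 < k₀) (hkinf : ∀ i, MemLp (k i) ⊤ Ω.vol)
    (hk : ∀ᵐ x ∂Ω.vol, ∀ i, k₀ ≤ k i x)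
    -- inverse Darcy number, expansion coefficients, gravity, Dirichlet datum
    (γ : ℝ) (hγ : 0 < γ) (α : E 2) (g : E n)
    (φD : Lp (E 2) 2 (surf ΓD)) (hφD : φD ∈ HHalf Ω ΓD)
    -- stabilization parameters
    (κ₁ κ₂ κ₃ δ₁ δ₂ δ₃ : ℝ)
    (hδ₁ : δ₁ ∈ Set.Ioo 0 (1 / ν₂)) (hδ₂ : δ₂ ∈ Set.Ioo 0 (2 / γ)) (hδ₃ : δ₃ ∈ Set.Ioo 0 1)
    (hκ₃ : κ₃ ∈ Set.Ioo 0 (2 * ν₁ * δ₁ / ν₂)) (hκ₂ : κ₂ ∈ Set.Ioo 0 (2 * δ₂))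
    (hκ₁ : κ₁ ∈ Set.Ioo 0 (2 * δ₃ * (2 * ν₁ - κ₃ * ν₂ / δ₁)))
    -- ellipticity constant and radius of the ball
    (a : ℝ) (ha : a = ellA Ω ν₁ ν₂ γ κ₁ κ₂ κ₃ δ₁ δ₂ δ₃)
    (r : ℝ) (hr : 0 < r) (hr₀ : ENNReal.ofReal r < r0 Ω a κ₃)
    -- assumed `ε`-regularity of the operator `𝒜`
    (ε : ℝ) (hε₂ : n = 2 → ε ∈ Set.Ioo 0 1) (hε₃ : n = 3 → ε ∈ Set.Ico (1 / 2) 1)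
    (Chat : ℝ) (hChat : 0 < Chat)
    (hreg : ∀ (w : H10 Ω n) (φ : H1 Ω 2), ‖w‖ + ‖φ‖ ≤ r →
      ∀ x : HH Ω, SolvesFlow Ω ν γ κ₁ κ₂ κ₃ α g w φ x →
        fracNorm ε x.t ≤ ENNReal.ofReal (Chat * ‖α‖ * ‖g‖ * ‖φ.1.fst‖))
    -- smallness of the data
    (hsmall : ENNReal.ofReal (r * CA a κ₂) * (1 + ENNReal.ofReal r * CB Ω ΓD k k₀) *
        ENNReal.ofReal (‖α‖ * ‖g‖)
      + CB Ω ΓD k k₀ * ENNReal.ofReal (halfNorm Ω φD) ≤ ENNReal.ofReal r)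
    (hLip : LLip Ω ΓD a Lν κ₂ κ₃ ε k₀ r Chat (‖α‖ * ‖g‖) < 1) :
    (∃! p : HH Ω × H1 Ω 2,
      IsSolution Ω ν γ κ₁ κ₂ κ₃ α g k φD p.1 p.2 ∧ ‖p.1.vel‖ + ‖p.2‖ ≤ r) ∧
    ∀ (x : HH Ω) (φ : H1 Ω 2),
      IsSolution Ω ν γ κ₁ κ₂ κ₃ α g k φD x φ → ‖x.vel‖ + ‖φ‖ ≤ r →
        ‖x‖ ≤ CA a κ₂ * r * ‖α‖ * ‖g‖ ∧
        ENNReal.ofReal ‖φ‖ ≤ CB Ω ΓD k k₀ * ENNReal.ofReal (r * ‖x.vel‖ + halfNorm Ω φD) := by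
  have hε : ε ∈ Set.Ioo 0 1 :=
    hn.elim hε₂ fun h => ⟨one_half_pos.trans_le (hε₃ h).1, (hε₃ h).2⟩
  exact mainTheorem1_general (by omega) Ω ΓD ν ν₁ ν₂ Lν (fun b => (hν b).1)
    (fun b => (abs_of_pos (hν₁.trans_le (hν b).1)).trans_le (hν b).2)
    (LipschitzWith.of_dist_le' fun b b' => by
      simpa only [dist_eq_norm, Real.norm_eq_abs] using hνLip b b')
    hLν.le k k₀ hk₀ hkinf hk γ hγ.le α g φD hφD κ₁ κ₂ κ₃ δ₁ δ₂ δ₃ hκ₁.1.le hκ₂.1.le hκ₃.1.le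
    hδ₁.1 hδ₂.1 hδ₃.1 a ha r hr hr₀ ε hε Chat hChat.le hreg hsmall hLip
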